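/- Consider the class of equations $$u_t+a(t)uu_{xxx}+b(t)u_xu_{xx}+c(t)u^2u_x+f(t)uu_x+g(t)u_{xxxxx}+h(t)u_{xxx}+m(t)u+n(t)u_x+k(t)xu_x=0,\qquad(1)$$ where the arbitrary elements $\theta=(a,b,c,f,g,h,m,n,k)$ are real smooth functions of $t$ on an open interval with $g\,(a^2+b^2+c^2)\neq0$ everywhere on it. An admissible transformation of a subclass of (1) is a triple consisting of two equations of the subclass and a nondegenerate point transformation of the variables $(t,x,u)$, defined on a domain of the $(t,x,u)$-space, whose prolongation to the fifth-order jet space maps the first equation to the second. The generalized extended equivalence group of a subclass consists of the invertible transformations of the joint space of variables and arbitrary elements that preserve the subclass and whose components for $(t,x,u)$ are, for every fixed $\theta$, a point transformation from the equation of $\theta$ to the equation of the new arbitrary elements $\tilde\theta$; both the new arbitrary elements and the components for $(t,x,u)$ may depend on $\theta$, also nonlocally. The subclass is normalized with respect to this group if every admissible transformation is induced by an element of the group (over the time intervals covered by the domain of the transformation and by its image). Then the subclass of (1) singled out by $k=0$ is normalized with respect to its generalized extended equivalence group, and this group consists of the transformations that have, at each $\theta$ of the subclass, the form $$\tilde t=\alpha(t),\quad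 \tilde x=\beta x+\gamma(t),\quad \tilde u=\varphi(t)\bigl(u+\sigma e^{-\int m\,dt}\bigr),$$ $$\tilde a=\frac{\beta^3}{\alpha_t\varphi}a,\quad \tilde b=\frac{\beta^3}{\alpha_t\varphi}b,\quad \tilde c=\frac{\beta}{\alpha_t\varphi^2}c,\quad \tilde f=\frac{\beta}{\alpha_t\varphi}\bigl(f-2\sigma ce^{-\int m\,dt}\bigr),\quad \tilde g=\frac{\beta^5}{\alpha_t}g,$$ $$\tilde h=\frac{\beta^3}{\alpha_t}\bigl(h-\sigma ae^{-\int m\,dt}\bigr),\quad \tilde m=\frac1{\alpha_t}\Bigl(m-\frac{\varphi_t}{\varphi}\Bigr),\quad \tilde n=\frac{\beta}{\alpha_t}\Bigl(n+\Bigl(\frac{\gamma}{\beta}\Bigr)_t+\sigma^2ce^{-2\int m\,dt}-\sigma fe^{-\int m\,dt}\Bigr),\quad \tilde k=k=0,$$ where $\tilde a,\dots,\tilde k$ are taken at $\tilde t=\alpha(t)$, $\int m\,dt$ is a fixed antiderivative of $m$ (vanishing at a fixed point $t_0$), $\alpha,\gamma,\varphi$ are smooth functions of $t$ and $\beta,\sigma$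 are constants with $\alpha_t\beta\varphi\neq0$. All such values of the parameters occur; in particular, any fixed choice of them, the same for all $\theta$, gives an element of the group. -/

import Mathlib

open Set Filter Topology
open scoped ContDiff

namespace VCKdV

/-- The space of the variables `(t, x, u)`. -/
abbrev Space : Type := ℝ × ℝ × ℝ

/-- Nonempty open intervals of the time axis (bounded or not). -/
def IsOpenInterval (I : Set ℝ) : Prop := IsOpen I ∧ IsConnected I

/-- A tuple of arbitrary elements `(a, b, c, f, g, h, m, n, k)`, functions of `t`. -/
@[ext] structure Coeffs where
  a : ℝ → ℝ
  b : ℝ → ℝ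
  c : ℝ → ℝ
  f : ℝ → ℝ
  g : ℝ → ℝ
  h : ℝ → ℝ
  m : ℝ → ℝ
  n : ℝ → ℝ
  k : ℝ → ℝ

/-- Restriction to `J ⊆ ℝ`. A function on `J` is represented by its extension by zero to `ℝ`,
so that functions on `J` are equal as soon as they agree at every point of `J`. -/
noncomputable def Coeffs.restrict (θ : Coeffs) (J : Set ℝ) : Coeffs where
  a := J.indicator θ.a
  b := J.indicator θ.b
  c := J.indicator θ.c
  f := J.indicator θ.f
  g := J.indicator θ.g
  h := J.indicator θ.h
  m := J.indicator θ.m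
  n := J.indicator θ.n
  k := J.indicator θ.k

/-- The arbitrary elements, defined on the time interval `I`, of the class of equations
`u_t + a u u_xxx + b u_x u_xx + c u² u_x + f u u_x + g u_xxxxx + h u_xxx + m u + n u_x + k x u_x = 0`:
smooth functions on `I` such that `g (a² + b² + c²)` has no zero on `I`. -/
structure Coeffs.MemClass (θ : Coeffs) (I : Set ℝ) : Prop where
  smooth_a : ContDiffOn ℝ ∞ θ.a I
  smooth_b : ContDiffOn ℝ ∞ θ.b I
  smooth_c : ContDiffOn ℝ ∞ θ.c I
  smooth_f : ContDiffOn ℝ ∞ θ.f I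
  smooth_g : ContDiffOn ℝ ∞ θ.g I
  smooth_h : ContDiffOn ℝ ∞ θ.h I
  smooth_m : ContDiffOn ℝ ∞ θ.m I
  smooth_n : ContDiffOn ℝ ∞ θ.n I
  smooth_k : ContDiffOn ℝ ∞ θ.k I
  ne_zero : ∀ t ∈ I, θ.g t * (θ.a t ^ 2 + θ.b t ^ 2 + θ.c t ^ 2) ≠ 0
  restrict_eq : θ.restrict I = θ

/-- The arbitrary elements on `I` of the subclass singled out by `k = 0`. -/
def Subclass (I : Set ℝ) : Type := {θ : Coeffs // θ.MemClass I ∧ ∀ t ∈ I, θ.k t = 0}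

/-- The function `u` of `(t, x)` satisfies, at the point `(t, x) = p`, the equation with the
arbitrary elements `θ`. This is a condition on the 5-jet of `u` at `p` only. -/
def Satisfies (θ : Coeffs) (u : ℝ × ℝ → ℝ) (p : ℝ × ℝ) : Prop :=
  deriv (fun s => u (s, p.2)) p.1
    + θ.a p.1 * u p * iteratedDeriv 3 (fun y => u (p.1, y)) p.2
    + θ.b p.1 * iteratedDeriv 1 (fun y => u (p.1, y)) p.2
        * iteratedDeriv 2 (fun y => u (p.1, y)) p.2
    + θ.c p.1 * u p ^ 2 * iteratedDeriv 1 (fun y => u (p.1, y)) p.2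
    + θ.f p.1 * u p * iteratedDeriv 1 (fun y => u (p.1, y)) p.2
    + θ.g p.1 * iteratedDeriv 5 (fun y => u (p.1, y)) p.2
    + θ.h p.1 * iteratedDeriv 3 (fun y => u (p.1, y)) p.2
    + θ.m p.1 * u p
    + θ.n p.1 * iteratedDeriv 1 (fun y => u (p.1, y)) p.2
    + θ.k p.1 * p.2 * iteratedDeriv 1 (fun y => u (p.1, y)) p.2 = 0

/-- The new independent variables `(t̃, x̃)`, evaluated along the graph of `u`. -/
def baseMap (F : Space → Space) (u : ℝ × ℝ → ℝ) (q : ℝ × ℝ) : ℝ × ℝ :=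
  ((F (q.1, q.2, u q)).1, (F (q.1, q.2, u q)).2.1)

/-- Near `p`, the map `F` of the `(t, x, u)`-space takes the graph of `u` to the graph of `v`, the
new independent variables being local coordinates on it. If everything is smooth, this means
that the prolongation of `F` to jets is defined at the jet of `u` at `p` and takes it to the jet
of `v` at `baseMap F u p`. -/
def MapsGraph (F : Space → Space) (u v : ℝ × ℝ → ℝ) (p : ℝ × ℝ) : Prop :=
  (fderiv ℝ (baseMap F u) p).IsInvertible ∧
    ∀ᶠ q in 𝓝 p, (F (q.1, q.2, u q)).2.2 = v (baseMap F u q)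

/-- `F`, considered on the domain `Ω` of the `(t, x, u)`-space, is a nondegenerate point
transformation from the equation with the arbitrary elements `θ` on the time interval `I` to the
equation with the arbitrary elements `η` on the time interval `J`: its prolongation to the
fifth-order jet space identifies the two equations. That is, `(θ, η, F)` is an admissible
transformation. -/
structure IsPointTransf (I J : Set ℝ) (θ η : Coeffs) (Ω : Set Space) (F : Space → Space) :
    Prop where
  isOpen : IsOpen Ω
  isConnected : IsConnected Ω
  subset : ∀ z ∈ Ω, z.1 ∈ I
  mapsTo : ∀ z ∈ Ω, (F z).1 ∈ J
  smooth : ContDiffOn ℝ ∞ F Ω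
  nondegenerate : ∀ z ∈ Ω, (fderiv ℝ F z).IsInvertible
  satisfies_iff : ∀ (u v : ℝ × ℝ → ℝ) (p : ℝ × ℝ), (p.1, p.2, u p) ∈ Ω →
    ContDiffAt ℝ ∞ u p → ContDiffAt ℝ ∞ v (baseMap F u p) → MapsGraph F u v p →
      (Satisfies θ u p ↔ Satisfies η v (baseMap F u p))

/-- The space of the variables `(t, x, u)` over the time interval `I`. -/
abbrev Cyl (I : Set ℝ) : Type := {z : Space // z.1 ∈ I}

/-- The joint space of the arbitrary elements of the subclass `k = 0` and of the variables. -/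
abbrev Joint (I : Set ℝ) : Type := Subclass I × Cyl I

/-- Generalized extended equivalence transformations of the subclass `k = 0`: invertible
transformations of the joint space of arbitrary elements and variables which preserve the subclass.
The new arbitrary elements `E θ` may depend on the old ones in a nonlocal way,
and the components `F θ` for the variables may depend on the arbitrary elements, also nonlocally.
Every `F θ` has to be a point transformation from the equation of `θ` to the equation of `E θ`. -/
def IsEquivTransf {I J : Set ℝ} (𝒯 : Joint I ≃ Joint J) : Prop :=
  ∃ (E : Subclass I ≃ Subclass J) (F : Subclass I → Space → Space),
    (∀ (θ : Subclass I) (z : Cyl I), (𝒯 (θ, z)).1 = E θ ∧ ((𝒯 (θ, z)).2 : Space) = F θ z) ∧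
    ∀ θ : Subclass I, IsPointTransf I J θ.1 (E θ).1 {z | z.1 ∈ I} (F θ)

/-- The parameters `α`, `β`, `γ`, `φ` (functions of `t`) and `σ` (a constant). -/
structure Params where
  α : ℝ → ℝ
  β : ℝ → ℝ
  γ : ℝ → ℝ
  φ : ℝ → ℝ
  σ : ℝ

/-- `α`, `β`, `γ`, `φ` are smooth on `I`, `α_t β φ ≠ 0` there, and `α` takes `I` onto `J`. -/
structure Params.Valid (P : Params) (I J : Set ℝ) : Prop where
  smooth_α : ContDiffOn ℝ ∞ P.α I
  smooth_β : ContDiffOn ℝ ∞ P.β I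
  smooth_γ : ContDiffOn ℝ ∞ P.γ I
  smooth_φ : ContDiffOn ℝ ∞ P.φ I
  ne_zero : ∀ t ∈ I, deriv P.α t * P.β t * P.φ t ≠ 0
  image_eq : P.α '' I = J

/-- `exp (-∫ m dt)`, with the antiderivative of `m` that vanishes at `t₀`. -/
noncomputable def expInt (t₀ : ℝ) (θ : Coeffs) (t : ℝ) : ℝ := Real.exp (-∫ s in t₀..t, θ.m s)

/-- `(t, x, u) ↦ (α(t), β(t) x + γ(t), φ(t) (u + σ exp (-∫ m dt)))`. -/
noncomputable def Params.pointMap (P : Params) (t₀ : ℝ) (θ : Coeffs) (z : Space) : Space :=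
  (P.α z.1, P.β z.1 * z.2.1 + P.γ z.1, P.φ z.1 * (z.2.2 + P.σ * expInt t₀ θ z.1))

/-- The expressions of the new arbitrary elements `η`, taken at `t̃ = α(t)`, through the old
arbitrary elements `θ`, taken at `t`, for all `t ∈ I`. -/
structure Params.CoeffRel (P : Params) (I : Set ℝ) (t₀ : ℝ) (θ η : Coeffs) : Prop where
  a_eq : ∀ t ∈ I, η.a (P.α t) = P.β t ^ 3 / (deriv P.α t * P.φ t) * θ.a t
  b_eq : ∀ t ∈ I, η.b (P.α t) = P.β t ^ 3 / (deriv P.α t * P.φ t) * θ.b t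
  c_eq : ∀ t ∈ I, η.c (P.α t) = P.β t / (deriv P.α t * P.φ t ^ 2) * θ.c t
  f_eq : ∀ t ∈ I, η.f (P.α t) =
    P.β t / (deriv P.α t * P.φ t) * (θ.f t - 2 * P.σ * θ.c t * expInt t₀ θ t)
  g_eq : ∀ t ∈ I, η.g (P.α t) = P.β t ^ 5 / deriv P.α t * θ.g t
  h_eq : ∀ t ∈ I, η.h (P.α t) =
    P.β t ^ 3 / deriv P.α t * (θ.h t - P.σ * θ.a t * expInt t₀ θ t)
  m_eq : ∀ t ∈ I, η.m (P.α t) = 1 / deriv P.α t * (θ.m t - deriv P.φ t / P.φ t)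
  n_eq : ∀ t ∈ I, η.n (P.α t) =
    P.β t / deriv P.α t * (θ.n t + deriv (fun s => P.γ s / P.β s) t - θ.k t * (P.γ t / P.β t)
      + P.σ ^ 2 * θ.c t * expInt t₀ θ t ^ 2 - P.σ * θ.f t * expInt t₀ θ t)
  k_eq : ∀ t ∈ I, η.k (P.α t) = 1 / deriv P.α t * (θ.k t + deriv P.β t / P.β t)

/-- At the tuple `θ` of arbitrary elements, the transformation `𝒯` of the joint space is given by
the formulas with the parameters `P`. -/
def Params.GivesAt (P : Params) {I J : Set ℝ} (t₀ : ℝ) (𝒯 : Joint I ≃ Joint J) (θ : Subclass I) :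
    Prop :=
  ∀ z : Cyl I, ((𝒯 (θ, z)).2 : Space) = P.pointMap t₀ θ.1 z ∧
    P.CoeffRel I t₀ θ.1 (𝒯 (θ, z)).1.1

/-- The subclass `k = 0` is normalized in the generalized extended sense: every
admissible transformation (on any domain `Ω` of the space of variables)
is induced by a generalized extended equivalence transformation. As the
arbitrary elements matter only at the values of time that occur in `Ω` and in its image, they are
restricted to the corresponding intervals `J` and `J'`. -/
def IsNormalized : Prop :=
  ∀ (I I' : Set ℝ), IsOpenInterval I → IsOpenInterval I' →
    ∀ (θ : Subclass I) (θ' : Subclass I') (Ω : Set Space) (F : Space → Space),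
      IsPointTransf I I' θ.1 θ'.1 Ω F →
      ∃ (J J' : Set ℝ) (η : Subclass J) (η' : Subclass J') (𝒯 : Joint J ≃ Joint J'),
        IsOpenInterval J ∧ IsOpenInterval J' ∧
        J = Prod.fst '' Ω ∧ J' = (fun z => (F z).1) '' Ω ∧
        η.1 = θ.1.restrict J ∧ η'.1 = θ'.1.restrict J' ∧
        IsEquivTransf 𝒯 ∧
        ∀ z : Cyl J, (z : Space) ∈ Ω → (𝒯 (η, z)).1 = η' ∧ ((𝒯 (η, z)).2 : Space) = F z

end VCKdV

open VCKdV

namespace VCKdV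

/-! ### One-variable calculus -/

/-! Let `F = (T, X, U)` identify the equation of `θ` with that of `η`; tildes mark elements of `η`.
The fifth-order prolongation of `F` is never written out. Instead, two polynomials that satisfy the
first equation at a point and differ in a well-chosen way are pushed forward, and the two resulting
instances of the second equation are subtracted. As `g̃ ≠ 0`, a difference in the fifth
`x̃`-derivative is detected. Adding the fifth power of the increment of `t`, which the equation does
not see, gives `T_x = T_u = 0` (`totalDeriv_compT_eq_zero`). Trading `u_xxxxx` against `u_t` gives
`g̃ T_t = g (X_x + u_x X_u)^5` for all admitted values of `u_x` (`g_relation_totalDeriv`), hence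
`X_u = 0` and, by differentiation, `X_xx = 0`. Changing `u_xxxx`, which is absent from the equation,
gives `U_xu = U_uu = 0` (`pd_ex_pd_eu_compU_add`).

The transformed equation is then explicit and polynomial in the free derivatives of `u`, and its
coefficients can be separated (`splitting`). Differentiating the resulting relations in `x` and `u`
yields `ã U_x = b̃ U_x = c̃ U_x = 0`, so `U_x = 0` because `ã, b̃, c̃` have no common zero. The
coefficient of `u_x` then gives `X_tx = 0`, because `k = k̃ = 0`; this is why `β` is constant. The
remaining equations are linear ordinary differential equations in `t` (`determining`); one of them
says that `U / U_u - u` solves `y' = -m y`, which is the origin of `σ exp(-∫ m dt)`.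

The domain `Ω` is connected, but its slices `t = const` need not be, so vanishing derivatives in `x`
and `u` do not by themselves make a function on `Ω` a function of `t`. Each determining equation is
therefore integrated to a quantity that is constant on `Ω`, and the dependence on `t` alone is read
off from it (`exists_params`).

Conversely, direct substitution shows that the given maps are point transformations
(`isPointTransf_pointMap`). The formulas for the arbitrary elements are triangular: `m` comes first,
then the exponential, then the rest; so they can be inverted (`exists_equiv`). Fixed parameters thus
act bijectively on the joint space, which yields normalization. For parameters depending on `θ`,
bijectivity on arbitrary elements is deduced from that of the transformation of the joint space. -/

theorem iteratedDeriv_comp_affine (f : ℝ → ℝ) (a c : ℝ) (n : ℕ) :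
    iteratedDeriv n (fun y => f (a + c * y)) = fun y => c ^ n * iteratedDeriv n f (a + c * y) := by
  induction n with
  | zero => simp
  | succ n ih =>
    rw [iteratedDeriv_succ, ih]
    ext y
    rw [deriv_const_mul_field, iteratedDeriv_succ]
    have h1 : deriv (fun y => iteratedDeriv n f (a + c * y)) y
        = c * deriv (iteratedDeriv n f) (a + c * y) := by
      have := deriv_comp_mul_left c (fun z => iteratedDeriv n f (a + z)) y
      rw [this, deriv_comp_const_add, smul_eq_mul]
    rw [h1]; ring

/-- For positive `n`, multiplication by `y ^ n` shows that the polynomial tends to `0`, so its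
constant term vanishes. One factor `y` is then cancelled and the induction continues. -/
theorem coeff_of_tendsto_div_pow (n : ℕ) (a : ℕ → ℝ) (c : ℝ)
    (h : Tendsto (fun y : ℝ => (∑ j ∈ Finset.range (n + 1), a j * y ^ j) / y ^ n)
      (𝓝[≠] 0) (𝓝 c)) : (∀ j < n, a j = 0) ∧ a n = c := by
  induction n generalizing a with
  | zero =>
    simp only [zero_add, Finset.range_one, Finset.sum_singleton, pow_zero, mul_one, div_one] at h
    exact ⟨by simp, tendsto_nhds_unique tendsto_const_nhds h⟩
  | succ n ih =>
    have hy : Tendsto (fun y : ℝ => y) (𝓝[≠] 0) (𝓝 0) := tendsto_nhdsWithin_of_tendsto_nhds tendsto_id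
    have h0 : a 0 = 0 := by
      have h1 := h.mul (hy.pow (n + 1))
      have h2 : Tendsto (fun y : ℝ => ∑ j ∈ Finset.range (n + 1 + 1), a j * y ^ j) (𝓝[≠] 0)
          (𝓝 (∑ j ∈ Finset.range (n + 1 + 1), a j * 0 ^ j)) :=
        tendsto_finsetSum _ fun j _ => (hy.pow j).const_mul _
      have h3 := tendsto_nhds_unique (h2.congr' ?_) h1
      · rw [Finset.sum_range_succ'] at h3
        simpa using h3
      · filter_upwards [self_mem_nhdsWithin] with y hy
        rw [div_mul_cancel₀ _ (pow_ne_zero _ hy)]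
    obtain ⟨h4, h5⟩ := ih (fun j => a (j + 1)) (h.congr' (by
      filter_upwards [self_mem_nhdsWithin] with y hy
      have hy : y ≠ 0 := hy
      have hs : ∑ j ∈ Finset.range (n + 1), a (j + 1) * y ^ (j + 1)
          = (∑ j ∈ Finset.range (n + 1), a (j + 1) * y ^ j) * y := by
        rw [Finset.sum_mul]
        exact Finset.sum_congr rfl fun j _ => by ring
      rw [Finset.sum_range_succ', h0, zero_mul, add_zero, hs, pow_succ, mul_div_mul_right _ _ hy]))
    refine ⟨fun j hj => ?_, h5⟩
    cases j with
    | zero => exact h0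
    | succ j => exact h4 j (by omega)

/-- The derivatives at `0` of a smooth function `f` with `f(y) = c yⁿ + o(yⁿ)`. -/
theorem iteratedDeriv_of_tendsto_div_pow {f : ℝ → ℝ} (hf : ContDiffAt ℝ ∞ f 0) (n : ℕ) {c : ℝ}
    (h : Tendsto (fun y => f y / y ^ n) (𝓝[≠] 0) (𝓝 c)) :
    (∀ j < n, iteratedDeriv j f 0 = 0) ∧ iteratedDeriv n f 0 = n.factorial * c := by
  have hfn : ContDiffAt ℝ n f 0 := hf.of_le (by exact_mod_cast le_top)
  obtain ⟨s, hs, hfs⟩ := hfn.contDiffOn (m := n) le_rfl (by simp)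
  have hs : s ∈ 𝓝 (0 : ℝ) := by simpa using hs
  obtain ⟨ε, hε, hball⟩ := Metric.mem_nhds_iff.1 hs
  have hfb := hfs.mono hball
  have h0 : (0 : ℝ) ∈ Metric.ball (0 : ℝ) ε := Metric.mem_ball_self hε
  -- By Taylor's theorem with Peano remainder, the Taylor polynomial divided by `y ^ n` has the same
  -- limit as `f y / y ^ n`, so its coefficients are determined.
  have ht := taylor_tendsto (convex_ball (0 : ℝ) ε) h0 hfb
  rw [Metric.isOpen_ball.nhdsWithin_eq h0] at ht
  have ht' := ht.mono_left (nhdsWithin_le_nhds (s := {0}ᶜ))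
  have key := h.sub ht'
  rw [sub_zero] at key
  have := coeff_of_tendsto_div_pow n (fun j => iteratedDeriv j f 0 / j.factorial) c
    (key.congr' (by
      filter_upwards with y
      rw [taylor_within_apply]
      simp only [sub_zero, smul_eq_mul]
      rw [mul_sub, ← div_eq_inv_mul, sub_sub_cancel, ← div_eq_inv_mul]
      congr 1
      refine Finset.sum_congr rfl fun j _ => ?_
      rw [iteratedDerivWithin_of_isOpen Metric.isOpen_ball h0]
      ring))
  have hfac : ∀ j : ℕ, (j.factorial : ℝ) ≠ 0 := fun j => by positivity
  constructor
  · intro j hj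
    simpa [hfac] using this.1 j hj
  · have := this.2
    rw [div_eq_iff (hfac n)] at this
    rw [this, mul_comm]

/-- The polynomial `c₀ + c₁ y + c₂ y² + c₃ y³ + c₄ y⁴ + c₅ y⁵`. -/
def quintic (c₀ c₁ c₂ c₃ c₄ c₅ y : ℝ) : ℝ :=
  c₀ + c₁ * y + c₂ * y ^ 2 + c₃ * y ^ 3 + c₄ * y ^ 4 + c₅ * y ^ 5

theorem contDiff_quintic (c₀ c₁ c₂ c₃ c₄ c₅ : ℝ) : ContDiff ℝ ∞ (quintic c₀ c₁ c₂ c₃ c₄ c₅) := by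
  unfold quintic; fun_prop

theorem iteratedDeriv_sub_right (f : ℝ → ℝ) (n : ℕ) (x : ℝ) :
    iteratedDeriv n (fun y => f (y - x)) x = iteratedDeriv n f 0 := by
  have := congrFun (iteratedDeriv_comp_affine f (-x) 1 n) x
  simp only [one_pow, one_mul, neg_add_cancel] at this
  rw [← this]
  congr 1
  ext y; ring_nf

theorem iteratedDeriv_quintic (c₀ c₁ c₂ c₃ c₄ c₅ : ℝ) :
    iteratedDeriv 1 (quintic c₀ c₁ c₂ c₃ c₄ c₅) 0 = c₁ ∧
    iteratedDeriv 2 (quintic c₀ c₁ c₂ c₃ c₄ c₅) 0 = 2 * c₂ ∧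
    iteratedDeriv 3 (quintic c₀ c₁ c₂ c₃ c₄ c₅) 0 = 6 * c₃ ∧
    iteratedDeriv 5 (quintic c₀ c₁ c₂ c₃ c₄ c₅) 0 = 120 * c₅ := by
  have h : ∀ k0 k1 k2 k3 k4 k5 : ℝ,
      deriv (fun y : ℝ => k0 + k1 * y + k2 * y ^ 2 + k3 * y ^ 3 + k4 * y ^ 4 + k5 * y ^ 5) =
      fun y => k1 + (2 * k2) * y + (3 * k3) * y ^ 2 + (4 * k4) * y ^ 3 + (5 * k5) * y ^ 4
        + 0 * y ^ 5 := by
    intro k0 k1 k2 k3 k4 k5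
    ext y
    have : HasDerivAt (fun y : ℝ => k0 + k1 * y + k2 * y ^ 2 + k3 * y ^ 3 + k4 * y ^ 4 + k5 * y ^ 5)
        (0 + k1 * 1 + k2 * (2 * y) + k3 * (3 * y ^ 2) + k4 * (4 * y ^ 3) + k5 * (5 * y ^ 4)) y := by
      refine ((((((hasDerivAt_const _ _).add ((hasDerivAt_id _).const_mul _)).add ?_).add ?_).add
        ?_).add ?_)
      · simpa using (hasDerivAt_pow 2 y).const_mul k2
      · simpa using (hasDerivAt_pow 3 y).const_mul k3
      · simpa using (hasDerivAt_pow 4 y).const_mul k4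
      · simpa using (hasDerivAt_pow 5 y).const_mul k5
    rw [this.deriv]; ring
  unfold quintic
  simp only [iteratedDeriv_succ, iteratedDeriv_zero, h]
  refine ⟨?_, ?_, ?_, ?_⟩ <;> ring

/-! ### Linear maps of the plane -/

theorem isInvertible_of_det_ne_zero (L : ℝ × ℝ →L[ℝ] ℝ × ℝ)
    (h : (L (1, 0)).1 * (L (0, 1)).2 - (L (0, 1)).1 * (L (1, 0)).2 ≠ 0) : L.IsInvertible := by
  have hL : ∀ v, L v = v.1 • L (1, 0) + v.2 • L (0, 1) := by
    intro v
    rw [← map_smul, ← map_smul, ← map_add]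
    congr 1
    ext <;> simp
  have hinj : Function.Injective (L : ℝ × ℝ →ₗ[ℝ] ℝ × ℝ) := by
    rw [injective_iff_map_eq_zero]
    intro v hv
    have hv : L v = 0 := hv
    rw [hL] at hv
    have h1 := congrArg Prod.fst hv
    have h2 := congrArg Prod.snd hv
    simp only [Prod.fst_add, Prod.smul_fst, smul_eq_mul, Prod.fst_zero, Prod.snd_add,
      Prod.smul_snd, Prod.snd_zero] at h1 h2
    have h3 : v.1 * ((L (1, 0)).1 * (L (0, 1)).2 - (L (0, 1)).1 * (L (1, 0)).2) = 0 := by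
      linear_combination (L (0, 1)).2 * h1 - (L (0, 1)).1 * h2
    have h4 : v.2 * ((L (1, 0)).1 * (L (0, 1)).2 - (L (0, 1)).1 * (L (1, 0)).2) = 0 := by
      linear_combination (L (1, 0)).1 * h2 - (L (1, 0)).2 * h1
    ext
    · simpa [h] using h3
    · simpa [h] using h4
  refine ⟨(LinearEquiv.ofInjectiveEndo _ hinj).toContinuousLinearEquiv, ?_⟩
  rfl

/-! ### Local inverses and images of graphs -/

section localInverse

variable {E : Type*} [NormedAddCommGroup E] [NormedSpace ℝ E] [CompleteSpace E]

theorem exists_local_inverse {f : E → E} {a : E} (hf : ContDiffAt ℝ ∞ f a)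
    (h : (fderiv ℝ f a).IsInvertible) :
    ∃ Q : E → E, ContDiffAt ℝ ∞ Q (f a) ∧ Q (f a) = a ∧
      (∀ᶠ q in 𝓝 a, Q (f q) = q) ∧ (∀ᶠ y in 𝓝 (f a), f (Q y) = y) := by
  obtain ⟨e, he⟩ := h
  have hd : HasFDerivAt f (e : E →L[ℝ] E) a := by
    rw [he]; exact (hf.differentiableAt (by simp)).hasFDerivAt
  have hs := hf.hasStrictFDerivAt' hd (by simp)
  exact ⟨hf.localInverse hd (by simp), hf.to_localInverse hd (by simp),
    hf.localInverse_apply_image hd (by simp), hs.eventually_left_inverse,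
    hs.eventually_right_inverse⟩

end localInverse

theorem contDiffAt_baseMap {F : Space → Space} {u : ℝ × ℝ → ℝ} {p : ℝ × ℝ}
    (hF : ContDiffAt ℝ ∞ F (p.1, p.2, u p)) (hu : ContDiffAt ℝ ∞ u p) :
    ContDiffAt ℝ ∞ (baseMap F u) p := by
  have h : ContDiffAt ℝ ∞ (fun q : ℝ × ℝ => F (q.1, q.2, u q)) p :=
    ContDiffAt.comp p (g := F) hF (contDiffAt_fst.prodMk (contDiffAt_snd.prodMk hu))
  exact h.fst.prodMk h.snd.fst

/-- A graph on which the new independent variables are local coordinates has an image graph. -/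
theorem exists_image_graph {F : Space → Space} {u : ℝ × ℝ → ℝ} {p : ℝ × ℝ}
    (hF : ContDiffAt ℝ ∞ F (p.1, p.2, u p)) (hu : ContDiffAt ℝ ∞ u p)
    (h : (fderiv ℝ (baseMap F u) p).IsInvertible) :
    ∃ v : ℝ × ℝ → ℝ, ContDiffAt ℝ ∞ v (baseMap F u p) ∧ MapsGraph F u v p := by
  obtain ⟨Q, hQ, hQp, hl, -⟩ := exists_local_inverse (contDiffAt_baseMap hF hu) h
  refine ⟨fun y => (F ((Q y).1, (Q y).2, u (Q y))).2.2, ?_, h, ?_⟩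
  · have hu' : ContDiffAt ℝ ∞ (fun y => u (Q y)) (baseMap F u p) :=
      ContDiffAt.comp _ (g := u) (by rw [hQp]; exact hu) hQ
    have h2 : ContDiffAt ℝ ∞ (fun y => F ((Q y).1, (Q y).2, u (Q y))) (baseMap F u p) :=
      ContDiffAt.comp _ (g := F) (by rw [hQp]; exact hF) (hQ.fst.prodMk (hQ.snd.prodMk hu'))
    exact h2.snd.snd
  · filter_upwards [hl] with q hq
    rw [hq]

/-! ### Partial derivatives and the determining equations for `T` and `X` -/

/-- The unit vector of the `t`-axis. -/
abbrev et : Space := (1, 0, 0)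
/-- The unit vector of the `x`-axis. -/
abbrev ex : Space := (0, 1, 0)
/-- The unit vector of the `u`-axis. -/
abbrev eu : Space := (0, 0, 1)

/-- The derivative of `f` at `z` in the direction of `e`. -/
noncomputable def pd (e : Space) (f : Space → ℝ) (z : Space) : ℝ := fderiv ℝ f z e

/-- The component of a point transformation for `t`. -/
def compT (F : Space → Space) (z : Space) : ℝ := (F z).1
/-- The component of a point transformation for `x`. -/
def compX (F : Space → Space) (z : Space) : ℝ := (F z).2.1
/-- The component of a point transformation for `u`. -/
def compU (F : Space → Space) (z : Space) : ℝ := (F z).2.2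

theorem fderiv_eq_pd (f : Space → ℝ) (z : Space) (a b c : ℝ) :
    fderiv ℝ f z (a, b, c) = a * pd et f z + b * pd ex f z + c * pd eu f z := by
  have : ((a, b, c) : Space) = a • et + b • ex + c • eu := by ext <;> simp
  rw [this, map_add, map_add, map_smul, map_smul, map_smul]
  rfl

section comp
variable {F : Space → Space} {z : Space}

theorem contDiffAt_compT (hF : ContDiffAt ℝ ∞ F z) : ContDiffAt ℝ ∞ (compT F) z := hF.fst
theorem contDiffAt_compX (hF : ContDiffAt ℝ ∞ F z) : ContDiffAt ℝ ∞ (compX F) z := hF.snd.fst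
theorem contDiffAt_compU (hF : ContDiffAt ℝ ∞ F z) : ContDiffAt ℝ ∞ (compU F) z := hF.snd.snd

theorem fderiv_eq_comp (hF : ContDiffAt ℝ ∞ F z) (e : Space) :
    fderiv ℝ F z e = (fderiv ℝ (compT F) z e, fderiv ℝ (compX F) z e, fderiv ℝ (compU F) z e) := by
  have hd {f : Space → ℝ} (h : ContDiffAt ℝ ∞ f z) : HasFDerivAt f (fderiv ℝ f z) z :=
    (h.differentiableAt (by simp)).hasFDerivAt
  have : HasFDerivAt F _ z := (hd (contDiffAt_compT hF)).prodMk
    ((hd (contDiffAt_compX hF)).prodMk (hd (contDiffAt_compU hF)))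
  rw [this.fderiv]; rfl

end comp

section graph
variable {u : ℝ × ℝ → ℝ} {p : ℝ × ℝ}

theorem hasFDerivAt_along_graph {f : Space → ℝ} (hf : ContDiffAt ℝ ∞ f (p.1, p.2, u p))
    (hu : ContDiffAt ℝ ∞ u p) :
    HasFDerivAt (fun q : ℝ × ℝ => f (q.1, q.2, u q))
      ((fderiv ℝ f (p.1, p.2, u p)).comp ((ContinuousLinearMap.fst ℝ ℝ ℝ).prod
        ((ContinuousLinearMap.snd ℝ ℝ ℝ).prod (fderiv ℝ u p)))) p := by
  have h2 : HasFDerivAt u (fderiv ℝ u p) p := (hu.differentiableAt (by simp)).hasFDerivAt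
  have h3 : HasFDerivAt (fun q : ℝ × ℝ => (q.1, q.2, u q)) _ p :=
    hasFDerivAt_fst.prodMk (hasFDerivAt_snd.prodMk h2)
  exact HasFDerivAt.comp p (g := f) (hf.differentiableAt (by simp)).hasFDerivAt h3

theorem fderiv_along_graph {f : Space → ℝ} (hf : ContDiffAt ℝ ∞ f (p.1, p.2, u p))
    (hu : ContDiffAt ℝ ∞ u p) (a b : ℝ) :
    fderiv ℝ (fun q : ℝ × ℝ => f (q.1, q.2, u q)) p (a, b) =
      a * pd et f (p.1, p.2, u p) + b * pd ex f (p.1, p.2, u p)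
        + fderiv ℝ u p (a, b) * pd eu f (p.1, p.2, u p) := by
  rw [(hasFDerivAt_along_graph hf hu).fderiv, ← fderiv_eq_pd]
  rfl

theorem fderiv_baseMap {F : Space → Space} (hF : ContDiffAt ℝ ∞ F (p.1, p.2, u p))
    (hu : ContDiffAt ℝ ∞ u p) (a b : ℝ) :
    fderiv ℝ (baseMap F u) p (a, b) =
      (a * pd et (compT F) (p.1, p.2, u p) + b * pd ex (compT F) (p.1, p.2, u p)
        + fderiv ℝ u p (a, b) * pd eu (compT F) (p.1, p.2, u p),
       a * pd et (compX F) (p.1, p.2, u p) + b * pd ex (compX F) (p.1, p.2, u p)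
        + fderiv ℝ u p (a, b) * pd eu (compX F) (p.1, p.2, u p)) := by
  have h1 := hasFDerivAt_along_graph (contDiffAt_compT hF) hu
  have h2 := hasFDerivAt_along_graph (contDiffAt_compX hF) hu
  have h3 : HasFDerivAt (baseMap F u) _ p := h1.prodMk h2
  rw [h3.fderiv, ← fderiv_along_graph (contDiffAt_compT hF) hu,
    ← fderiv_along_graph (contDiffAt_compX hF) hu, h1.fderiv, h2.fderiv]
  rfl

end graph

theorem deriv_fst_eq_fderiv {v : ℝ × ℝ → ℝ} {p : ℝ × ℝ} (hv : ContDiffAt ℝ ∞ v p) :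
    deriv (fun s => v (s, p.2)) p.1 = fderiv ℝ v p (1, 0) := by
  have h1 : HasDerivAt (fun s : ℝ => (s, p.2)) (1, 0) p.1 :=
    (hasDerivAt_id _).prodMk (hasDerivAt_const _ _)
  have h2 : HasFDerivAt v (fderiv ℝ v p) (p.1, p.2) := (hv.differentiableAt (by simp)).hasFDerivAt
  exact (HasFDerivAt.comp_hasDerivAt p.1 h2 h1).deriv

theorem deriv_snd_eq_fderiv {v : ℝ × ℝ → ℝ} {p : ℝ × ℝ} (hv : ContDiffAt ℝ ∞ v p) :
    deriv (fun s => v (p.1, s)) p.2 = fderiv ℝ v p (0, 1) := by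
  have h1 : HasDerivAt (fun s : ℝ => (p.1, s)) (0, 1) p.2 :=
    (hasDerivAt_const _ _).prodMk (hasDerivAt_id _)
  have h2 : HasFDerivAt v (fderiv ℝ v p) (p.1, p.2) := (hv.differentiableAt (by simp)).hasFDerivAt
  exact (HasFDerivAt.comp_hasDerivAt p.2 h2 h1).deriv

theorem contDiffAt_slice {v : ℝ × ℝ → ℝ} {p : ℝ × ℝ} (hv : ContDiffAt ℝ ∞ v p) :
    ContDiffAt ℝ ∞ (fun y => v (p.1, y)) p.2 :=
  ContDiffAt.comp p.2 (g := v) hv (contDiffAt_const.prodMk contDiffAt_id)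

/-! ### Comparison of the images of two solutions -/

namespace IsPointTransf

variable {I J : Set ℝ} {θ η : Coeffs} {Ω : Set Space} {F : Space → Space}

theorem contDiffAt (h : IsPointTransf I J θ η Ω F) {z : Space} (hz : z ∈ Ω) :
    ContDiffAt ℝ ∞ F z := h.smooth.contDiffAt (h.isOpen.mem_nhds hz)

/-- Comparison of the images of two solutions `u`, `w` at `p` with the same value at `p`, the
images of which agree up to order four along `t̃ = const`. -/
theorem perturbation (h : IsPointTransf I J θ η Ω F) {u w : ℝ × ℝ → ℝ} {p : ℝ × ℝ}
    (hz : (p.1, p.2, u p) ∈ Ω) (hu : ContDiffAt ℝ ∞ u p) (hw : ContDiffAt ℝ ∞ w p)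
    (huw : w p = u p) (hSu : Satisfies θ u p) (hSw : Satisfies θ w p)
    (hIu : (fderiv ℝ (baseMap F u) p).IsInvertible)
    (hIw : (fderiv ℝ (baseMap F w) p).IsInvertible)
    {c : ℝ} {d : ℝ × ℝ} (hd : fderiv ℝ (baseMap F w) p d = (1, 0))
    (hQ : ∀ Q : ℝ → ℝ × ℝ, Q 0 = p → ContDiffAt ℝ ∞ Q 0 →
      fderiv ℝ (baseMap F w) p (deriv Q 0) = (0, 1) →
      (∀ᶠ y in 𝓝 0, baseMap F w (Q y) = baseMap F u p + (0, y)) →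
      Tendsto (fun y => (w (Q y) - u (Q y)) / y ^ 5) (𝓝[≠] 0) (𝓝 c)) :
    fderiv ℝ w p d - fderiv ℝ u p d + 120 * η.g (compT F (p.1, p.2, u p)) * c = 0 := by
  have hF := h.contDiffAt hz
  have hFw : ContDiffAt ℝ ∞ F (p.1, p.2, w p) := by rw [huw]; exact hF
  have hb : baseMap F w p = baseMap F u p := by simp only [baseMap, huw]
  obtain ⟨v, hv, hmv⟩ := exists_image_graph hF hu hIu
  obtain ⟨v', hv', hmv'⟩ := exists_image_graph hFw hw hIw
  have hEv := (h.satisfies_iff u v p hz hu hv hmv).1 hSu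
  have hEv' := (h.satisfies_iff w v' p (by rw [huw]; exact hz) hw hv' hmv').1 hSw
  rw [hb] at hEv' hv'
  set z₀ : Space := (p.1, p.2, u p) with hz₀
  set pt := baseMap F u p with hpt
  -- `Θ` vanishes on the graph of `u`, and on the graph of `w` it equals `v' - v` at the image
  -- point. Hence `v' - v` is, to leading order, `K (w - u)` with `K = Θ_u`.
  set Θ : Space → ℝ := fun z => compU F z - v (compT F z, compX F z) with hΘ
  have hΘs : ContDiffAt ℝ ∞ Θ z₀ := (contDiffAt_compU hF).sub
    (ContDiffAt.comp z₀ (g := v) hv ((contDiffAt_compT hF).prodMk (contDiffAt_compX hF)))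
  have hΘs' : ContDiffAt ℝ ∞ Θ (p.1, p.2, w p) := by rw [huw]; exact hΘs
  have h1 : ∀ᶠ q : ℝ × ℝ in 𝓝 p, Θ (q.1, q.2, u q) = 0 := by
    filter_upwards [hmv.2] with q hq
    exact sub_eq_zero.2 hq
  have h2 : ∀ᶠ q : ℝ × ℝ in 𝓝 p,
      v' (baseMap F w q) - v (baseMap F w q) = Θ (q.1, q.2, w q) := by
    filter_upwards [hmv'.2] with q hq
    rw [← hq]; rfl
  set K := pd eu Θ z₀ with hK
  have htan : ∀ a b : ℝ, a * pd et Θ z₀ + b * pd ex Θ z₀ + fderiv ℝ u p (a, b) * K = 0 := by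
    intro a b
    rw [← fderiv_along_graph hΘs hu]
    have : (fun q : ℝ × ℝ => Θ (q.1, q.2, u q)) =ᶠ[𝓝 p] fun _ => 0 := h1
    rw [this.fderiv_eq]; simp
  -- If `Θ_u = 0`, then `Θ = 0` along the graph of `u` forces the whole differential of `Θ` to
  -- vanish. But on the vector that the differential of `F` sends to `eu` it equals `1`.
  have hK0 : K ≠ 0 := by
    intro hK0
    have hΘ0 : ∀ e, fderiv ℝ Θ z₀ e = 0 := by
      rintro ⟨a, b, c⟩
      have h3 := htan 1 0
      have h4 := htan 0 1
      rw [hK0] at h3 h4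
      rw [fderiv_eq_pd, ← hK, hK0]
      linear_combination a * h3 + b * h4
    obtain ⟨A, hA⟩ := h.nondegenerate z₀ hz
    have hAe : fderiv ℝ F z₀ (A.symm eu) = eu := by
      rw [← hA]; exact A.apply_symm_apply eu
    rw [fderiv_eq_comp hF] at hAe
    have hd (f : Space → ℝ) (h : ContDiffAt ℝ ∞ f z₀) : HasFDerivAt f (fderiv ℝ f z₀) z₀ :=
      (h.differentiableAt (by simp)).hasFDerivAt
    have hvd : HasFDerivAt v (fderiv ℝ v pt) (compT F z₀, compX F z₀) :=
      (hv.differentiableAt (by simp)).hasFDerivAt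
    have hcomp : HasFDerivAt Θ _ z₀ := (hd _ (contDiffAt_compU hF)).sub (HasFDerivAt.comp z₀ hvd
      ((hd _ (contDiffAt_compT hF)).prodMk (hd _ (contDiffAt_compX hF))))
    have h5 := hΘ0 (A.symm eu)
    rw [hcomp.fderiv] at h5
    simp only [sub_apply, ContinuousLinearMap.comp_apply,
      ContinuousLinearMap.prod_apply] at h5
    simp only [Prod.mk.injEq] at hAe
    rw [hAe.1, hAe.2.1, hAe.2.2] at h5
    have : ((0, 0) : ℝ × ℝ) = 0 := rfl
    rw [this, map_zero] at h5
    norm_num at h5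
  have hD : ContDiffAt ℝ ∞ (fun y => v' y - v y) pt := hv'.sub hv
  have hDb : ∀ a b, fderiv ℝ (fun y => v' y - v y) pt (fderiv ℝ (baseMap F w) p (a, b))
      = K * (fderiv ℝ w p (a, b) - fderiv ℝ u p (a, b)) := by
    intro a b
    have h3 := fderiv_along_graph hΘs' hw a b
    have h4 : (fun q : ℝ × ℝ => Θ (q.1, q.2, w q)) =ᶠ[𝓝 p]
        fun q => (fun y => v' y - v y) (baseMap F w q) := by
      filter_upwards [h2] with q hq
      exact hq.symm
    rw [h4.fderiv_eq] at h3
    have h5 : HasFDerivAt (fun y => v' y - v y) (fderiv ℝ (fun y => v' y - v y) pt)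
        (baseMap F w p) := by
      rw [hb]; exact (hD.differentiableAt (by simp)).hasFDerivAt
    have h6 := (HasFDerivAt.comp p h5
      ((contDiffAt_baseMap hFw hw).differentiableAt (by simp)).hasFDerivAt).fderiv
    have h7 : fderiv ℝ (fun q => (fun y => v' y - v y) (baseMap F w q)) p (a, b) =
      fderiv ℝ (fun y => v' y - v y) pt (fderiv ℝ (baseMap F w) p (a, b)) := congrArg (· (a, b)) h6
    rw [← h7, h3, huw, ← hz₀]
    linear_combination htan a b
  have hDt : deriv (fun s => v' (s, pt.2)) pt.1 - deriv (fun s => v (s, pt.2)) pt.1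
      = K * (fderiv ℝ w p d - fderiv ℝ u p d) := by
    have h3 := hDb d.1 d.2
    rw [Prod.mk.eta, hd] at h3
    rw [deriv_fst_eq_fderiv hv, deriv_fst_eq_fderiv hv', ← h3,
      fderiv_fun_sub (hv'.differentiableAt (by simp)) (hv.differentiableAt (by simp))]
    rfl
  obtain ⟨Q, hQs, hQp, hQl, hQr⟩ := exists_local_inverse (contDiffAt_baseMap hFw hw) hIw
  rw [hb] at hQs hQp hQr
  have hline : ContDiffAt ℝ ∞ (fun y : ℝ => pt + (0, y)) 0 := by fun_prop
  have hline0 : pt + ((0 : ℝ), (0 : ℝ)) = pt := by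
    ext <;> simp
  have hlinet : Tendsto (fun y : ℝ => pt + (0, y)) (𝓝 0) (𝓝 pt) := by
    have := hline.continuousAt.tendsto
    rwa [hline0] at this
  set Qc : ℝ → ℝ × ℝ := fun y => Q (pt + (0, y)) with hQc
  have hQc0 : Qc 0 = p := by rw [hQc]; simp only [hline0, hQp]
  have hQcs : ContDiffAt ℝ ∞ Qc 0 := ContDiffAt.comp 0 (g := Q) (by rw [hline0]; exact hQs) hline
  have hQcr : ∀ᶠ y in 𝓝 0, baseMap F w (Qc y) = pt + (0, y) := hlinet.eventually hQr
  have hQct : Tendsto Qc (𝓝 0) (𝓝 p) := by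
    have := hQcs.continuousAt.tendsto
    rwa [hQc0] at this
  have hQcd : fderiv ℝ (baseMap F w) p (deriv Qc 0) = (0, 1) := by
    have h3 : HasDerivAt (fun y => baseMap F w (Qc y)) (fderiv ℝ (baseMap F w) p (deriv Qc 0)) 0 :=
      HasFDerivAt.comp_hasDerivAt (l := baseMap F w) 0 (by
        rw [hQc0]; exact ((contDiffAt_baseMap hFw hw).differentiableAt (by simp)).hasFDerivAt)
        (hQcs.differentiableAt (by simp)).hasDerivAt
    have h4 : HasDerivAt (fun y : ℝ => pt + (0, y)) (0, 1) 0 :=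
      ((hasDerivAt_const _ _).prodMk (hasDerivAt_id _)).const_add pt
    exact h3.unique (h4.congr_of_eventuallyEq hQcr)
  have hlim := hQ Qc hQc0 hQcs hQcd hQcr
  set f : ℝ → ℝ := fun y => v' (pt.1, pt.2 + y) - v (pt.1, pt.2 + y) with hf
  have hfs : ContDiffAt ℝ ∞ f 0 := by
    have : f = fun y => (fun y => v' y - v y) (pt + (0, y)) := by
      ext y
      have : pt + (0, y) = (pt.1, pt.2 + y) := by ext <;> simp
      simp only [this, hf]
    rw [this]
    exact ContDiffAt.comp 0 (g := fun y => v' y - v y) (by rw [hline0]; exact hD) hline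
  have hfΘ : ∀ᶠ y in 𝓝 0, f y = Θ ((Qc y).1, (Qc y).2, w (Qc y)) := by
    filter_upwards [hQct.eventually h2, hQcr] with y hy hy'
    rw [← hy, hy']
    have : pt + (0, y) = (pt.1, pt.2 + y) := by ext <;> simp
    rw [this]
  -- Strict differentiability of `Θ` is applied to the pair of points of the two graphs over `Qc y`:
  -- both move with `y`, and they differ only in the coordinate `u`.
  have hflim : Tendsto (fun y => f y / y ^ 5) (𝓝[≠] 0) (𝓝 (K * c)) := by
    have hst : HasStrictFDerivAt Θ (fderiv ℝ Θ z₀) z₀ := hΘs.hasStrictFDerivAt (by simp)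
    have ht1 : Tendsto (fun y => ((Qc y).1, (Qc y).2, w (Qc y))) (𝓝 0) (𝓝 z₀) := by
      have h3 : Tendsto (fun y => w (Qc y)) (𝓝 0) (𝓝 (u p)) := by
        rw [← huw]; exact hw.continuousAt.tendsto.comp hQct
      exact (continuous_fst.continuousAt.tendsto.comp hQct).prodMk_nhds
        ((continuous_snd.continuousAt.tendsto.comp hQct).prodMk_nhds h3)
    have ht2 : Tendsto (fun y => ((Qc y).1, (Qc y).2, u (Qc y))) (𝓝 0) (𝓝 z₀) := by
      have h3 : Tendsto (fun y => u (Qc y)) (𝓝 0) (𝓝 (u p)) :=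
        hu.continuousAt.tendsto.comp hQct
      exact (continuous_fst.continuousAt.tendsto.comp hQct).prodMk_nhds
        ((continuous_snd.continuousAt.tendsto.comp hQct).prodMk_nhds h3)
    have h3 := hst.isLittleO.comp_tendsto (ht1.prodMk_nhds ht2)
    have h4 : (fun y => f y - K * (w (Qc y) - u (Qc y))) =o[𝓝 0]
        fun y => w (Qc y) - u (Qc y) := by
      refine (h3.congr' ?_ Filter.EventuallyEq.rfl).trans_isBigO ?_
      · filter_upwards [hfΘ, hQct.eventually h1] with y hy hy'
        simp only [Function.comp_apply, hy, hy', sub_zero, Prod.mk_sub_mk, sub_self]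
        rw [fderiv_eq_pd]; ring
      · refine Asymptotics.isBigO_of_le _ fun y => ?_
        simp [Prod.norm_def]
    have h5 : Tendsto (fun y => (f y - K * (w (Qc y) - u (Qc y))) / y ^ 5) (𝓝[≠] 0) (𝓝 0) := by
      have h6 : (fun y => w (Qc y) - u (Qc y)) =O[𝓝[≠] 0] fun y => y ^ 5 :=
        Asymptotics.isBigO_of_div_tendsto_nhds (by
          filter_upwards [self_mem_nhdsWithin] with y hy h7
          exact absurd (pow_eq_zero_iff (by norm_num) |>.1 h7) hy) c hlim
      exact ((h4.mono nhdsWithin_le_nhds).trans_isBigO h6).tendsto_div_nhds_zero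
    have h8 := h5.add (hlim.const_mul K)
    rw [zero_add] at h8
    refine h8.congr fun y => ?_
    ring
  obtain ⟨hj, h5⟩ := iteratedDeriv_of_tendsto_div_pow hfs 5 hflim
  have hjet : ∀ j : ℕ, iteratedDeriv j f 0 = iteratedDeriv j (fun y => v' (pt.1, y)) pt.2
      - iteratedDeriv j (fun y => v (pt.1, y)) pt.2 := by
    intro j
    have e : f = fun y => ((fun y => v' (pt.1, y)) - fun y => v (pt.1, y)) (pt.2 + 1 * y) := by
      ext y; simp [hf]
    rw [e, iteratedDeriv_comp_affine, ← iteratedDeriv_sub]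
    · simp
    · exact (contDiffAt_slice hv').of_le (by exact_mod_cast le_top)
    · exact (contDiffAt_slice hv).of_le (by exact_mod_cast le_top)
  have j0 := (hjet 0).symm.trans (hj 0 (by norm_num))
  have j1 := (hjet 1).symm.trans (hj 1 (by norm_num))
  have j2 := (hjet 2).symm.trans (hj 2 (by norm_num))
  have j3 := (hjet 3).symm.trans (hj 3 (by norm_num))
  have j5 := (hjet 5).symm.trans h5
  simp only [iteratedDeriv_zero] at j0
  rw [sub_eq_zero] at j0 j1 j2 j3
  rw [sub_eq_iff_eq_add] at j5 hDt
  -- The jets of `v` and `v'` entering the equation differ only in the time derivative, by `K (dw(d)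
  -- - du(d))`, and in the fifth derivative, by `120 K c`. The equations are subtracted and `K` is
  -- cancelled.
  unfold Satisfies at hEv hEv'
  rw [show v' pt = v pt from j0, j1, j2, j3, j5, hDt] at hEv'
  have hpt1 : pt.1 = compT F z₀ := rfl
  rw [hpt1] at hEv hEv'
  have hfac : ((Nat.factorial 5 : ℕ) : ℝ) = 120 := by norm_num [Nat.factorial]
  rw [hfac] at hEv'
  apply mul_left_cancel₀ hK0
  linear_combination hEv' - hEv

end IsPointTransf

/-- A polynomial with prescribed derivatives at `p`. -/
def testFun (p : ℝ × ℝ) (c₀ τ c₁ c₂ c₃ c₄ c₅ ε : ℝ) (q : ℝ × ℝ) : ℝ :=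
  quintic c₀ c₁ c₂ c₃ c₄ c₅ (q.2 - p.2) + τ * (q.1 - p.1) + ε * (q.1 - p.1) ^ 5

section testFun
variable (p : ℝ × ℝ) (c₀ τ c₁ c₂ c₃ c₄ c₅ ε : ℝ)

theorem contDiff_testFun : ContDiff ℝ ∞ (testFun p c₀ τ c₁ c₂ c₃ c₄ c₅ ε) := by
  unfold testFun quintic; fun_prop

theorem testFun_self : testFun p c₀ τ c₁ c₂ c₃ c₄ c₅ ε p = c₀ := by
  simp [testFun, quintic]

theorem deriv_testFun_fst :
    deriv (fun s => testFun p c₀ τ c₁ c₂ c₃ c₄ c₅ ε (s, p.2)) p.1 = τ := by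
  have h1 : HasDerivAt (fun s => s - p.1) 1 p.1 := (hasDerivAt_id _).sub_const _
  have h := ((h1.const_mul τ).const_add (quintic c₀ c₁ c₂ c₃ c₄ c₅ (p.2 - p.2))).add
    ((h1.pow 5).const_mul ε)
  refine h.deriv.trans ?_
  simp

theorem iteratedDeriv_testFun (n : ℕ) :
    iteratedDeriv n (fun y => testFun p c₀ τ c₁ c₂ c₃ c₄ c₅ ε (p.1, y)) p.2
      = iteratedDeriv n (quintic c₀ c₁ c₂ c₃ c₄ c₅) 0 := by
  rw [← iteratedDeriv_sub_right _ n p.2]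
  simp [testFun]

theorem fderiv_testFun (a b : ℝ) :
    fderiv ℝ (testFun p c₀ τ c₁ c₂ c₃ c₄ c₅ ε) p (a, b) = a * τ + b * c₁ := by
  have hs := (contDiff_testFun p c₀ τ c₁ c₂ c₃ c₄ c₅ ε).contDiffAt (x := p)
  have h1 := deriv_fst_eq_fderiv hs
  have h2 := deriv_snd_eq_fderiv hs
  rw [deriv_testFun_fst] at h1
  rw [← iteratedDeriv_one, iteratedDeriv_testFun, (iteratedDeriv_quintic _ _ _ _ _ _).1] at h2
  have : ((a, b) : ℝ × ℝ) = a • (1, 0) + b • (0, 1) := by ext <;> simp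
  rw [this, map_add, map_smul, map_smul, ← h1, ← h2]
  simp

theorem satisfies_testFun (θ : Coeffs) :
    Satisfies θ (testFun p c₀ τ c₁ c₂ c₃ c₄ c₅ ε) p ↔
      τ + θ.a p.1 * c₀ * (6 * c₃) + θ.b p.1 * c₁ * (2 * c₂) + θ.c p.1 * c₀ ^ 2 * c₁
        + θ.f p.1 * c₀ * c₁ + θ.g p.1 * (120 * c₅) + θ.h p.1 * (6 * c₃) + θ.m p.1 * c₀
        + θ.n p.1 * c₁ + θ.k p.1 * p.2 * c₁ = 0 := by
  obtain ⟨h1, h2, h3, h5⟩ := iteratedDeriv_quintic c₀ c₁ c₂ c₃ c₄ c₅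
  rw [Satisfies, deriv_testFun_fst, testFun_self]
  simp only [iteratedDeriv_testFun, h1, h2, h3, h5]

end testFun

theorem isInvertible_fderiv_baseMap {F : Space → Space} {u : ℝ × ℝ → ℝ} {p : ℝ × ℝ}
    (hF : ContDiffAt ℝ ∞ F (p.1, p.2, u p)) (hu : ContDiffAt ℝ ∞ u p) {τ ξ : ℝ}
    (hτ : fderiv ℝ u p (1, 0) = τ) (hξ : fderiv ℝ u p (0, 1) = ξ)
    (h : (pd et (compT F) (p.1, p.2, u p) + τ * pd eu (compT F) (p.1, p.2, u p))
        * (pd ex (compX F) (p.1, p.2, u p) + ξ * pd eu (compX F) (p.1, p.2, u p))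
      - (pd ex (compT F) (p.1, p.2, u p) + ξ * pd eu (compT F) (p.1, p.2, u p))
        * (pd et (compX F) (p.1, p.2, u p) + τ * pd eu (compX F) (p.1, p.2, u p)) ≠ 0) :
    (fderiv ℝ (baseMap F u) p).IsInvertible := by
  apply isInvertible_of_det_ne_zero
  rw [fderiv_baseMap hF hu, fderiv_baseMap hF hu, hτ, hξ]
  simpa using h

theorem Coeffs.MemClass.g_ne_zero {θ : Coeffs} {I : Set ℝ} (h : θ.MemClass I) {t : ℝ} (ht : t ∈ I) :
    θ.g t ≠ 0 := left_ne_zero_of_mul (h.ne_zero t ht)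

/-! ### The component for `t` depends only on `t` -/

namespace IsPointTransf

variable {I J : Set ℝ} {θ η : Coeffs} {Ω : Set Space} {F : Space → Space}

/-- The term `ε (t - p.1)^5` of a test function affects neither the equation at `p` nor the first
derivatives there. It would, however, change the fifth derivative of the image along `t̃ = const` if
the corresponding curve in the `(t, x)`-plane crossed `t = const` transversally. Since `g̃ ≠ 0`,
that curve is tangent to `t = const`, so the total `x`-derivative of `T` vanishes. -/
theorem totalDeriv_compT_eq_zero (h : IsPointTransf I J θ η Ω F) (hθ : θ.MemClass I)
    (hη : η.MemClass J) {z : Space} (hz : z ∈ Ω) (ξ τ : ℝ)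
    (hdet : (pd et (compT F) z + τ * pd eu (compT F) z) * (pd ex (compX F) z + ξ * pd eu (compX F) z)
      - (pd ex (compT F) z + ξ * pd eu (compT F) z) * (pd et (compX F) z + τ * pd eu (compX F) z)
        ≠ 0) :
    pd ex (compT F) z + ξ * pd eu (compT F) z = 0 := by
  by_contra hne
  obtain ⟨t, x, c₀⟩ := z
  set p : ℝ × ℝ := (t, x) with hp
  have hg := hθ.g_ne_zero (h.subset _ hz)
  have hg' := hη.g_ne_zero (h.mapsTo _ hz)
  simp only at hg
  -- As `g ≠ 0`, the equation can be solved for the fifth derivative: `c₅` makes it hold with `u_t =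
  -- τ`, `u_x = ξ` and `u_xx = u_xxx = 0`.
  set c₅ : ℝ := -(τ + θ.c t * c₀ ^ 2 * ξ + θ.f t * c₀ * ξ + θ.m t * c₀ + θ.n t * ξ
    + θ.k t * x * ξ) / (120 * θ.g t) with hc₅
  have hu (ε : ℝ) : ContDiffAt ℝ ∞ (testFun p c₀ τ ξ 0 0 0 c₅ ε) p :=
    (contDiff_testFun ..).contDiffAt
  have hup (ε : ℝ) : testFun p c₀ τ ξ 0 0 0 c₅ ε p = c₀ := testFun_self ..
  have hS (ε : ℝ) : Satisfies θ (testFun p c₀ τ ξ 0 0 0 c₅ ε) p := by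
    rw [satisfies_testFun]
    have : θ.g t * (120 * c₅) = -(τ + θ.c t * c₀ ^ 2 * ξ + θ.f t * c₀ * ξ + θ.m t * c₀
      + θ.n t * ξ + θ.k t * x * ξ) := by rw [hc₅]; field_simp
    simp only [hp, this]; ring
  have hzε (ε : ℝ) : (p.1, p.2, testFun p c₀ τ ξ 0 0 0 c₅ ε p) ∈ Ω := by rw [hup]; exact hz
  have hI (ε : ℝ) : (fderiv ℝ (baseMap F (testFun p c₀ τ ξ 0 0 0 c₅ ε)) p).IsInvertible :=
    isInvertible_fderiv_baseMap (h.contDiffAt (hzε ε)) (hu ε) (τ := τ) (ξ := ξ)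
      (by rw [fderiv_testFun]; simp) (by rw [fderiv_testFun]; simp) (by rw [hup]; exact hdet)
  obtain ⟨A, hA⟩ := hI 1
  have hA' : ∀ e, fderiv ℝ (baseMap F (testFun p c₀ τ ξ 0 0 0 c₅ 1)) p (A.symm e) = e := by
    intro e; rw [← hA]; exact A.apply_symm_apply e
  -- The two functions differ by `(t - p.1)^5` and the curve leaves `p` with velocity `A.symm (0,
  -- 1)`; this gives `c`.
  have hfin := h.perturbation (hzε 0) (hu 0) (hu 1) (by rw [hup, hup]) (hS 0) (hS 1) (hI 0) (hI 1)
    (c := (A.symm (0, 1)).1 ^ 5) (hA' (1, 0)) (by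
      intro Q hQ0 hQs hQd _
      have hd : deriv Q 0 = A.symm (0, 1) := by
        rw [← hQd, ← hA]; exact (A.symm_apply_apply _).symm
      have h1 : HasDerivAt (fun y => (Q y).1) (A.symm (0, 1)).1 0 := by
        rw [← hd]; exact (hQs.differentiableAt (by simp)).hasDerivAt.fst
      have h2 := (hasDerivAt_iff_tendsto_slope.1 h1).pow 5
      refine h2.congr fun y => ?_
      rw [slope_def_field, hQ0, sub_zero, div_pow]
      simp only [testFun]
      ring)
  rw [hup, ← Prod.mk.eta (p := A.symm (1, 0)), fderiv_testFun, fderiv_testFun] at hfin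
  have hg'' : η.g (compT F (p.1, p.2, c₀)) ≠ 0 := hg'
  have hlam : (A.symm (0, 1)).1 = 0 := by
    have : (A.symm (0, 1)).1 ^ 5 = 0 := by
      have h1 : 120 * η.g (compT F (p.1, p.2, c₀)) * (A.symm (0, 1)).1 ^ 5 = 0 := by
        linear_combination hfin
      simpa [hg''] using h1
    exact pow_eq_zero_iff (by norm_num) |>.1 this
  have h1 := hA' (0, 1)
  rw [← Prod.mk.eta (p := A.symm (0, 1)), fderiv_baseMap (h.contDiffAt (hzε 1)) (hu 1), hlam, hup,
    fderiv_testFun] at h1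
  simp only [zero_mul, zero_add, Prod.mk.injEq] at h1
  have h2 : (A.symm (0, 1)).2 * (pd ex (compT F) (t, x, c₀) + ξ * pd eu (compT F) (t, x, c₀))
      = 0 := by linear_combination h1.1
  have h3 : (A.symm (0, 1)).2 = 0 := by simpa [hne] using h2
  have h4 := h1.2
  rw [h3] at h4
  norm_num at h4

/-- Up to sign these are the 2×2 minors of the differential of `(T, X)`, which has rank two because
that of `F` is onto. -/
theorem minor_ne_zero (h : IsPointTransf I J θ η Ω F) {z : Space} (hz : z ∈ Ω) :
    ¬ (pd et (compT F) z * pd ex (compX F) z - pd ex (compT F) z * pd et (compX F) z = 0 ∧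
      pd et (compT F) z * pd eu (compX F) z - pd eu (compT F) z * pd et (compX F) z = 0 ∧
      pd eu (compT F) z * pd ex (compX F) z - pd ex (compT F) z * pd eu (compX F) z = 0) := by
  rintro ⟨m0, m1, m2⟩
  obtain ⟨A, hA⟩ := h.nondegenerate z hz
  have hA' : ∀ e, fderiv ℝ F z (A.symm e) = e := by
    intro e; rw [← hA]; exact A.apply_symm_apply e
  obtain ⟨⟨a1, a2, a3⟩, h1⟩ : ∃ a, fderiv ℝ F z a = et := ⟨_, hA' et⟩
  obtain ⟨⟨b1, b2, b3⟩, h2⟩ : ∃ b, fderiv ℝ F z b = ex := ⟨_, hA' ex⟩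
  rw [fderiv_eq_comp (h.contDiffAt hz)] at h1 h2
  simp only [fderiv_eq_pd, Prod.mk.injEq] at h1 h2
  obtain ⟨h11, h12, -⟩ := h1
  obtain ⟨h21, h22, -⟩ := h2
  set Tt := pd et (compT F) z
  set Tx := pd ex (compT F) z
  set Tu := pd eu (compT F) z
  set Xt := pd et (compX F) z
  set Xx := pd ex (compX F) z
  set Xu := pd eu (compX F) z
  have : (a1 * Tt + a2 * Tx + a3 * Tu) * (b1 * Xt + b2 * Xx + b3 * Xu)
      - (b1 * Tt + b2 * Tx + b3 * Tu) * (a1 * Xt + a2 * Xx + a3 * Xu) = 0 := by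
    linear_combination (a1 * b2 - a2 * b1) * m0 + (a1 * b3 - a3 * b1) * m1
      + (a3 * b2 - a2 * b3) * m2
  rw [h11, h12, h21, h22] at this
  norm_num at this

/-- The determinant required by `totalDeriv_compT_eq_zero` is affine in `(ξ, τ)`, and its
coefficients are the minors that do not all vanish. So two values of `ξ` are available, and `T_x + ξ
T_u` vanishes at both. -/
theorem pd_compT_eq_zero (h : IsPointTransf I J θ η Ω F) (hθ : θ.MemClass I)
    (hη : η.MemClass J) {z : Space} (hz : z ∈ Ω) :
    pd ex (compT F) z = 0 ∧ pd eu (compT F) z = 0 := by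
  have hk := h.totalDeriv_compT_eq_zero hθ hη hz
  have hm := h.minor_ne_zero hz
  generalize pd et (compT F) z = Tt at *
  generalize pd ex (compT F) z = Tx at *
  generalize pd eu (compT F) z = Tu at *
  generalize pd et (compX F) z = Xt at *
  generalize pd ex (compX F) z = Xx at *
  generalize pd eu (compX F) z = Xu at *
  have hdet : ∀ ξ τ : ℝ, (Tt + τ * Tu) * (Xx + ξ * Xu) - (Tx + ξ * Tu) * (Xt + τ * Xu)
      = (Tt * Xx - Tx * Xt) + ξ * (Tt * Xu - Tu * Xt) + τ * (Tu * Xx - Tx * Xu) := by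
    intro ξ τ; ring
  have two : ∃ ξ₁ ξ₂ : ℝ, ξ₁ ≠ ξ₂ ∧ Tx + ξ₁ * Tu = 0 ∧ Tx + ξ₂ * Tu = 0 := by
    by_cases h2 : Tu * Xx - Tx * Xu = 0
    · have h3 : ∀ ξ : ℝ, (Tt * Xx - Tx * Xt) + ξ * (Tt * Xu - Tu * Xt) ≠ 0 → Tx + ξ * Tu = 0 := by
        intro ξ hξ
        refine hk ξ 0 ?_
        rw [hdet, h2]; simpa using hξ
      by_cases h1 : Tt * Xu - Tu * Xt = 0
      · have h0 : Tt * Xx - Tx * Xt ≠ 0 := fun h0 => hm ⟨h0, h1, h2⟩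
        exact ⟨0, 1, by norm_num, h3 0 (by simpa [h1] using h0), h3 1 (by simpa [h1] using h0)⟩
      -- `r` is the only `ξ` at which the determinant with `τ = 0` vanishes; two other values are
      -- taken.
      · set r := -(Tt * Xx - Tx * Xt) / (Tt * Xu - Tu * Xt) with hr
        have h4 : (Tt * Xx - Tx * Xt) + r * (Tt * Xu - Tu * Xt) = 0 := by
          rw [hr, div_mul_cancel₀ _ h1]; ring
        refine ⟨r + 1, r + 2, by norm_num, h3 _ ?_, h3 _ ?_⟩
        · intro h5
          apply h1
          linear_combination h5 - h4
        · intro h5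
          apply h1
          linear_combination (h5 - h4) / 2
    · have h3 : ∀ ξ : ℝ, Tx + ξ * Tu = 0 := by
        intro ξ
        -- This `τ` makes the determinant equal to `1`.
        refine hk ξ ((1 - ((Tt * Xx - Tx * Xt) + ξ * (Tt * Xu - Tu * Xt)))
          / (Tu * Xx - Tx * Xu)) ?_
        rw [hdet, div_mul_cancel₀ _ h2]
        norm_num
      exact ⟨0, 1, by norm_num, h3 0, h3 1⟩
  obtain ⟨ξ₁, ξ₂, hne, h1, h2⟩ := two
  have h3 : Tu = 0 := by
    have : (ξ₁ - ξ₂) * Tu = 0 := by linear_combination h1 - h2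
    simpa [sub_ne_zero.2 hne] using this
  exact ⟨by simpa [h3] using h1, h3⟩

theorem pd_et_compT_ne_zero (h : IsPointTransf I J θ η Ω F) (hθ : θ.MemClass I)
    (hη : η.MemClass J) {z : Space} (hz : z ∈ Ω) : pd et (compT F) z ≠ 0 := by
  obtain ⟨h1, h2⟩ := h.pd_compT_eq_zero hθ hη hz
  intro h0
  exact h.minor_ne_zero hz (by simp [h0, h1, h2])

end IsPointTransf

/-! ### Functions with vanishing partial derivatives, locally -/

theorem eventually_eq_of_pd_eu {f : Space → ℝ} {z₀ : Space}
    (hf : ∀ᶠ z in 𝓝 z₀, DifferentiableAt ℝ f z) (h : ∀ᶠ z in 𝓝 z₀, pd eu f z = 0) :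
    ∀ᶠ z in 𝓝 z₀, f z = f (z.1, z.2.1, z₀.2.2) := by
  obtain ⟨r, hr, hb⟩ := Metric.eventually_nhds_iff_ball.1 (hf.and h)
  have ht : Tendsto (fun z : Space => (z.1, z.2.1, z₀.2.2)) (𝓝 z₀) (𝓝 z₀) :=
    Continuous.tendsto' (by fun_prop) _ _ rfl
  filter_upwards [Metric.ball_mem_nhds z₀ hr, ht.eventually (Metric.ball_mem_nhds z₀ hr)] with z h1 h2
  obtain ⟨y, hy, hy'⟩ := domain_mvt (f := f) (f' := fderiv ℝ f)
    (fun x hx => (hb x hx).1.hasFDerivAt.hasFDerivWithinAt) (convex_ball z₀ r) h2 h1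
  have hyb := (convex_ball z₀ r).segment_subset h2 h1 hy
  have : z - (z.1, z.2.1, z₀.2.2) = (0, 0, z.2.2 - z₀.2.2) := by ext <;> simp
  rw [this, fderiv_eq_pd, (hb y hyb).2] at hy'
  linarith

theorem eventually_eq_of_pd_ex {f : Space → ℝ} {z₀ : Space}
    (hf : ∀ᶠ z in 𝓝 z₀, DifferentiableAt ℝ f z) (h : ∀ᶠ z in 𝓝 z₀, pd ex f z = 0) :
    ∀ᶠ z in 𝓝 z₀, f z = f (z.1, z₀.2.1, z.2.2) := by
  obtain ⟨r, hr, hb⟩ := Metric.eventually_nhds_iff_ball.1 (hf.and h)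
  have ht : Tendsto (fun z : Space => (z.1, z₀.2.1, z.2.2)) (𝓝 z₀) (𝓝 z₀) :=
    Continuous.tendsto' (by fun_prop) _ _ rfl
  filter_upwards [Metric.ball_mem_nhds z₀ hr, ht.eventually (Metric.ball_mem_nhds z₀ hr)] with z h1 h2
  obtain ⟨y, hy, hy'⟩ := domain_mvt (f := f) (f' := fderiv ℝ f)
    (fun x hx => (hb x hx).1.hasFDerivAt.hasFDerivWithinAt) (convex_ball z₀ r) h2 h1
  have hyb := (convex_ball z₀ r).segment_subset h2 h1 hy
  have : z - (z.1, z₀.2.1, z.2.2) = (0, z.2.1 - z₀.2.1, 0) := by ext <;> simp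
  rw [this, fderiv_eq_pd, (hb y hyb).2] at hy'
  linarith

theorem eventually_eq_of_pd {f : Space → ℝ} {z₀ : Space}
    (hf : ∀ᶠ z in 𝓝 z₀, DifferentiableAt ℝ f z) (hx : ∀ᶠ z in 𝓝 z₀, pd ex f z = 0)
    (hu : ∀ᶠ z in 𝓝 z₀, pd eu f z = 0) :
    ∀ᶠ z in 𝓝 z₀, f z = f (z.1, z₀.2) := by
  have ht : Tendsto (fun z : Space => (z.1, z.2.1, z₀.2.2)) (𝓝 z₀) (𝓝 z₀) :=
    Continuous.tendsto' (by fun_prop) _ _ rfl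
  filter_upwards [eventually_eq_of_pd_eu hf hu, ht.eventually (eventually_eq_of_pd_ex hf hx)]
    with z h1 h2
  rw [h1, h2]

/-! ### Calculus of partial derivatives on an open set -/

section pd
variable {Ω : Set Space} {f : Space → ℝ} {z : Space}

theorem contDiffOn_pd (hΩ : IsOpen Ω) (hf : ContDiffOn ℝ ∞ f Ω) (e : Space) :
    ContDiffOn ℝ ∞ (pd e f) Ω :=
  (hf.fderiv_of_isOpen hΩ (m := ∞) (by simp)).clm_apply contDiffOn_const

theorem differentiableAt_of_contDiffOn (hΩ : IsOpen Ω) (hf : ContDiffOn ℝ ∞ f Ω) (hz : z ∈ Ω) :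
    DifferentiableAt ℝ f z :=
  (hf.contDiffAt (hΩ.mem_nhds hz)).differentiableAt (by simp)

theorem pd_congr (hΩ : IsOpen Ω) {g : Space → ℝ} (h : ∀ z ∈ Ω, f z = g z) (hz : z ∈ Ω)
    (e : Space) : pd e f z = pd e g z := by
  have : f =ᶠ[𝓝 z] g := by
    filter_upwards [hΩ.mem_nhds hz] with y hy using h y hy
  rw [pd, this.fderiv_eq]; rfl

theorem pd_eq_zero_of_const (hΩ : IsOpen Ω) {c : ℝ} (h : ∀ z ∈ Ω, f z = c) (hz : z ∈ Ω)
    (e : Space) : pd e f z = 0 := by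
  rw [pd_congr hΩ h hz e]; simp [pd]

theorem pd_comm (hΩ : IsOpen Ω) (hf : ContDiffOn ℝ ∞ f Ω) (hz : z ∈ Ω) (e e' : Space) :
    pd e (pd e' f) z = pd e' (pd e f) z := by
  have h := hf.contDiffAt (hΩ.mem_nhds hz)
  have hs := h.isSymmSndFDerivAt (by
    rw [minSmoothness_of_isRCLikeNormedField]
    exact WithTop.coe_le_coe.2 (le_top (a := (2 : ℕ∞))))
  have hd : DifferentiableAt ℝ (fderiv ℝ f) z :=
    (h.fderiv_right (m := ∞) (by simp)).differentiableAt (by simp)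
  have key : ∀ e e' : Space, pd e (pd e' f) z = fderiv ℝ (fderiv ℝ f) z e e' := by
    intro e e'
    have : HasFDerivAt (fun y => fderiv ℝ f y e') _ z :=
      hd.hasFDerivAt.clm_apply (hasFDerivAt_const e' z)
    change fderiv ℝ (fun y => fderiv ℝ f y e') z e = _
    rw [this.fderiv]; simp
  rw [key, key]
  exact hs _ _

/-- The derivative along the line through `z` in the direction `e`. -/
theorem hasDerivAt_line (hf : DifferentiableAt ℝ f z) (e : Space) :
    HasDerivAt (fun s : ℝ => f (z + s • e)) (pd e f z) 0 := by
  have h1 : HasDerivAt (fun s : ℝ => z + s • e) e 0 := by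
    simpa using ((hasDerivAt_id (0 : ℝ)).smul_const e).const_add z
  have h2 : HasFDerivAt f (fderiv ℝ f z) (z + (0 : ℝ) • e) := by simpa using hf.hasFDerivAt
  exact HasFDerivAt.comp_hasDerivAt (l := f) 0 h2 h1

theorem eventually_line_mem (hΩ : IsOpen Ω) (hz : z ∈ Ω) (e : Space) :
    ∀ᶠ s : ℝ in 𝓝 0, z + s • e ∈ Ω := by
  have : Tendsto (fun s : ℝ => z + s • e) (𝓝 0) (𝓝 z) := Continuous.tendsto' (by fun_prop) _ _ (by simp)
  exact this.eventually (hΩ.mem_nhds hz)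

/-- An identity on `Ω` may be differentiated along lines. -/
theorem deriv_line_eq_zero (hΩ : IsOpen Ω) (hz : z ∈ Ω) (h : ∀ y ∈ Ω, f y = 0) {e : Space} {d : ℝ}
    (hd : HasDerivAt (fun s : ℝ => f (z + s • e)) d 0) : d = 0 := by
  refine hd.unique ((hasDerivAt_const (0 : ℝ) (0 : ℝ)).congr_of_eventuallyEq ?_)
  filter_upwards [eventually_line_mem hΩ hz e] with s hs using h _ hs

theorem hasDerivAt_line_fst (q : ℝ → ℝ) (z e : Space) (he : e.1 = 0) :
    HasDerivAt (fun s : ℝ => q (z + s • e).1) 0 0 := by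
  simp only [Prod.fst_add, Prod.smul_fst, he, smul_zero, add_zero]
  exact hasDerivAt_const _ _

theorem hasDerivAt_line_comp {q : ℝ → ℝ} {K : Set ℝ} (hK : IsOpen K) (hq : ContDiffOn ℝ ∞ q K)
    (hf : DifferentiableAt ℝ f z) (hfz : f z ∈ K) {e : Space} (h0 : pd e f z = 0) :
    HasDerivAt (fun s : ℝ => q (f (z + s • e))) 0 0 := by
  have h1 := hasDerivAt_line hf e
  have h2 : HasDerivAt q (deriv q (f z)) (f (z + (0 : ℝ) • e)) := by
    simpa using ((hq.contDiffAt (hK.mem_nhds hfz)).differentiableAt (by simp)).hasDerivAt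
  have := HasDerivAt.comp (h₂ := q) 0 h2 h1
  rw [h0, mul_zero] at this
  exact this

end pd

/-! ### The component for `x` is affine in `x` and free of `u` -/

namespace IsPointTransf

variable {I J : Set ℝ} {θ η : Coeffs} {Ω : Set Space} {F : Space → Space}

theorem contDiffOn_compT (h : IsPointTransf I J θ η Ω F) : ContDiffOn ℝ ∞ (compT F) Ω := h.smooth.fst
theorem contDiffOn_compX (h : IsPointTransf I J θ η Ω F) : ContDiffOn ℝ ∞ (compX F) Ω :=
  h.smooth.snd.fst
theorem contDiffOn_compU (h : IsPointTransf I J θ η Ω F) : ContDiffOn ℝ ∞ (compU F) Ω :=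
  h.smooth.snd.snd

theorem eventually_compT_eq (h : IsPointTransf I J θ η Ω F) (hθ : θ.MemClass I)
    (hη : η.MemClass J) {z₀ : Space} (hz : z₀ ∈ Ω) :
    ∀ᶠ z in 𝓝 z₀, compT F z = compT F (z.1, z₀.2) := by
  have hΩ := h.isOpen.mem_nhds hz
  refine eventually_eq_of_pd ?_ ?_ ?_ <;> filter_upwards [hΩ] with y hy
  · exact differentiableAt_of_contDiffOn h.isOpen h.contDiffOn_compT hy
  · exact (h.pd_compT_eq_zero hθ hη hy).1
  · exact (h.pd_compT_eq_zero hθ hη hy).2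

/-- Raising the fifth Taylor coefficient of `u` by one is compensated in the equation by lowering
`u_t` by `120 g`. In the image the first change contributes `120 g̃ / (X_x + ξ X_u)^5`, because
curves `t̃ = const` are now curves `t = const`, and the second contributes `-120 g / T_t`. -/
theorem g_relation_totalDeriv (h : IsPointTransf I J θ η Ω F) (hθ : θ.MemClass I)
    (hη : η.MemClass J) {z : Space} (hz : z ∈ Ω) (ξ : ℝ)
    (hne : pd ex (compX F) z + ξ * pd eu (compX F) z ≠ 0) :
    η.g (compT F z) * pd et (compT F) z
      = θ.g z.1 * (pd ex (compX F) z + ξ * pd eu (compX F) z) ^ 5 := by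
  have hTz := h.eventually_compT_eq hθ hη hz
  have hTt := h.pd_et_compT_ne_zero hθ hη hz
  obtain ⟨hTx, hTu⟩ := h.pd_compT_eq_zero hθ hη hz
  have hTd := differentiableAt_of_contDiffOn h.isOpen h.contDiffOn_compT hz
  obtain ⟨t, x, c₀⟩ := z
  set p : ℝ × ℝ := (t, x) with hp
  have hg := hθ.g_ne_zero (h.subset _ hz)
  simp only at hg
  set R : ℝ := θ.c t * c₀ ^ 2 * ξ + θ.f t * c₀ * ξ + θ.m t * c₀ + θ.n t * ξ + θ.k t * x * ξ with hR
  set c₅ : ℝ := -R / (120 * θ.g t) with hc₅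
  have hc₅' : θ.g t * (120 * c₅) = -R := by rw [hc₅]; field_simp
  have hu (τ c : ℝ) : ContDiffAt ℝ ∞ (testFun p c₀ τ ξ 0 0 0 c 0) p :=
    (contDiff_testFun ..).contDiffAt
  have hup (τ c : ℝ) : testFun p c₀ τ ξ 0 0 0 c 0 p = c₀ := testFun_self ..
  have hS (ε : ℝ) : Satisfies θ (testFun p c₀ (-120 * θ.g t * ε) ξ 0 0 0 (c₅ + ε) 0) p := by
    rw [satisfies_testFun]
    have h1 : θ.g t * (120 * (c₅ + ε)) = -R + θ.g t * 120 * ε := by rw [← hc₅']; ring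
    simp only [hp, h1, hR]; ring
  have hzε (τ c : ℝ) : (p.1, p.2, testFun p c₀ τ ξ 0 0 0 c 0 p) ∈ Ω := by rw [hup]; exact hz
  have hI (τ c : ℝ) : (fderiv ℝ (baseMap F (testFun p c₀ τ ξ 0 0 0 c 0)) p).IsInvertible :=
    isInvertible_fderiv_baseMap (h.contDiffAt (hzε τ c)) (hu τ c) (τ := τ) (ξ := ξ)
      (by rw [fderiv_testFun]; simp) (by rw [fderiv_testFun]; simp) (by
        rw [hup, hTx, hTu]; simpa using ⟨hTt, hne⟩)
  set w := testFun p c₀ (-120 * θ.g t * 1) ξ 0 0 0 (c₅ + 1) 0 with hw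
  have hws : ContDiffAt ℝ ∞ w p := hu _ _
  have hwp : w p = c₀ := hup _ _
  have hL : ∀ a b, fderiv ℝ (baseMap F w) p (a, b) = (a * pd et (compT F) (t, x, c₀),
      a * pd et (compX F) (t, x, c₀) + b * pd ex (compX F) (t, x, c₀)
        + (a * (-120 * θ.g t * 1) + b * ξ) * pd eu (compX F) (t, x, c₀)) := by
    intro a b
    rw [fderiv_baseMap (h.contDiffAt (hzε _ _)) hws, hup, hTx, hTu, fderiv_testFun]
    simp [hp]
  obtain ⟨A, hA⟩ := hI (-120 * θ.g t * 1) (c₅ + 1)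
  have hA' : ∀ e, fderiv ℝ (baseMap F w) p (A.symm e) = e := by
    intro e; rw [← hA]; exact A.apply_symm_apply e
  have hTs : HasDerivAt (fun s => compT F (s, x, c₀)) (pd et (compT F) (t, x, c₀)) t := by
    have h1 : HasDerivAt (fun s : ℝ => ((s, x, c₀) : Space)) et t :=
      (hasDerivAt_id _).prodMk (hasDerivAt_const _ _)
    exact HasFDerivAt.comp_hasDerivAt (l := compT F) t hTd.hasFDerivAt h1
  have hfin := h.perturbation (hzε (-120 * θ.g t * 0) (c₅ + 0)) (hu _ _) hws (by rw [hup, hwp])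
    (hS 0) (hS 1) (hI _ _) (hI _ _)
    (c := (pd ex (compX F) (t, x, c₀) + ξ * pd eu (compX F) (t, x, c₀))⁻¹ ^ 5) (hA' (1, 0)) (by
      intro Q hQ0 hQs hQd hQb
      have hd2 : (deriv Q 0).2 = (pd ex (compX F) (t, x, c₀) + ξ * pd eu (compX F) (t, x, c₀))⁻¹ := by
        rw [← Prod.mk.eta (p := deriv Q 0), hL, Prod.mk.injEq] at hQd
        obtain ⟨e1, e2⟩ := hQd
        have e3 : (deriv Q 0).1 = 0 := by simpa [hTt] using e1
        rw [e3] at e2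
        apply eq_inv_of_mul_eq_one_left
        linear_combination e2
      have h1 : HasDerivAt (fun y => (Q y).2) (deriv Q 0).2 0 :=
        (hQs.differentiableAt (by simp)).hasDerivAt.snd
      have h2 := (hasDerivAt_iff_tendsto_slope.1 h1).pow 5
      rw [hd2] at h2
      have hQt : Tendsto Q (𝓝 0) (𝓝 p) := by
        have := hQs.continuousAt.tendsto
        rwa [hQ0] at this
      have ht1 : Tendsto (fun y => (((Q y).1, (Q y).2, w (Q y)) : Space)) (𝓝 0) (𝓝 (t, x, c₀)) := by
        have h3 : Tendsto (fun y => w (Q y)) (𝓝 0) (𝓝 c₀) := by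
          rw [← hwp]; exact hws.continuousAt.tendsto.comp hQt
        exact (continuous_fst.continuousAt.tendsto.comp hQt).prodMk_nhds
          ((continuous_snd.continuousAt.tendsto.comp hQt).prodMk_nhds h3)
      -- Near the point `T` is an injective function of `t` alone. Hence `t` is constant along the
      -- curve, and the part of `w - u` linear in `t` drops out, leaving the fifth power of the
      -- increment of `x`.
      have hinj : ∀ᶠ s in 𝓝 t, compT F (s, x, c₀) = compT F (t, x, c₀) → s = t := by
        have := hTs.eventually_ne (c := compT F (t, x, c₀)) hTt
        rw [eventually_nhdsWithin_iff] at this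
        filter_upwards [this] with s hs h3
        by_contra h4
        exact hs h4 h3
      have hQ1 : Tendsto (fun y => (Q y).1) (𝓝 0) (𝓝 t) :=
        continuous_fst.continuousAt.tendsto.comp hQt
      refine h2.congr' ?_
      filter_upwards [nhdsWithin_le_nhds (hQ1.eventually hinj), nhdsWithin_le_nhds hQb,
        nhdsWithin_le_nhds (ht1.eventually hTz)] with y h3 h4 h5
      have h6 : (Q y).1 = t := by
        apply h3
        have h7 := congrArg Prod.fst h4
        simp only [Prod.fst_add, add_zero] at h7
        have h8 : compT F ((Q y).1, (Q y).2, w (Q y)) = compT F (t, x, c₀) := by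
          rw [← hup (-120 * θ.g t * 0) c₅]; exact h7
        rw [← h8, h5]
      rw [slope_def_field, hQ0, sub_zero, div_pow]
      simp only [hw, testFun, quintic, h6, hp]
      ring)
  rw [hup, ← Prod.mk.eta (p := A.symm (1, 0)), hw, fderiv_testFun, fderiv_testFun] at hfin
  have h1 := hA' (1, 0)
  rw [← Prod.mk.eta (p := A.symm (1, 0)), hL, Prod.mk.injEq] at h1
  set D := pd ex (compX F) (t, x, c₀) + ξ * pd eu (compX F) (t, x, c₀)
  have h2 : D⁻¹ ^ 5 * D ^ 5 = 1 := by rw [← mul_pow, inv_mul_cancel₀ hne, one_pow]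
  have hpt : compT F (p.1, p.2, c₀) = compT F (t, x, c₀) := rfl
  rw [hpt] at hfin
  linear_combination pd et (compT F) (t, x, c₀) * D ^ 5 / 120 * hfin + θ.g t * D ^ 5 * h1.1
    - η.g (compT F (t, x, c₀)) * pd et (compT F) (t, x, c₀) * h2

/-- If `X_u ≠ 0`, suitable `ξ` give `X_x + ξ X_u` the values `1` and `2`, while the left side of the
relation is independent of `ξ`; then `g = 32 g`. -/
theorem pd_eu_compX (h : IsPointTransf I J θ η Ω F) (hθ : θ.MemClass I)
    (hη : η.MemClass J) {z : Space} (hz : z ∈ Ω) : pd eu (compX F) z = 0 := by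
  by_contra hu
  have hk := h.g_relation_totalDeriv hθ hη hz
  have hg := hθ.g_ne_zero (h.subset _ hz)
  have h1 := hk ((1 - pd ex (compX F) z) / pd eu (compX F) z) (by
    rw [div_mul_cancel₀ _ hu]; norm_num)
  have h2 := hk ((2 - pd ex (compX F) z) / pd eu (compX F) z) (by
    rw [div_mul_cancel₀ _ hu]; norm_num)
  rw [div_mul_cancel₀ _ hu] at h1 h2
  apply hg
  linear_combination (h1 - h2) / 31

theorem pd_ex_compX_ne_zero (h : IsPointTransf I J θ η Ω F) (hθ : θ.MemClass I)
    (hη : η.MemClass J) {z : Space} (hz : z ∈ Ω) : pd ex (compX F) z ≠ 0 := by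
  obtain ⟨h1, h2⟩ := h.pd_compT_eq_zero hθ hη hz
  have h3 := h.pd_eu_compX hθ hη hz
  intro h0
  exact h.minor_ne_zero hz (by simp [h0, h1, h2, h3])

theorem g_relation (h : IsPointTransf I J θ η Ω F) (hθ : θ.MemClass I)
    (hη : η.MemClass J) {z : Space} (hz : z ∈ Ω) :
    η.g (compT F z) * pd et (compT F) z = θ.g z.1 * pd ex (compX F) z ^ 5 := by
  simpa using h.g_relation_totalDeriv hθ hη hz 0 (by simpa using h.pd_ex_compX_ne_zero hθ hη hz)

theorem pd_pd_et_compT (h : IsPointTransf I J θ η Ω F) (hθ : θ.MemClass I)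
    (hη : η.MemClass J) {z : Space} (hz : z ∈ Ω) :
    pd ex (pd et (compT F)) z = 0 ∧ pd eu (pd et (compT F)) z = 0 := by
  constructor <;> rw [pd_comm h.isOpen h.contDiffOn_compT hz] <;>
    refine pd_eq_zero_of_const h.isOpen (c := 0) (fun y hy => ?_) hz _
  · exact (h.pd_compT_eq_zero hθ hη hy).1
  · exact (h.pd_compT_eq_zero hθ hη hy).2

theorem pd_eu_pd_compX (h : IsPointTransf I J θ η Ω F) (hθ : θ.MemClass I)
    (hη : η.MemClass J) {z : Space} (hz : z ∈ Ω) (e : Space) :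
    pd eu (pd e (compX F)) z = 0 := by
  rw [pd_comm h.isOpen h.contDiffOn_compX hz]
  exact pd_eq_zero_of_const h.isOpen (fun y hy => h.pd_eu_compX hθ hη hy) hz _

/-- In `g̃(T) T_t = g X_x^5` everything except `X_x` is a function of `t` locally; differentiation
in `x` leaves `5 g X_x^4 X_xx = 0`. -/
theorem pd_ex_pd_ex_compX (h : IsPointTransf I J θ η Ω F) (hθ : θ.MemClass I)
    (hη : η.MemClass J) (hJ : IsOpen J) {z : Space} (hz : z ∈ Ω) :
    pd ex (pd ex (compX F)) z = 0 := by
  have hrel : ∀ y ∈ Ω, η.g (compT F y) * pd et (compT F) y - θ.g y.1 * pd ex (compX F) y ^ 5 = 0 :=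
    fun y hy => sub_eq_zero.2 (h.g_relation hθ hη hy)
  have hB := h.pd_ex_compX_ne_zero hθ hη hz
  have hg := hθ.g_ne_zero (h.subset _ hz)
  have d1 := hasDerivAt_line_comp hJ hη.smooth_g
    (differentiableAt_of_contDiffOn h.isOpen h.contDiffOn_compT hz) (h.mapsTo _ hz)
    (h.pd_compT_eq_zero hθ hη hz).1
  have d2 := hasDerivAt_line (differentiableAt_of_contDiffOn h.isOpen
    (contDiffOn_pd h.isOpen h.contDiffOn_compT et) hz) ex
  have d3 := hasDerivAt_line (differentiableAt_of_contDiffOn h.isOpen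
    (contDiffOn_pd h.isOpen h.contDiffOn_compX ex) hz) ex
  have d4 := hasDerivAt_line_fst θ.g z ex rfl
  have := deriv_line_eq_zero h.isOpen hz hrel ((d1.mul d2).sub (d4.mul (d3.pow 5)))
  rw [(h.pd_pd_et_compT hθ hη hz).1] at this
  simpa [hg, hB] using this

end IsPointTransf

/-- The jets of graphs related by a point transformation with `T = T(t)` and `X` affine in `x`. -/
theorem jets_of_mapsGraph {F : Space → Space} {u v : ℝ × ℝ → ℝ} {p : ℝ × ℝ}
    (hF : ContDiffAt ℝ ∞ F (p.1, p.2, u p)) (hu : ContDiffAt ℝ ∞ u p)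
    (hv : ContDiffAt ℝ ∞ v (baseMap F u p)) (hm : MapsGraph F u v p) {B : ℝ}
    (hT : ∀ᶠ y in 𝓝 p.2, compT F (p.1, y, u (p.1, y)) = compT F (p.1, p.2, u p))
    (hX : ∀ᶠ y in 𝓝 p.2,
      compX F (p.1, y, u (p.1, y)) = compX F (p.1, p.2, u p) + B * (y - p.2))
    (hTu : pd eu (compT F) (p.1, p.2, u p) = 0) (hXu : pd eu (compX F) (p.1, p.2, u p) = 0) :
    (∀ j, B ^ j * iteratedDeriv j (fun y => v ((baseMap F u p).1, y)) (baseMap F u p).2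
      = iteratedDeriv j (fun y => compU F (p.1, y, u (p.1, y))) p.2) ∧
    deriv (fun s => v (s, (baseMap F u p).2)) (baseMap F u p).1 * pd et (compT F) (p.1, p.2, u p)
      + iteratedDeriv 1 (fun y => v ((baseMap F u p).1, y)) (baseMap F u p).2
        * pd et (compX F) (p.1, p.2, u p)
      = pd et (compU F) (p.1, p.2, u p)
        + deriv (fun s => u (s, p.2)) p.1 * pd eu (compU F) (p.1, p.2, u p) := by
  set pt := baseMap F u p with hpt
  have ht : Tendsto (fun y : ℝ => (p.1, y)) (𝓝 p.2) (𝓝 p) := Continuous.tendsto' (by fun_prop) _ _ rfl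
  constructor
  · intro j
    have h1 : (fun y => compU F (p.1, y, u (p.1, y))) =ᶠ[𝓝 p.2]
        fun y => (fun y => v (pt.1, y)) ((pt.2 - B * p.2) + B * y) := by
      filter_upwards [hT, hX, ht.eventually hm.2] with y h1 h2 h3
      have h4 : baseMap F u (p.1, y) = (pt.1, (pt.2 - B * p.2) + B * y) := by
        refine Prod.ext h1 (h2.trans ?_)
        have : compX F (p.1, p.2, u p) = pt.2 := rfl
        simp only [this]
        ring
      rw [← h4]
      exact h3
    rw [(h1.iteratedDeriv j).eq_of_nhds, iteratedDeriv_comp_affine (fun y => v (pt.1, y))]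
    simp
  · rw [deriv_fst_eq_fderiv hv, deriv_fst_eq_fderiv hu, iteratedDeriv_one, deriv_snd_eq_fderiv hv]
    have h1 := fderiv_along_graph (contDiffAt_compU hF) hu 1 0
    have h2 : (fun q : ℝ × ℝ => compU F (q.1, q.2, u q)) =ᶠ[𝓝 p] fun q => v (baseMap F u q) := hm.2
    rw [h2.fderiv_eq] at h1
    have h3 : HasFDerivAt (fun q => v (baseMap F u q)) _ p :=
      HasFDerivAt.comp p (g := v) (hv.differentiableAt (by simp)).hasFDerivAt
      ((contDiffAt_baseMap hF hu).differentiableAt (by simp)).hasFDerivAt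
    rw [h3.fderiv, ContinuousLinearMap.comp_apply, fderiv_baseMap hF hu, hTu, hXu] at h1
    have h4 : ∀ a b : ℝ, fderiv ℝ v pt (a, b) = a * fderiv ℝ v pt (1, 0) + b * fderiv ℝ v pt (0, 1) := by
      intro a b
      have : ((a, b) : ℝ × ℝ) = a • (1, 0) + b • (0, 1) := by ext <;> simp
      rw [this, map_add, map_smul, map_smul]
      rfl
    rw [h4] at h1
    linear_combination h1

section affine
variable {Ω : Set Space} {f : Space → ℝ}

/-- Removing the part of `f` that is linear in the direction `e`. -/
theorem pd_sub_mul_coord (hΩ : IsOpen Ω) (hf : ContDiffOn ℝ ∞ f Ω) {z : Space} (hz : z ∈ Ω)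
    {e e' : Space} {l : Space → ℝ} {d : ℝ} (hl : HasDerivAt (fun s : ℝ => l (z + s • e')) d 0)
    (h0 : pd e' (pd e f) z = 0) (hls : DifferentiableAt ℝ l z) :
    pd e' (fun z => f z - pd e f z * l z) z = pd e' f z - pd e f z * d := by
  have hd := differentiableAt_of_contDiffOn hΩ hf hz
  have hd' := differentiableAt_of_contDiffOn hΩ (contDiffOn_pd hΩ hf e) hz
  have h1 := (hasDerivAt_line hd e').sub ((hasDerivAt_line hd' e').mul hl)
  have h2 := hasDerivAt_line (f := fun z => f z - pd e f z * l z) (hd.sub (hd'.mul hls)) e'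
  have := h2.unique h1
  rw [this, h0]
  simp

end affine

/-! ### The transformed equation and linearity of the component for `u` -/

namespace IsPointTransf

variable {I J : Set ℝ} {θ η : Coeffs} {Ω : Set Space} {F : Space → Space}

/-- Both `X_x` and `X - X_x (x - x₀)` have vanishing derivatives in `x` and `u`, so locally they are
functions of `t`. -/
theorem eventually_compX_eq (h : IsPointTransf I J θ η Ω F) (hθ : θ.MemClass I)
    (hη : η.MemClass J) (hJ : IsOpen J) {z₀ : Space} (hz : z₀ ∈ Ω) :
    ∀ᶠ z in 𝓝 z₀, z.1 = z₀.1 →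
      compX F z = compX F z₀ + pd ex (compX F) z₀ * (z.2.1 - z₀.2.1) := by
  have hΩ := h.isOpen.mem_nhds hz
  have hXx := contDiffOn_pd h.isOpen h.contDiffOn_compX ex
  have h1 : ∀ᶠ z in 𝓝 z₀, pd ex (compX F) z = pd ex (compX F) (z.1, z₀.2) := by
    refine eventually_eq_of_pd ?_ ?_ ?_ <;> filter_upwards [hΩ] with y hy
    · exact differentiableAt_of_contDiffOn h.isOpen hXx hy
    · exact h.pd_ex_pd_ex_compX hθ hη hJ hy
    · exact h.pd_eu_pd_compX hθ hη hy ex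
  have h2 : ∀ᶠ z in 𝓝 z₀, (fun z => compX F z - pd ex (compX F) z * (z.2.1 - z₀.2.1)) z
      = (fun z => compX F z - pd ex (compX F) z * (z.2.1 - z₀.2.1)) (z.1, z₀.2) := by
    refine eventually_eq_of_pd ?_ ?_ ?_ <;> filter_upwards [hΩ] with y hy
    · exact (differentiableAt_of_contDiffOn h.isOpen h.contDiffOn_compX hy).sub
        ((differentiableAt_of_contDiffOn h.isOpen hXx hy).mul (by fun_prop))
    · have hl : HasDerivAt (fun s : ℝ => (y + s • ex).2.1 - z₀.2.1) 1 0 := by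
        simpa using ((hasDerivAt_id (0 : ℝ)).const_add y.2.1).sub_const z₀.2.1
      rw [pd_sub_mul_coord h.isOpen h.contDiffOn_compX hy hl (h.pd_ex_pd_ex_compX hθ hη hJ hy)
        (by fun_prop)]
      ring
    · have hl : HasDerivAt (fun s : ℝ => (y + s • eu).2.1 - z₀.2.1) 0 0 := by
        simpa using hasDerivAt_const (0 : ℝ) (y.2.1 - z₀.2.1)
      rw [pd_sub_mul_coord h.isOpen h.contDiffOn_compX hy hl (h.pd_eu_pd_compX hθ hη hy ex)
        (by fun_prop), h.pd_eu_compX hθ hη hy]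
      ring
  filter_upwards [h1, h2] with z h1 h2 ht
  have h3 : ((z.1, z₀.2) : Space) = z₀ := by rw [ht]
  simp only [h3, sub_self, mul_zero, sub_zero] at h1 h2
  rw [h1] at h2
  linarith

/-- The equation for `u` at `p` in terms of the new coefficients. -/
theorem satisfies_iff_jets (h : IsPointTransf I J θ η Ω F) (hθ : θ.MemClass I)
    (hη : η.MemClass J) (hJ : IsOpen J) {u : ℝ × ℝ → ℝ} {p : ℝ × ℝ} (hu : ContDiffAt ℝ ∞ u p)
    {z : Space} (hz : z ∈ Ω) (hzp : z = (p.1, p.2, u p)) {B : ℝ} (hB : B = pd ex (compX F) z)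
    {N : ℕ → ℝ} (hN : ∀ j, N j = iteratedDeriv j (fun y => compU F (p.1, y, u (p.1, y))) p.2) :
    Satisfies θ u p ↔
      (pd et (compU F) z + deriv (fun s => u (s, p.2)) p.1 * pd eu (compU F) z
          - N 1 / B * pd et (compX F) z) / pd et (compT F) z
        + η.a (compT F z) * compU F z * (N 3 / B ^ 3)
        + η.b (compT F z) * (N 1 / B) * (N 2 / B ^ 2)
        + η.c (compT F z) * compU F z ^ 2 * (N 1 / B)
        + η.f (compT F z) * compU F z * (N 1 / B)
        + η.g (compT F z) * (N 5 / B ^ 5)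
        + η.h (compT F z) * (N 3 / B ^ 3)
        + η.m (compT F z) * compU F z
        + η.n (compT F z) * (N 1 / B)
        + η.k (compT F z) * compX F z * (N 1 / B) = 0 := by
  have hF := h.contDiffAt hz
  obtain ⟨hTx, hTu⟩ := h.pd_compT_eq_zero hθ hη hz
  have hXu := h.pd_eu_compX hθ hη hz
  have hTt := h.pd_et_compT_ne_zero hθ hη hz
  have hB0 : B ≠ 0 := by rw [hB]; exact h.pd_ex_compX_ne_zero hθ hη hz
  have evT := h.eventually_compT_eq hθ hη hz
  have evX := h.eventually_compX_eq hθ hη hJ hz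
  rw [← hB] at evX
  subst hzp
  have hI : (fderiv ℝ (baseMap F u) p).IsInvertible := by
    refine isInvertible_fderiv_baseMap hF hu rfl rfl ?_
    rw [hTx, hTu, hXu, ← hB]
    simpa using ⟨hTt, hB0⟩
  obtain ⟨v, hv, hm⟩ := exists_image_graph hF hu hI
  have hp : Tendsto (fun y : ℝ => (p.1, y)) (𝓝 p.2) (𝓝 p) :=
    Continuous.tendsto' (by fun_prop) _ _ rfl
  have hgr : Tendsto (fun y : ℝ => ((p.1, y, u (p.1, y)) : Space)) (𝓝 p.2) (𝓝 (p.1, p.2, u p)) :=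
    tendsto_const_nhds.prodMk_nhds (tendsto_id.prodMk_nhds (hu.continuousAt.tendsto.comp hp))
  obtain ⟨hj, ht⟩ := jets_of_mapsGraph hF hu hv hm (B := B) (hgr.eventually evT)
    ((hgr.eventually evX).mono fun y hy => hy rfl) hTu hXu
  rw [h.satisfies_iff u v p hz hu hv hm]
  have hj' : ∀ j, iteratedDeriv j (fun y => v ((baseMap F u p).1, y)) (baseMap F u p).2
      = N j / B ^ j := by
    intro j
    rw [hN, ← hj, mul_div_cancel_left₀ _ (pow_ne_zero j hB0)]
  have hv0 : v (baseMap F u p) = compU F (p.1, p.2, u p) := hm.2.self_of_nhds.symm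
  have hvt : deriv (fun s => v (s, (baseMap F u p).2)) (baseMap F u p).1
      = (pd et (compU F) (p.1, p.2, u p)
        + deriv (fun s => u (s, p.2)) p.1 * pd eu (compU F) (p.1, p.2, u p)
          - N 1 / B * pd et (compX F) (p.1, p.2, u p)) / pd et (compT F) (p.1, p.2, u p) := by
    rw [eq_div_iff hTt, ← ht, hj', pow_one]
    ring
  unfold Satisfies
  rw [hvt, hv0]
  simp only [hj', pow_one]
  rfl

/-- The equations contain no fourth derivative. Adding `y^4` to `u` changes `U` along the graph by
`y^4 U_u + o(y^5)`, with `U_u` evaluated along the graph. So in the transformed equation only the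
fifth derivative changes, by `120` times the total `x`-derivative of `U_u`, and `g̃ ≠ 0` forces this
to vanish. -/
theorem pd_ex_pd_eu_compU_add (h : IsPointTransf I J θ η Ω F) (hθ : θ.MemClass I)
    (hη : η.MemClass J) (hJ : IsOpen J) {z : Space} (hz : z ∈ Ω) (ξ : ℝ) :
    pd ex (pd eu (compU F)) z + ξ * pd eu (pd eu (compU F)) z = 0 := by
  have hB0 := h.pd_ex_compX_ne_zero hθ hη hz
  have hg := hθ.g_ne_zero (h.subset _ hz)
  have hg' : η.g (compT F z) ≠ 0 := hη.g_ne_zero (h.mapsTo _ hz)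
  have hUu := contDiffOn_pd h.isOpen h.contDiffOn_compU eu
  have hUud := differentiableAt_of_contDiffOn h.isOpen hUu hz
  obtain ⟨t, x, c₀⟩ := z
  set z₀ : Space := (t, x, c₀) with hz₀
  set p : ℝ × ℝ := (t, x) with hp
  change θ.g t ≠ 0 at hg
  set R : ℝ := θ.c t * c₀ ^ 2 * ξ + θ.f t * c₀ * ξ + θ.m t * c₀ + θ.n t * ξ + θ.k t * x * ξ with hR
  set c₅ : ℝ := -R / (120 * θ.g t) with hc₅
  have hc₅' : θ.g t * (120 * c₅) = -R := by rw [hc₅]; field_simp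
  set u : ℝ → ℝ × ℝ → ℝ := fun c₄ => testFun p c₀ 0 ξ 0 0 c₄ c₅ 0 with hu
  have hus (c₄ : ℝ) : ContDiff ℝ ∞ (u c₄) := contDiff_testFun ..
  have hup (c₄ : ℝ) : u c₄ p = c₀ := testFun_self ..
  have hS (c₄ : ℝ) : Satisfies θ (u c₄) p := by
    rw [hu, satisfies_testFun]
    simp only [hp, hc₅', hR]; ring
  have hlx (y : ℝ) : HasDerivAt (fun y : ℝ => x + y) 1 y := (hasDerivAt_id _).const_add x
  have hcs (c₄ : ℝ) : ContDiff ℝ ∞ (fun y : ℝ => ((t, x + y, u c₄ (t, x + y)) : Space)) := by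
    have := hus c₄
    fun_prop
  have hc0 (c₄ : ℝ) : ((t, x + 0, u c₄ (t, x + 0)) : Space) = z₀ := by
    rw [add_zero]; simp only [hz₀]; rw [← hup c₄]
  have hct (c₄ : ℝ) : Tendsto (fun y : ℝ => ((t, x + y, u c₄ (t, x + y)) : Space)) (𝓝 0) (𝓝 z₀) := by
    have := (hcs c₄).continuous.tendsto 0
    rwa [hc0] at this
  have hfs (c₄ : ℝ) : ContDiffAt ℝ ∞ (fun y : ℝ => compU F (t, x + y, u c₄ (t, x + y))) 0 :=
    ContDiffAt.comp 0 (g := compU F) (by rw [hc0]; exact contDiffAt_compU (h.contDiffAt hz))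
      (hcs c₄).contDiffAt
  have hdiff (y : ℝ) : u 1 (t, x + y) = u 0 (t, x + y) + y ^ 4 := by
    simp only [hu, testFun, quintic, hp]; ring
  obtain ⟨r, hr, hball⟩ := Metric.isOpen_iff.1 h.isOpen z₀ hz
  set f : ℝ → ℝ := fun y => compU F (t, x + y, u 1 (t, x + y)) - compU F (t, x + y, u 0 (t, x + y))
    with hf
  -- Mean value theorem in the variable `u`. The intermediate point is off the graph by at most
  -- `y^4`, too little to affect the first-order expansion of `U_u`.
  have hmv : ∀ᶠ y : ℝ in 𝓝 0, ∃ s, |s| ≤ y ^ 4 ∧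
      f y = y ^ 4 * pd eu (compU F) (t, x + y, u 0 (t, x + y) + s) := by
    filter_upwards [(hct 0).eventually (Metric.ball_mem_nhds z₀ hr),
      (hct 1).eventually (Metric.ball_mem_nhds z₀ hr)] with y h0 h1
    obtain ⟨y', hy, hy'⟩ := domain_mvt (f := compU F) (f' := fderiv ℝ (compU F))
      (fun a ha => (differentiableAt_of_contDiffOn h.isOpen h.contDiffOn_compU
        (hball ha)).hasFDerivAt.hasFDerivWithinAt) (convex_ball z₀ r) h0 h1
    rw [segment_eq_image'] at hy
    obtain ⟨s, ⟨hs0, hs1⟩, rfl⟩ := hy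
    have hy4 : 0 ≤ y ^ 4 := by positivity
    have e1 : ((t, x + y, u 1 (t, x + y)) : Space) - (t, x + y, u 0 (t, x + y)) = (0, 0, y ^ 4) := by
      rw [hdiff]; ext <;> simp
    have e2 : ((t, x + y, u 0 (t, x + y)) : Space) + s • ((0, 0, y ^ 4) : Space)
        = (t, x + y, u 0 (t, x + y) + s * y ^ 4) := by
      ext <;> simp
    refine ⟨s * y ^ 4, ?_, ?_⟩
    · rw [abs_of_nonneg (mul_nonneg hs0 hy4)]
      exact mul_le_of_le_one_left hy4 hs1
    · beta_reduce at hy'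
      rw [e1, e2, fderiv_eq_pd] at hy'
      simpa [hf] using hy'
  -- The mean value formula is only local. The default `s = 0` keeps the bound `|s| ≤ y^4` for every
  -- `y`, so `s` can be chosen as a function on the whole line.
  have hmv' : ∀ y : ℝ, ∃ s, |s| ≤ y ^ 4 ∧ ((∃ s, |s| ≤ y ^ 4 ∧
      f y = y ^ 4 * pd eu (compU F) (t, x + y, u 0 (t, x + y) + s)) →
      f y = y ^ 4 * pd eu (compU F) (t, x + y, u 0 (t, x + y) + s)) := by
    intro y
    by_cases hy : ∃ s, |s| ≤ y ^ 4 ∧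
      f y = y ^ 4 * pd eu (compU F) (t, x + y, u 0 (t, x + y) + s)
    · obtain ⟨s, hs, hs'⟩ := hy
      exact ⟨s, hs, fun _ => hs'⟩
    · exact ⟨0, by rw [abs_zero]; positivity, fun h => absurd h hy⟩
  choose s hs hs' using hmv'
  have hs0 : s 0 = 0 := by simpa using hs 0
  have hsd : HasDerivAt s 0 0 := by
    rw [hasDerivAt_iff_isLittleO_nhds_zero]
    have h1 : (fun y : ℝ => s (0 + y) - s 0 - y • (0 : ℝ)) =O[𝓝 0] fun y : ℝ => y ^ 4 := by
      refine Asymptotics.isBigO_of_le _ fun y => ?_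
      have hy4 : 0 ≤ y ^ 4 := by positivity
      simp only [zero_add, hs0, sub_zero, smul_zero, Real.norm_eq_abs, abs_of_nonneg hy4]
      exact hs y
    exact h1.trans_isLittleO (by simpa using Asymptotics.isLittleO_pow_pow (𝕜 := ℝ) (m := 1) (n := 4) (by norm_num))
  set κ₀ := pd eu (compU F) z₀ with hκ₀
  set κ₁ := pd ex (pd eu (compU F)) z₀ + ξ * pd eu (pd eu (compU F)) z₀ with hκ₁
  have hu0d : HasDerivAt (fun y => u 0 (t, x + y)) ξ 0 := by
    have h1 : HasFDerivAt (u 0) (fderiv ℝ (u 0) p) (t, x + 0) := by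
      rw [add_zero]; exact ((hus 0).differentiable (by simp) p).hasFDerivAt
    have h2 : HasDerivAt (fun y : ℝ => ((t, x + y) : ℝ × ℝ)) (0, 1) 0 :=
      (hasDerivAt_const _ _).prodMk (hlx 0)
    have := HasFDerivAt.comp_hasDerivAt (l := u 0) 0 h1 h2
    rw [hu, fderiv_testFun] at this
    simp only [zero_mul, one_mul, zero_add] at this
    exact this
  have hVd : HasDerivAt (fun y => pd eu (compU F) (t, x + y, u 0 (t, x + y) + s y)) κ₁ 0 := by
    have h1 : HasDerivAt (fun y : ℝ => ((t, x + y, u 0 (t, x + y) + s y) : Space)) (0, 1, ξ + 0) 0 :=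
      (hasDerivAt_const _ _).prodMk ((hlx 0).prodMk (hu0d.add hsd))
    have h2 : HasFDerivAt (pd eu (compU F)) (fderiv ℝ (pd eu (compU F)) z₀)
        (t, x + 0, u 0 (t, x + 0) + s 0) := by
      rw [hs0, add_zero (u 0 _), hc0]; exact hUud.hasFDerivAt
    have h3 := HasFDerivAt.comp_hasDerivAt (l := pd eu (compU F)) 0 h2 h1
    rw [fderiv_eq_pd] at h3
    refine h3.congr_deriv ?_
    rw [hκ₁]; ring
  -- Write `f y = y^4 V(y)` with `V(0) = κ₀` and `V'(0) = κ₁`. Once `κ₀ y^4` is removed, the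
  -- quotient by `y^5` is the slope of `V` at `0`.
  have hlim : Tendsto (fun y => (f y - quintic 0 0 0 0 κ₀ 0 y) / y ^ 5) (𝓝[≠] 0) (𝓝 κ₁) := by
    refine (hasDerivAt_iff_tendsto_slope.1 hVd).congr' ?_
    filter_upwards [nhdsWithin_le_nhds hmv, self_mem_nhdsWithin] with y hy hy0
    have hy0 : y ≠ 0 := hy0
    rw [slope_def_field, hs' y hy, hs0, add_zero (u 0 _), hc0]
    simp only [quintic, ← hκ₀]
    field_simp
    ring
  have hqs : ContDiff ℝ ∞ (quintic 0 0 0 0 κ₀ 0) := contDiff_quintic ..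
  obtain ⟨hj, h5⟩ := iteratedDeriv_of_tendsto_div_pow (f := fun y => f y - quintic 0 0 0 0 κ₀ 0 y)
    (((hfs 1).sub (hfs 0)).sub hqs.contDiffAt) 5 hlim
  set N : ℝ → ℕ → ℝ := fun c₄ j =>
    iteratedDeriv j (fun y => compU F (p.1, y, u c₄ (p.1, y))) p.2 with hN
  have hN' : ∀ c₄ j, N c₄ j = iteratedDeriv j (fun y => compU F (t, x + y, u c₄ (t, x + y))) 0 := by
    intro c₄ j
    have := congrFun (iteratedDeriv_comp_affine (fun y => compU F (p.1, y, u c₄ (p.1, y))) x 1 j) 0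
    simp only [one_pow, one_mul, add_zero] at this
    exact this.symm
  have hjet : ∀ j : ℕ, iteratedDeriv j (fun y => f y - quintic 0 0 0 0 κ₀ 0 y) 0
      = N 1 j - N 0 j - iteratedDeriv j (quintic 0 0 0 0 κ₀ 0) 0 := by
    intro j
    have hle : (j : WithTop ℕ∞) ≤ ∞ := by exact_mod_cast le_top
    rw [hN', hN', ← iteratedDeriv_sub ((hfs 1).of_le hle) ((hfs 0).of_le hle)]
    change _ = iteratedDeriv j f 0 - _
    rw [← iteratedDeriv_sub (((hfs 1).sub (hfs 0)).of_le hle) (hqs.contDiffAt.of_le hle)]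
    rfl
  obtain ⟨q1, q2, q3, q5⟩ := iteratedDeriv_quintic 0 0 0 0 κ₀ 0
  have e1 : N 1 1 = N 0 1 := by
    have := (hjet 1).symm.trans (hj 1 (by norm_num)); rw [q1] at this; linarith
  have e2 : N 1 2 = N 0 2 := by
    have := (hjet 2).symm.trans (hj 2 (by norm_num)); rw [q2] at this; linarith
  have e3 : N 1 3 = N 0 3 := by
    have := (hjet 3).symm.trans (hj 3 (by norm_num)); rw [q3] at this; linarith
  have e5 : N 1 5 = N 0 5 + 120 * κ₁ := by
    have := (hjet 5).symm.trans h5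
    rw [q5] at this
    norm_num [Nat.factorial] at this
    linarith
  have eq0 := (h.satisfies_iff_jets hθ hη hJ (hus 0).contDiffAt hz (by rw [hup]) rfl
    (fun j => rfl : ∀ j, N 0 j = _)).1 (hS 0)
  have eq1 := (h.satisfies_iff_jets hθ hη hJ (hus 1).contDiffAt hz (by rw [hup]) rfl
    (fun j => rfl : ∀ j, N 1 j = _)).1 (hS 1)
  have d0 : ∀ c₄, deriv (fun s => u c₄ (s, p.2)) p.1 = 0 := fun c₄ => deriv_testFun_fst ..
  rw [d0] at eq0 eq1
  rw [e1, e2, e3, e5] at eq1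
  have key : η.g (compT F z₀) * (120 * κ₁ / pd ex (compX F) z₀ ^ 5) = 0 := by
    linear_combination eq1 - eq0
  simpa [hg', hB0] using key

theorem pd_pd_eu_compU (h : IsPointTransf I J θ η Ω F) (hθ : θ.MemClass I)
    (hη : η.MemClass J) (hJ : IsOpen J) {z : Space} (hz : z ∈ Ω) :
    pd ex (pd eu (compU F)) z = 0 ∧ pd eu (pd eu (compU F)) z = 0 := by
  have h0 := h.pd_ex_pd_eu_compU_add hθ hη hJ hz 0
  have h1 := h.pd_ex_pd_eu_compU_add hθ hη hJ hz 1
  constructor <;> linarith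

end IsPointTransf

/-! ### Splitting with respect to the derivatives of `u` -/

namespace IsPointTransf

variable {I J : Set ℝ} {θ η : Coeffs} {Ω : Set Space} {F : Space → Space}

/-- As `T_u = X_u = 0`, the differential of `F` maps `eu` to `(0, 0, U_u)`. -/
theorem pd_eu_compU_ne_zero (h : IsPointTransf I J θ η Ω F) (hθ : θ.MemClass I)
    (hη : η.MemClass J) {z : Space} (hz : z ∈ Ω) : pd eu (compU F) z ≠ 0 := by
  intro h0
  obtain ⟨A, hA⟩ := h.nondegenerate z hz
  have h1 := fderiv_eq_comp (h.contDiffAt hz) eu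
  have h2 : fderiv ℝ (compT F) z eu = 0 := (h.pd_compT_eq_zero hθ hη hz).2
  have h3 : fderiv ℝ (compX F) z eu = 0 := h.pd_eu_compX hθ hη hz
  have h4 : fderiv ℝ (compU F) z eu = 0 := h0
  rw [h2, h3, h4, ← hA] at h1
  have h5 : A eu = A 0 := by rw [map_zero]; exact h1
  have h6 := congrArg (fun z : Space => z.2.2) (A.injective h5)
  norm_num at h6

/-- `U_u` is locally a function of `t`, and `U - U_u (u - u₀)` is locally independent of `u`. -/
theorem eventually_compU_eq (h : IsPointTransf I J θ η Ω F) (hθ : θ.MemClass I)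
    (hη : η.MemClass J) (hJ : IsOpen J) {z₀ : Space} (hz : z₀ ∈ Ω) :
    ∀ᶠ z in 𝓝 z₀, z.1 = z₀.1 →
      compU F z = pd eu (compU F) z₀ * (z.2.2 - z₀.2.2) + compU F (z.1, z.2.1, z₀.2.2) := by
  have hΩ := h.isOpen.mem_nhds hz
  have hUu := contDiffOn_pd h.isOpen h.contDiffOn_compU eu
  have h1 : ∀ᶠ z in 𝓝 z₀, pd eu (compU F) z = pd eu (compU F) (z.1, z₀.2) := by
    refine eventually_eq_of_pd ?_ ?_ ?_ <;> filter_upwards [hΩ] with y hy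
    · exact differentiableAt_of_contDiffOn h.isOpen hUu hy
    · exact (h.pd_pd_eu_compU hθ hη hJ hy).1
    · exact (h.pd_pd_eu_compU hθ hη hJ hy).2
  have h2 : ∀ᶠ z in 𝓝 z₀, (fun z => compU F z - pd eu (compU F) z * (z.2.2 - z₀.2.2)) z
      = (fun z => compU F z - pd eu (compU F) z * (z.2.2 - z₀.2.2)) (z.1, z.2.1, z₀.2.2) := by
    refine eventually_eq_of_pd_eu ?_ ?_ <;> filter_upwards [hΩ] with y hy
    · exact (differentiableAt_of_contDiffOn h.isOpen h.contDiffOn_compU hy).sub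
        ((differentiableAt_of_contDiffOn h.isOpen hUu hy).mul (by fun_prop))
    · have hl : HasDerivAt (fun s : ℝ => (y + s • eu).2.2 - z₀.2.2) 1 0 := by
        simpa using ((hasDerivAt_id (0 : ℝ)).const_add y.2.2).sub_const z₀.2.2
      rw [pd_sub_mul_coord h.isOpen h.contDiffOn_compU hy hl (h.pd_pd_eu_compU hθ hη hJ hy).2
        (by fun_prop)]
      ring
  filter_upwards [h1, h2] with z h1 h2 ht
  have h3 : ((z.1, z₀.2) : Space) = z₀ := by rw [ht]
  simp only [h3, sub_self, mul_zero, sub_zero] at h1 h2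
  rw [h1] at h2
  linarith

/-- The jets of the new dependent variable along the graph of a test function. -/
theorem iteratedDeriv_compU_testFun (h : IsPointTransf I J θ η Ω F) (hθ : θ.MemClass I)
    (hη : η.MemClass J) (hJ : IsOpen J) {t x c₀ : ℝ} (hz : (t, x, c₀) ∈ Ω)
    (τ c₁ c₂ c₃ c₄ c₅ ε : ℝ) {j : ℕ} (hj : 0 < j) :
    iteratedDeriv j (fun y => compU F (t, y, testFun (t, x) c₀ τ c₁ c₂ c₃ c₄ c₅ ε (t, y))) x
      = pd eu (compU F) (t, x, c₀) * iteratedDeriv j (quintic c₀ c₁ c₂ c₃ c₄ c₅) 0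
        + iteratedDeriv j (fun y => compU F (t, y, c₀)) x := by
  set u := testFun (t, x) c₀ τ c₁ c₂ c₃ c₄ c₅ ε with hu
  set Φ := pd eu (compU F) (t, x, c₀)
  have hus : ContDiff ℝ ∞ u := contDiff_testFun ..
  have hup : u (t, x) = c₀ := testFun_self ..
  have hgr : Tendsto (fun y : ℝ => ((t, y, u (t, y)) : Space)) (𝓝 x) (𝓝 (t, x, c₀)) := by
    have h1 : Continuous (fun y : ℝ => ((t, y, u (t, y)) : Space)) := by
      have := hus.continuous
      fun_prop
    have := h1.tendsto x
    rwa [hup] at this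
  have hev : (fun y => compU F (t, y, u (t, y))) =ᶠ[𝓝 x]
      (fun y => -(Φ * c₀) + Φ * u (t, y)) + fun y => compU F (t, y, c₀) := by
    filter_upwards [hgr.eventually (h.eventually_compU_eq hθ hη hJ hz)] with y hy
    rw [hy rfl]
    simp only [Pi.add_apply]
    ring
  have hle : (j : WithTop ℕ∞) ≤ ∞ := by exact_mod_cast le_top
  have hs1 : ContDiffAt ℝ ∞ (fun y => u (t, y)) x := by fun_prop
  have hs2 : ContDiffAt ℝ ∞ (fun y => compU F (t, y, c₀)) x :=
    ContDiffAt.comp x (g := compU F) (contDiffAt_compU (h.contDiffAt hz)) (by fun_prop)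
  rw [(hev.iteratedDeriv j).eq_of_nhds, iteratedDeriv_add
    ((contDiffAt_const.add (contDiffAt_const.mul hs1)).of_le hle) (hs2.of_le hle),
    iteratedDeriv_const_add hj, iteratedDeriv_const_mul_field]
  congr 2
  exact iteratedDeriv_testFun (t, x) c₀ τ c₁ c₂ c₃ c₄ c₅ ε j

/-- The determining equations obtained by splitting with respect to the derivatives of `u`. -/
theorem splitting (h : IsPointTransf I J θ η Ω F) (hθ : θ.MemClass I)
    (hη : η.MemClass J) (hJ : IsOpen J) (hθk : ∀ t ∈ I, θ.k t = 0) (hηk : ∀ t ∈ J, η.k t = 0)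
    {z : Space} (hz : z ∈ Ω) {W : ℕ → ℝ}
    (hW : ∀ j, W j = iteratedDeriv j (fun y => compU F (z.1, y, z.2.2)) z.2.1) :
    (η.a (compT F z) * compU F z + η.h (compT F z)) * pd et (compT F) z
        = (θ.a z.1 * z.2.2 + θ.h z.1) * pd ex (compX F) z ^ 3 ∧
    η.b (compT F z) * pd eu (compU F) z * pd et (compT F) z = θ.b z.1 * pd ex (compX F) z ^ 3 ∧
    η.b (compT F z) * W 1 = 0 ∧
    pd et (compT F) z * (η.b (compT F z) * W 2 / pd ex (compX F) z ^ 2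
          + η.c (compT F z) * compU F z ^ 2 + η.f (compT F z) * compU F z + η.n (compT F z))
        - (θ.c z.1 * z.2.2 ^ 2 + θ.f z.1 * z.2.2 + θ.n z.1) * pd ex (compX F) z
        - pd et (compX F) z = 0 ∧
    ((∀ j > 0, W j = 0) → pd et (compU F) z - pd eu (compU F) z * θ.m z.1 * z.2.2
      + pd et (compT F) z * η.m (compT F z) * compU F z = 0) := by
  have hB0 := h.pd_ex_compX_ne_zero hθ hη hz
  have hT0 := h.pd_et_compT_ne_zero hθ hη hz
  have hΦ0 := h.pd_eu_compU_ne_zero hθ hη hz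
  have hkθ := hθk _ (h.subset _ hz)
  have hkη : η.k (compT F z) = 0 := hηk _ (h.mapsTo _ hz)
  obtain ⟨t, x, c₀⟩ := z
  simp only at hW hkθ
  simp only
  -- The time derivative of the test function is eliminated by means of the equation, so `u_x`,
  -- `u_xx`, `u_xxx`, `u_xxxxx` are free. Quotients are written as products with inverses, so that
  -- the identity is polynomial.
  have E : ∀ c₁ c₂ c₃ c₅ : ℝ,
      (pd et (compU F) (t, x, c₀) + -(θ.a t * c₀ * (6 * c₃) + θ.b t * c₁ * (2 * c₂)
        + θ.c t * c₀ ^ 2 * c₁ + θ.f t * c₀ * c₁ + θ.g t * (120 * c₅) + θ.h t * (6 * c₃)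
        + θ.m t * c₀ + θ.n t * c₁) * pd eu (compU F) (t, x, c₀)
          - (pd eu (compU F) (t, x, c₀) * c₁ + W 1) * (pd ex (compX F) (t, x, c₀))⁻¹
            * pd et (compX F) (t, x, c₀)) * (pd et (compT F) (t, x, c₀))⁻¹
        + η.a (compT F (t, x, c₀)) * compU F (t, x, c₀)
          * ((pd eu (compU F) (t, x, c₀) * (6 * c₃) + W 3) * (pd ex (compX F) (t, x, c₀))⁻¹ ^ 3)
        + η.b (compT F (t, x, c₀))
          * ((pd eu (compU F) (t, x, c₀) * c₁ + W 1) * (pd ex (compX F) (t, x, c₀))⁻¹)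
          * ((pd eu (compU F) (t, x, c₀) * (2 * c₂) + W 2) * (pd ex (compX F) (t, x, c₀))⁻¹ ^ 2)
        + (η.c (compT F (t, x, c₀)) * compU F (t, x, c₀) ^ 2
            + η.f (compT F (t, x, c₀)) * compU F (t, x, c₀) + η.n (compT F (t, x, c₀)))
          * ((pd eu (compU F) (t, x, c₀) * c₁ + W 1) * (pd ex (compX F) (t, x, c₀))⁻¹)
        + η.g (compT F (t, x, c₀))
          * ((pd eu (compU F) (t, x, c₀) * (120 * c₅) + W 5) * (pd ex (compX F) (t, x, c₀))⁻¹ ^ 5)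
        + η.h (compT F (t, x, c₀))
          * ((pd eu (compU F) (t, x, c₀) * (6 * c₃) + W 3) * (pd ex (compX F) (t, x, c₀))⁻¹ ^ 3)
        + η.m (compT F (t, x, c₀)) * compU F (t, x, c₀) = 0 := by
    intro c₁ c₂ c₃ c₅
    set τ := -(θ.a t * c₀ * (6 * c₃) + θ.b t * c₁ * (2 * c₂)
      + θ.c t * c₀ ^ 2 * c₁ + θ.f t * c₀ * c₁ + θ.g t * (120 * c₅) + θ.h t * (6 * c₃)
      + θ.m t * c₀ + θ.n t * c₁) with hτ
    have hS : Satisfies θ (testFun (t, x) c₀ τ c₁ c₂ c₃ 0 c₅ 0) (t, x) := by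
      rw [satisfies_testFun]
      simp only [hτ, hkθ]; ring
    have hk := (h.satisfies_iff_jets hθ hη hJ (contDiff_testFun ..).contDiffAt hz
      (by rw [testFun_self]) rfl (fun j => rfl)).1 hS
    obtain ⟨q1, q2, q3, q5⟩ := iteratedDeriv_quintic c₀ c₁ c₂ c₃ 0 c₅
    have hjj (j : ℕ) (hj : 0 < j) :=
      h.iteratedDeriv_compU_testFun hθ hη hJ hz τ c₁ c₂ c₃ 0 c₅ 0 hj
    rw [deriv_testFun_fst] at hk
    simp only [hjj 1 (by norm_num), hjj 2 (by norm_num), hjj 3 (by norm_num), hjj 5 (by norm_num),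
      q1, q2, q3, q5, hkη, ← hW] at hk
    rw [← hk]
    ring
  clear hW
  have hs := mul_inv_cancel₀ hT0
  have hq := mul_inv_cancel₀ hB0
  simp only [div_eq_mul_inv, ← inv_pow]
  set B := pd ex (compX F) (t, x, c₀)
  set Xt := pd et (compX F) (t, x, c₀)
  set Tt := pd et (compT F) (t, x, c₀)
  set Φ := pd eu (compU F) (t, x, c₀)
  set Ut := pd et (compU F) (t, x, c₀)
  set U := compU F (t, x, c₀)
  set T := compT F (t, x, c₀)
  set q := B⁻¹
  set s := Tt⁻¹
  -- Finite differences isolate coefficients: `e3 - e0` that of `u_xxx`, `e12 - e1 - e2 + e0` that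
  -- of `u_x u_xx`, `e2 - e0` that of `u_xx` and `e1 - e0` that of `u_x`. Each has the factor `U_u ≠
  -- 0`.
  have e0 := E 0 0 0 0
  have e1 := E 1 0 0 0
  have e2 := E 0 1 0 0
  have e3 := E 0 0 1 0
  have e12 := E 1 1 0 0
  clear E
  have hq3 : B ^ 3 * q ^ 3 = 1 := by rw [← mul_pow, hq, one_pow]
  have r3 : (η.a T * U + η.h T) * q ^ 3 = (θ.a t * c₀ + θ.h t) * s := by
    apply mul_left_cancel₀ hΦ0
    linear_combination (e3 - e0) / 6
  have r12 : η.b T * Φ * q ^ 3 = θ.b t * s := by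
    apply mul_left_cancel₀ hΦ0
    linear_combination (e12 - e1 - e2 + e0) / 2
  have r2 : η.b T * W 1 * q ^ 3 = 0 := by
    apply mul_left_cancel₀ hΦ0
    linear_combination (e2 - e0) / 2
  have r1 : -(θ.c t * c₀ ^ 2 + θ.f t * c₀ + θ.n t) * s - q * Xt * s + η.b T * W 2 * q ^ 3
      + (η.c T * U ^ 2 + η.f T * U + η.n T) * q = 0 := by
    apply mul_left_cancel₀ hΦ0
    linear_combination e1 - e0
  refine ⟨?_, ?_, ?_, ?_, fun hW => ?_⟩
  · linear_combination Tt * B ^ 3 * r3 - (η.a T * U + η.h T) * Tt * hq3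
      + (θ.a t * c₀ + θ.h t) * B ^ 3 * hs
  · linear_combination Tt * B ^ 3 * r12 - η.b T * Φ * Tt * hq3 + θ.b t * B ^ 3 * hs
  · linear_combination B ^ 3 * r2 - η.b T * W 1 * hq3
  · linear_combination B * Tt * r1
      + ((θ.c t * c₀ ^ 2 + θ.f t * c₀ + θ.n t) * B + q * B * Xt) * hs + Xt * hq
      - (η.b T * W 2 * Tt * q ^ 2 + Tt * (η.c T * U ^ 2 + η.f T * U + η.n T)) * hq
  · simp only [hW 1 (by norm_num), hW 2 (by norm_num), hW 3 (by norm_num), hW 5 (by norm_num)] at e0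
    linear_combination Tt * e0 - (Ut - Φ * θ.m t * c₀) * hs

/-! ### The determining equations -/

theorem eventually_slice {z : Space} {P : Space → Prop} (h : ∀ᶠ y in 𝓝 z, P y) :
    ∀ᶠ y in 𝓝 z.2.1, P (z.1, y, z.2.2) := by
  have : Tendsto (fun y : ℝ => ((z.1, y, z.2.2) : Space)) (𝓝 z.2.1) (𝓝 z) :=
    Continuous.tendsto' (by fun_prop) _ _ rfl
  exact this.eventually h

theorem deriv_slice {f : Space → ℝ} {z : Space} (hf : DifferentiableAt ℝ f z) :
    deriv (fun y => f (z.1, y, z.2.2)) z.2.1 = pd ex f z := by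
  have h1 : HasDerivAt (fun y : ℝ => ((z.1, y, z.2.2) : Space)) ex z.2.1 :=
    (hasDerivAt_const _ _).prodMk ((hasDerivAt_id _).prodMk (hasDerivAt_const _ _))
  exact (HasFDerivAt.comp_hasDerivAt (l := f) z.2.1 hf.hasFDerivAt h1).deriv

/-- The determining equations for admissible transformations of the subclass `k = 0`. -/
structure Determining (θ η : Coeffs) (F : Space → Space) (z : Space) : Prop where
  Tx : pd ex (compT F) z = 0
  Tu : pd eu (compT F) z = 0
  Tt : pd et (compT F) z ≠ 0
  Xu : pd eu (compX F) z = 0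
  Xx : pd ex (compX F) z ≠ 0
  Xxe : ∀ e, pd e (pd ex (compX F)) z = 0
  Ux : pd ex (compU F) z = 0
  Uu : pd eu (compU F) z ≠ 0
  Uux : pd ex (pd eu (compU F)) z = 0
  Uuu : pd eu (pd eu (compU F)) z = 0
  Uut : pd et (pd eu (compU F)) z
    = pd eu (compU F) z * (θ.m z.1 - pd et (compT F) z * η.m (compT F z))
  Ut : pd et (compU F) z = pd eu (compU F) z * θ.m z.1 * z.2.2
    - pd et (compT F) z * η.m (compT F z) * compU F z
  a : η.a (compT F z) * pd eu (compU F) z * pd et (compT F) z = θ.a z.1 * pd ex (compX F) z ^ 3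
  b : η.b (compT F z) * pd eu (compU F) z * pd et (compT F) z = θ.b z.1 * pd ex (compX F) z ^ 3
  c : η.c (compT F z) * pd eu (compU F) z ^ 2 * pd et (compT F) z = θ.c z.1 * pd ex (compX F) z
  f : pd et (compT F) z * pd eu (compU F) z * (2 * η.c (compT F z) * compU F z + η.f (compT F z))
    = (2 * θ.c z.1 * z.2.2 + θ.f z.1) * pd ex (compX F) z
  g : η.g (compT F z) * pd et (compT F) z = θ.g z.1 * pd ex (compX F) z ^ 5
  h : (η.a (compT F z) * compU F z + η.h (compT F z)) * pd et (compT F) z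
    = (θ.a z.1 * z.2.2 + θ.h z.1) * pd ex (compX F) z ^ 3
  Xt : pd et (compX F) z = pd et (compT F) z * (η.c (compT F z) * compU F z ^ 2
      + η.f (compT F z) * compU F z + η.n (compT F z))
    - (θ.c z.1 * z.2.2 ^ 2 + θ.f z.1 * z.2.2 + θ.n z.1) * pd ex (compX F) z

/-- The relations of `splitting` hold on the whole open set `Ω` and may be differentiated in `x` and
`u`, which leaves the arbitrary elements, `T_t` and `X_x` unchanged. The coefficient of `u_xxx`
yields the rule for `a` and `ã U_x = 0`. The coefficient of `u_x` yields the rule for `f`, which in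
turn yields the rule for `c` and `c̃ U_x = 0`. -/
theorem determining (h : IsPointTransf I J θ η Ω F) (hθ : θ.MemClass I)
    (hη : η.MemClass J) (hJ : IsOpen J) (hθk : ∀ t ∈ I, θ.k t = 0) (hηk : ∀ t ∈ J, η.k t = 0)
    {z : Space} (hz : z ∈ Ω) : Determining θ η F z := by
  have hΩ := h.isOpen
  have hTs := h.contDiffOn_compT
  have hXs := h.contDiffOn_compX
  have hUs := h.contDiffOn_compU
  have hT0 {y} (hy : y ∈ Ω) := h.pd_et_compT_ne_zero hθ hη hy
  have hTx {y} (hy : y ∈ Ω) := (h.pd_compT_eq_zero hθ hη hy).1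
  have hTu {y} (hy : y ∈ Ω) := (h.pd_compT_eq_zero hθ hη hy).2
  have hTtx {y} (hy : y ∈ Ω) := (h.pd_pd_et_compT hθ hη hy).1
  have hTtu {y} (hy : y ∈ Ω) := (h.pd_pd_et_compT hθ hη hy).2
  have hXu {y} (hy : y ∈ Ω) := h.pd_eu_compX hθ hη hy
  have hXtu {y} (hy : y ∈ Ω) := h.pd_eu_pd_compX hθ hη hy et
  have hXxu {y} (hy : y ∈ Ω) := h.pd_eu_pd_compX hθ hη hy ex
  have hXxx {y} (hy : y ∈ Ω) := h.pd_ex_pd_ex_compX hθ hη hJ hy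
  have hB0 {y} (hy : y ∈ Ω) := h.pd_ex_compX_ne_zero hθ hη hy
  have hΦ0 {y} (hy : y ∈ Ω) := h.pd_eu_compU_ne_zero hθ hη hy
  have hUux {y} (hy : y ∈ Ω) := (h.pd_pd_eu_compU hθ hη hJ hy).1
  have hUuu {y} (hy : y ∈ Ω) := (h.pd_pd_eu_compU hθ hη hJ hy).2
  have hsp {y} (hy : y ∈ Ω) := h.splitting hθ hη hJ hθk hηk hy (fun j => rfl)
  have hadd (y : Space) : y + ((0, 0, 0) : Space) = y := add_zero y
  have dfst (q : ℝ → ℝ) (y e : Space) (he : e.1 = 0) := hasDerivAt_line_fst q y e he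
  have dcx {q : ℝ → ℝ} (hq : ContDiffOn ℝ ∞ q J) {y : Space} (hy : y ∈ Ω) :=
    hasDerivAt_line_comp hJ hq (differentiableAt_of_contDiffOn hΩ hTs hy) (h.mapsTo _ hy) (hTx hy)
  have dcu {q : ℝ → ℝ} (hq : ContDiffOn ℝ ∞ q J) {y : Space} (hy : y ∈ Ω) :=
    hasDerivAt_line_comp hJ hq (differentiableAt_of_contDiffOn hΩ hTs hy) (h.mapsTo _ hy) (hTu hy)
  have dl {f : Space → ℝ} (hf : ContDiffOn ℝ ∞ f Ω) {y : Space} (hy : y ∈ Ω) (e : Space) :=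
    hasDerivAt_line (differentiableAt_of_contDiffOn hΩ hf hy) e
  have sTt := contDiffOn_pd hΩ hTs et
  have sXx := contDiffOn_pd hΩ hXs ex
  have sXt := contDiffOn_pd hΩ hXs et
  have sUx := contDiffOn_pd hΩ hUs ex
  have sUt := contDiffOn_pd hΩ hUs et
  have sUu := contDiffOn_pd hΩ hUs eu
  have dcoordx (y : Space) : HasDerivAt (fun s : ℝ => (y + s • ex).2.2) 0 0 := by
    simpa using hasDerivAt_const (0 : ℝ) y.2.2
  have dcoordu (y : Space) : HasDerivAt (fun s : ℝ => (y + s • eu).2.2) 1 0 := by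
    simpa using (hasDerivAt_id (0 : ℝ)).const_add y.2.2
  have hbU : ∀ y ∈ Ω, η.b (compT F y) * pd ex (compU F) y = 0 := by
    intro y hy
    have := (hsp hy).2.2.1
    rwa [iteratedDeriv_one, deriv_slice (differentiableAt_of_contDiffOn hΩ hUs hy)] at this
  -- This removes the term with `W 2` from the coefficient of `u_x`.
  have hbUU : ∀ y ∈ Ω, η.b (compT F y) * pd ex (pd ex (compU F)) y = 0 := by
    intro y hy
    have := deriv_line_eq_zero hΩ hy hbU ((dcx hη.smooth_b hy).mul (dl sUx hy ex))
    simpa [hadd] using this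
  have hn : ∀ y ∈ Ω, pd et (compT F) y * (η.c (compT F y) * compU F y ^ 2
        + η.f (compT F y) * compU F y + η.n (compT F y))
        - (θ.c y.1 * y.2.2 ^ 2 + θ.f y.1 * y.2.2 + θ.n y.1) * pd ex (compX F) y
        - pd et (compX F) y = 0 := by
    intro y hy
    have h1 := (hsp hy).2.2.2.1
    have h2 : iteratedDeriv 2 (fun s => compU F (y.1, s, y.2.2)) y.2.1
        = pd ex (pd ex (compU F)) y := by
      have h3 : deriv (fun s => compU F (y.1, s, y.2.2)) =ᶠ[𝓝 y.2.1]
          fun s => pd ex (compU F) (y.1, s, y.2.2) := by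
        filter_upwards [eventually_slice (hΩ.mem_nhds hy)] with s hs
        exact deriv_slice (z := (y.1, s, y.2.2)) (differentiableAt_of_contDiffOn hΩ hUs hs)
      rw [iteratedDeriv_succ, iteratedDeriv_one, h3.deriv_eq,
        deriv_slice (differentiableAt_of_contDiffOn hΩ sUx hy)]
    rw [h2, hbUU y hy] at h1
    linear_combination h1
  have hh : ∀ y ∈ Ω, (η.a (compT F y) * compU F y + η.h (compT F y)) * pd et (compT F) y
      - (θ.a y.1 * y.2.2 + θ.h y.1) * pd ex (compX F) y ^ 3 = 0 := fun y hy =>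
    sub_eq_zero.2 (hsp hy).1
  have haU : ∀ y ∈ Ω, η.a (compT F y) * pd ex (compU F) y = 0 := by
    intro y hy
    have := deriv_line_eq_zero hΩ hy hh
      (((((dcx hη.smooth_a hy).mul (dl hUs hy ex)).add (dcx hη.smooth_h hy)).mul (dl sTt hy ex)).sub
        ((((dfst θ.a y ex rfl).mul (dcoordx y)).add (dfst θ.h y ex rfl)).mul
          ((dl sXx hy ex).pow 3)))
    rw [hTtx hy, hXxx hy] at this
    have hTt := hT0 hy
    simpa [hadd, hTt] using this
  have ha : ∀ y ∈ Ω, η.a (compT F y) * pd eu (compU F) y * pd et (compT F) y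
      = θ.a y.1 * pd ex (compX F) y ^ 3 := by
    intro y hy
    have := deriv_line_eq_zero hΩ hy hh
      (((((dcu hη.smooth_a hy).mul (dl hUs hy eu)).add (dcu hη.smooth_h hy)).mul (dl sTt hy eu)).sub
        ((((dfst θ.a y eu rfl).mul (dcoordu y)).add (dfst θ.h y eu rfl)).mul
          ((dl sXx hy eu).pow 3)))
    rw [hTtu hy, hXxu hy] at this
    simp [hadd] at this
    linear_combination this
  have hf : ∀ y ∈ Ω, pd et (compT F) y * pd eu (compU F) y
        * (2 * η.c (compT F y) * compU F y + η.f (compT F y))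
      - (2 * θ.c y.1 * y.2.2 + θ.f y.1) * pd ex (compX F) y = 0 := by
    intro y hy
    have := deriv_line_eq_zero hΩ hy hn
      ((((dl sTt hy eu).mul ((((dcu hη.smooth_c hy).mul ((dl hUs hy eu).pow 2)).add
        ((dcu hη.smooth_f hy).mul (dl hUs hy eu))).add (dcu hη.smooth_n hy))).sub
        (((((dfst θ.c y eu rfl).mul ((dcoordu y).pow 2)).add
        ((dfst θ.f y eu rfl).mul (dcoordu y))).add (dfst θ.n y eu rfl)).mul (dl sXx hy eu))).sub
        (dl sXt hy eu))
    rw [hTtu hy, hXxu hy, hXtu hy] at this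
    simp [hadd] at this
    linear_combination this
  have hcU : ∀ y ∈ Ω, η.c (compT F y) * pd ex (compU F) y = 0 := by
    intro y hy
    have := deriv_line_eq_zero hΩ hy hf
      ((((dl sTt hy ex).mul (dl sUu hy ex)).mul ((((dcx hη.smooth_c hy).const_mul 2).mul
        (dl hUs hy ex)).add (dcx hη.smooth_f hy))).sub
        (((((dfst θ.c y ex rfl).const_mul 2).mul (dcoordx y)).add (dfst θ.f y ex rfl)).mul
          (dl sXx hy ex)))
    rw [hTtx hy, hUux hy, hXxx hy] at this
    have hTt := hT0 hy
    have hΦ := hΦ0 hy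
    simpa [hadd, hTt, hΦ] using this
  have hc : ∀ y ∈ Ω, η.c (compT F y) * pd eu (compU F) y ^ 2 * pd et (compT F) y
      = θ.c y.1 * pd ex (compX F) y := by
    intro y hy
    have := deriv_line_eq_zero hΩ hy hf
      ((((dl sTt hy eu).mul (dl sUu hy eu)).mul ((((dcu hη.smooth_c hy).const_mul 2).mul
        (dl hUs hy eu)).add (dcu hη.smooth_f hy))).sub
        (((((dfst θ.c y eu rfl).const_mul 2).mul (dcoordu y)).add (dfst θ.f y eu rfl)).mul
          (dl sXx hy eu)))
    rw [hTtu hy, hUuu hy, hXxu hy] at this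
    simp [hadd] at this
    linear_combination this / 2
  -- Where `U_x ≠ 0`, all of `ã, b̃, c̃` would vanish at the image time, which the class excludes.
  have hUx : ∀ y ∈ Ω, pd ex (compU F) y = 0 := by
    intro y hy
    by_contra hne
    have h1 : η.a (compT F y) = 0 := (mul_eq_zero.1 (haU y hy)).resolve_right hne
    have h2 : η.b (compT F y) = 0 := (mul_eq_zero.1 (hbU y hy)).resolve_right hne
    have h3 : η.c (compT F y) = 0 := (mul_eq_zero.1 (hcU y hy)).resolve_right hne
    exact hη.ne_zero _ (h.mapsTo _ hy) (by
      change η.g (compT F y) * (η.a (compT F y) ^ 2 + η.b (compT F y) ^ 2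
        + η.c (compT F y) ^ 2) = 0
      rw [h1, h2, h3]; ring)
  -- The condition `k = k̃ = 0` takes effect here: `x` does not occur explicitly in the coefficient
  -- of `u_x`, so its derivative in `x` is just `-X_tx`.
  have hXtx : ∀ y ∈ Ω, pd ex (pd et (compX F)) y = 0 := by
    intro y hy
    have := deriv_line_eq_zero hΩ hy hn
      ((((dl sTt hy ex).mul ((((dcx hη.smooth_c hy).mul ((dl hUs hy ex).pow 2)).add
        ((dcx hη.smooth_f hy).mul (dl hUs hy ex))).add (dcx hη.smooth_n hy))).sub
        (((((dfst θ.c y ex rfl).mul ((dcoordx y).pow 2)).add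
        ((dfst θ.f y ex rfl).mul (dcoordx y))).add (dfst θ.n y ex rfl)).mul (dl sXx hy ex))).sub
        (dl sXt hy ex))
    rw [hTtx hy, hXxx hy, hUx y hy] at this
    simpa [hadd] using this
  have hXxe : ∀ e, pd e (pd ex (compX F)) z = 0 := by
    rintro ⟨e1, e2, e3⟩
    have h1 : pd et (pd ex (compX F)) z = 0 := by rw [pd_comm hΩ hXs hz]; exact hXtx z hz
    rw [pd, fderiv_eq_pd, h1, hXxx hz, hXxu hz]
    ring
  have hm : ∀ y ∈ Ω, pd et (compU F) y - pd eu (compU F) y * θ.m y.1 * y.2.2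
      + pd et (compT F) y * η.m (compT F y) * compU F y = 0 := by
    intro y hy
    refine (hsp hy).2.2.2.2 fun j hj => ?_
    have h1 : ∀ᶠ y' in 𝓝 y, compU F y' = compU F (y'.1, y.2.1, y'.2.2) := by
      refine eventually_eq_of_pd_ex ?_ ?_ <;> filter_upwards [hΩ.mem_nhds hy] with y' hy'
      · exact differentiableAt_of_contDiffOn hΩ hUs hy'
      · exact hUx y' hy'
    have h2 : (fun s => compU F (y.1, s, y.2.2)) =ᶠ[𝓝 y.2.1] fun _ => compU F y := by
      filter_upwards [eventually_slice h1] with s hs using hs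
    rw [(h2.iteratedDeriv j).eq_of_nhds, iteratedDeriv_const, if_neg (by omega)]
  have hUut : pd et (pd eu (compU F)) z
      = pd eu (compU F) z * (θ.m z.1 - pd et (compT F) z * η.m (compT F z)) := by
    have := deriv_line_eq_zero hΩ hz hm
      (((dl sUt hz eu).sub (((dl sUu hz eu).mul (dfst θ.m z eu rfl)).mul (dcoordu z))).add
        (((dl sTt hz eu).mul (dcu hη.smooth_m hz)).mul (dl hUs hz eu)))
    rw [hTtu hz, hUuu hz, pd_comm hΩ hUs hz] at this
    simp [hadd] at this
    linear_combination this
  exact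
    { Tx := hTx hz
      Tu := hTu hz
      Tt := hT0 hz
      Xu := hXu hz
      Xx := hB0 hz
      Xxe := hXxe
      Ux := hUx z hz
      Uu := hΦ0 hz
      Uux := hUux hz
      Uuu := hUuu hz
      Uut := hUut
      Ut := by linear_combination hm z hz
      a := ha z hz
      b := (hsp hz).2.1
      c := hc z hz
      f := sub_eq_zero.1 (hf z hz)
      g := h.g_relation hθ hη hz
      h := (hsp hz).1
      Xt := by linear_combination -(hn z hz) }

end IsPointTransf

/-! ### Antiderivatives on an interval and `exp (-∫ m dt)` -/

theorem hasDerivAt_integral_of_mem {q : ℝ → ℝ} {K : Set ℝ} (hK : IsOpen K) (hc : K.OrdConnected)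
    (hq : ContinuousOn q K) {t₀ t : ℝ} (h₀ : t₀ ∈ K) (ht : t ∈ K) :
    HasDerivAt (fun s => ∫ r in t₀..s, q r) (q t) t := by
  have hsub : uIcc t₀ t ⊆ K := hc.uIcc_subset h₀ ht
  exact intervalIntegral.integral_hasDerivAt_right (hq.mono hsub).intervalIntegrable
    (hq.stronglyMeasurableAtFilter hK t ht) (hq.continuousAt (hK.mem_nhds ht))

theorem IsOpenInterval.ordConnected {I : Set ℝ} (h : IsOpenInterval I) : I.OrdConnected :=
  h.2.isPreconnected.ordConnected

theorem hasDerivAt_expInt {θ : Coeffs} {I : Set ℝ} (hI : IsOpenInterval I)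
    (hm : ContinuousOn θ.m I) {t₀ t : ℝ} (h₀ : t₀ ∈ I) (ht : t ∈ I) :
    HasDerivAt (expInt t₀ θ) (-(θ.m t) * expInt t₀ θ t) t := by
  have := (hasDerivAt_integral_of_mem hI.1 hI.ordConnected hm h₀ ht).neg.exp
  exact this.congr_deriv (by simp only [expInt, Pi.neg_apply]; ring)

theorem expInt_pos (t₀ : ℝ) (θ : Coeffs) (t : ℝ) : 0 < expInt t₀ θ t := Real.exp_pos _

theorem expInt_congr {θ θ' : Coeffs} {I : Set ℝ} (hc : I.OrdConnected)
    (h : ∀ t ∈ I, θ.m t = θ'.m t) {t₀ t : ℝ} (h₀ : t₀ ∈ I) (ht : t ∈ I) :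
    expInt t₀ θ t = expInt t₀ θ' t := by
  unfold expInt
  rw [intervalIntegral.integral_congr fun s hs => h s (hc.uIcc_subset h₀ ht hs)]

theorem contDiffOn_expInt {θ : Coeffs} {I : Set ℝ} (hI : IsOpenInterval I)
    (hm : ContDiffOn ℝ ∞ θ.m I) {t₀ : ℝ} (h₀ : t₀ ∈ I) : ContDiffOn ℝ ∞ (expInt t₀ θ) I := by
  have h1 : ∀ t ∈ I, HasDerivAt (fun s => ∫ r in t₀..s, θ.m r) (θ.m t) t := fun t ht =>
    hasDerivAt_integral_of_mem hI.1 hI.ordConnected hm.continuousOn h₀ ht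
  have h2 : ContDiffOn ℝ ∞ (fun s => ∫ r in t₀..s, θ.m r) I := by
    rw [contDiffOn_infty_iff_deriv_of_isOpen hI.1]
    exact ⟨fun t ht => (h1 t ht).differentiableAt.differentiableWithinAt,
      hm.congr fun t ht => (h1 t ht).deriv⟩
  exact h2.neg.exp

/-! ### From local to global on a connected domain -/

section connected
variable {Ω : Set Space} {f : Space → ℝ}

theorem exists_const_of_line_deriv (hΩ : IsOpen Ω) (hc : IsConnected Ω)
    (hd : ∀ z ∈ Ω, DifferentiableAt ℝ f z)
    (h : ∀ z ∈ Ω, ∀ e : Space, HasDerivAt (fun s : ℝ => f (z + s • e)) 0 0) :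
    ∃ C, ∀ z ∈ Ω, f z = C := by
  refine hΩ.exists_is_const_of_fderiv_eq_zero hc.isPreconnected
    (fun z hz => (hd z hz).differentiableWithinAt) fun z hz => ?_
  refine ContinuousLinearMap.ext fun e => ?_
  exact (hasDerivAt_line (hd z hz) e).unique (h z hz e)

/-- A smooth function on `Ω` depending only on `t` is a smooth function of `t`. -/
theorem exists_descent (hΩ : IsOpen Ω) (hf : ContDiffOn ℝ ∞ f Ω)
    (h : ∀ z ∈ Ω, ∀ z' ∈ Ω, z.1 = z'.1 → f z = f z') :
    ∃ φ : ℝ → ℝ, ContDiffOn ℝ ∞ φ (Prod.fst '' Ω) ∧ (∀ z ∈ Ω, f z = φ z.1) ∧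
      ∀ z ∈ Ω, deriv φ z.1 = pd et f z := by
  classical
  -- The value of `f` at an arbitrary point of `Ω` over `t`; the hypothesis makes the choice
  -- immaterial. Smoothness is local, since near `z.1` this is `f (·, z.2)`.
  set φ : ℝ → ℝ := fun t => if ht : t ∈ Prod.fst '' Ω then f ht.choose else 0 with hφ
  have h1 : ∀ z ∈ Ω, f z = φ z.1 := by
    intro z hz
    have ht : z.1 ∈ Prod.fst '' Ω := mem_image_of_mem _ hz
    rw [hφ]
    simp only [dif_pos ht]
    exact h z hz _ ht.choose_spec.1 ht.choose_spec.2.symm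
  have h2 : ∀ z ∈ Ω, φ =ᶠ[𝓝 z.1] fun s => f (s, z.2) := by
    intro z hz
    have ht : Tendsto (fun s : ℝ => ((s, z.2) : Space)) (𝓝 z.1) (𝓝 z) :=
      Continuous.tendsto' (by fun_prop) _ _ rfl
    filter_upwards [ht.eventually (hΩ.mem_nhds hz)] with s hs
    exact (h1 _ hs).symm
  refine ⟨φ, ?_, h1, fun z hz => ?_⟩
  · rintro _ ⟨z, hz, rfl⟩
    refine ContDiffAt.contDiffWithinAt (ContDiffAt.congr_of_eventuallyEq ?_ (h2 z hz))
    exact ContDiffAt.comp z.1 (g := f) (hf.contDiffAt (hΩ.mem_nhds hz)) (by fun_prop)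
  · rw [(h2 z hz).deriv_eq]
    have h3 : HasDerivAt (fun s : ℝ => ((s, z.2) : Space)) et z.1 :=
      (hasDerivAt_id _).prodMk (hasDerivAt_const _ _)
    exact (HasFDerivAt.comp_hasDerivAt (l := f) z.1
      (differentiableAt_of_contDiffOn hΩ hf hz).hasFDerivAt h3).deriv

theorem isOpenInterval_image_fst (hΩ : IsOpen Ω) (hc : IsConnected Ω) :
    IsOpenInterval (Prod.fst '' Ω) :=
  ⟨isOpenMap_fst _ hΩ, hc.image _ continuous_fst.continuousOn⟩

end connected

theorem hasDerivAt_line_comp_of_hasDerivAt {q : ℝ → ℝ} {q' : ℝ} {f : Space → ℝ} {z : Space}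
    (hq : HasDerivAt q q' (f z)) (hf : DifferentiableAt ℝ f z) (e : Space) :
    HasDerivAt (fun s : ℝ => q (f (z + s • e))) (q' * pd e f z) 0 := by
  have h2 : HasDerivAt q q' (f (z + (0 : ℝ) • e)) := by simpa using hq
  exact HasDerivAt.comp (h₂ := q) 0 h2 (hasDerivAt_line hf e)

theorem hasDerivAt_line_comp_fst {q : ℝ → ℝ} {q' : ℝ} {z : Space}
    (hq : HasDerivAt q q' z.1) (e : Space) :
    HasDerivAt (fun s : ℝ => q (z + s • e).1) (q' * e.1) 0 := by
  have h1 : HasDerivAt (fun s : ℝ => (z + s • e).1) e.1 0 := by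
    simpa using ((hasDerivAt_id (0 : ℝ)).mul_const e.1).const_add z.1
  have h2 : HasDerivAt q q' (z + (0 : ℝ) • e).1 := by simpa using hq
  exact HasDerivAt.comp (h₂ := q) 0 h2 h1

/-! ### The form of admissible transformations -/

namespace IsPointTransf

variable {I J : Set ℝ} {θ η : Coeffs} {Ω : Set Space} {F : Space → Space}

/-- Admissible transformations of the subclass `k = 0`. -/
theorem exists_params (h : IsPointTransf I J θ η Ω F)
    (hJ : IsOpenInterval J) (hθ : θ.MemClass I) (hη : η.MemClass J)
    (hθk : ∀ t ∈ I, θ.k t = 0) (hηk : ∀ t ∈ J, η.k t = 0) {t₀ : ℝ} (ht₀ : t₀ ∈ Prod.fst '' Ω) :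
    ∃ P : Params, P.Valid (Prod.fst '' Ω) ((fun z => (F z).1) '' Ω) ∧
      (∃ B : ℝ, ∀ t ∈ Prod.fst '' Ω, P.β t = B) ∧
      (∀ z ∈ Ω, F z = P.pointMap t₀ θ z) ∧ P.CoeffRel (Prod.fst '' Ω) t₀ θ η := by
  have D : ∀ z ∈ Ω, Determining θ η F z := fun z hz => h.determining hθ hη hJ.1 hθk hηk hz
  have hΩ := h.isOpen
  have hconn := h.isConnected
  set K : Set ℝ := Prod.fst '' Ω with hK
  have hKo : IsOpenInterval K := isOpenInterval_image_fst hΩ hconn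
  have hKI : K ⊆ I := by rintro _ ⟨z, hz, rfl⟩; exact h.subset z hz
  have hmem : ∀ z ∈ Ω, z.1 ∈ K := fun z hz => mem_image_of_mem _ hz
  have hTJ : ∀ z ∈ Ω, compT F z ∈ J := h.mapsTo
  have hTs := h.contDiffOn_compT
  have hXs := h.contDiffOn_compX
  have hUs := h.contDiffOn_compU
  have sUu := contDiffOn_pd hΩ hUs eu
  have dd {f : Space → ℝ} (hf : ContDiffOn ℝ ∞ f Ω) {z : Space} (hz : z ∈ Ω) :=
    differentiableAt_of_contDiffOn hΩ hf hz
  have pT : ∀ z ∈ Ω, ∀ e : Space, pd e (compT F) z = e.1 * pd et (compT F) z := by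
    intro z hz e
    rw [pd, ← Prod.mk.eta (p := e), ← Prod.mk.eta (p := e.2), fderiv_eq_pd, (D z hz).Tx,
      (D z hz).Tu]
    ring
  have pX : ∀ z ∈ Ω, ∀ e : Space,
      pd e (compX F) z = e.1 * pd et (compX F) z + e.2.1 * pd ex (compX F) z := by
    intro z hz e
    rw [pd, ← Prod.mk.eta (p := e), ← Prod.mk.eta (p := e.2), fderiv_eq_pd, (D z hz).Xu]
    ring
  have pU : ∀ z ∈ Ω, ∀ e : Space,
      pd e (compU F) z = e.1 * pd et (compU F) z + e.2.2 * pd eu (compU F) z := by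
    intro z hz e
    rw [pd, ← Prod.mk.eta (p := e), ← Prod.mk.eta (p := e.2), fderiv_eq_pd, (D z hz).Ux]
    ring
  have pΦ : ∀ z ∈ Ω, ∀ e : Space,
      pd e (pd eu (compU F)) z = e.1 * pd et (pd eu (compU F)) z := by
    intro z hz e
    rw [pd, ← Prod.mk.eta (p := e), ← Prod.mk.eta (p := e.2), fderiv_eq_pd, (D z hz).Uux,
      (D z hz).Uuu]
    ring
  have hint {q : ℝ → ℝ} (hq : ContinuousOn q K) {z : Space} (hz : z ∈ Ω) :
      HasDerivAt (fun s => ∫ r in t₀..s, q r) (q z.1) z.1 :=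
    hasDerivAt_integral_of_mem hKo.1 hKo.ordConnected hq ht₀ (hmem z hz)
  -- the component for `x` has constant derivative
  obtain ⟨B, hB⟩ : ∃ B, ∀ z ∈ Ω, pd ex (compX F) z = B := by
    refine exists_const_of_line_deriv hΩ hconn (fun z hz => dd (contDiffOn_pd hΩ hXs ex) hz)
      fun z hz e => ?_
    have := hasDerivAt_line (dd (contDiffOn_pd hΩ hXs ex) hz) e
    rwa [(D z hz).Xxe e] at this
  -- the component for `t`
  obtain ⟨z₀, hz₀, hz₀t⟩ := ht₀
  have ht₀ : t₀ ∈ K := ⟨z₀, hz₀, hz₀t⟩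
  -- Slices of `Ω` may be disconnected, so `T_x = T_u = 0` is not enough. The relation `g̃ T_t = B^5
  -- g` makes `G(T) - B^5 ∫ g dt` constant on `Ω`, where `G' = g̃`. As `g̃ ≠ 0`, `G` is injective by
  -- Rolle's theorem, and `T` is a function of `t`.
  set G : ℝ → ℝ := fun s => ∫ r in (compT F z₀)..s, η.g r with hG
  have hGd : ∀ s ∈ J, HasDerivAt G (η.g s) s := fun s hs =>
    hasDerivAt_integral_of_mem hJ.1 hJ.ordConnected hη.smooth_g.continuousOn (hTJ z₀ hz₀) hs
  have hGinj : ∀ s ∈ J, ∀ s' ∈ J, G s = G s' → s = s' := by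
    have key : ∀ s ∈ J, ∀ s' ∈ J, s < s' → G s ≠ G s' := by
      intro s hs s' hs' hlt heq
      have hsub : Icc s s' ⊆ J := hJ.ordConnected.out hs hs'
      obtain ⟨r, hr, hr'⟩ := exists_hasDerivAt_eq_zero hlt
        (fun r hr => (hGd r (hsub hr)).continuousAt.continuousWithinAt) heq
        (fun r hr => hGd r (hsub (Ioo_subset_Icc_self hr)))
      exact hη.g_ne_zero (hsub (Ioo_subset_Icc_self hr)) hr'
    intro s hs s' hs' heq
    rcases lt_trichotomy s s' with h1 | h1 | h1
    · exact absurd heq (key s hs s' hs' h1)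
    · exact h1
    · exact absurd heq.symm (key s' hs' s hs h1)
  obtain ⟨C₁, hC₁⟩ : ∃ C, ∀ z ∈ Ω,
      (fun z : Space => G (compT F z) - B ^ 5 * ∫ r in t₀..z.1, θ.g r) z = C := by
    have hgK := hθ.smooth_g.continuousOn.mono hKI
    refine exists_const_of_line_deriv hΩ hconn (fun z hz => ?_) fun z hz e => ?_
    · have h1 : DifferentiableAt ℝ (fun z : Space => ∫ r in t₀..z.1, θ.g r) z :=
        DifferentiableAt.comp z (g := fun s => ∫ r in t₀..s, θ.g r) (hint hgK hz).differentiableAt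
          differentiableAt_fst
      have h2 : DifferentiableAt ℝ (fun z : Space => G (compT F z)) z :=
        DifferentiableAt.comp z (g := G) (hGd _ (hTJ z hz)).differentiableAt (dd hTs hz)
      exact h2.sub (h1.const_mul _)
    · refine ((hasDerivAt_line_comp_of_hasDerivAt (hGd _ (hTJ z hz)) (dd hTs hz) e).sub
        ((hasDerivAt_line_comp_fst (hint hgK hz) e).const_mul (B ^ 5))).congr_deriv ?_
      rw [pT z hz]
      have := (D z hz).g
      rw [hB z hz] at this
      linear_combination e.1 * this
  obtain ⟨α, hαs, hα, hαd⟩ := exists_descent hΩ hTs (by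
    intro z hz z' hz' heq
    apply hGinj _ (hTJ z hz) _ (hTJ z' hz')
    have h1 := hC₁ z hz
    have h2 := hC₁ z' hz'
    simp only [heq] at h1 h2
    linarith)
  have hαJ : ∀ t ∈ K, α t ∈ J := by
    rintro _ ⟨z, hz, rfl⟩; rw [← hα z hz]; exact hTJ z hz
  have hα' : ContinuousOn (deriv α) K :=
    ((contDiffOn_infty_iff_deriv_of_isOpen hKo.1).1 hαs).2.continuousOn
  have hcomp {q : ℝ → ℝ} (hq : ContDiffOn ℝ ∞ q J) : ContinuousOn (fun t => q (α t)) K :=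
    hq.continuousOn.comp hαs.continuousOn hαJ
  -- the coefficient of `u` in the component for `u`
  set μ : ℝ → ℝ := fun t => θ.m t - deriv α t * η.m (α t) with hμ
  have hμc : ContinuousOn μ K :=
    (hθ.smooth_m.continuousOn.mono hKI).sub (hα'.mul (hcomp hη.smooth_m))
  have hUut : ∀ z ∈ Ω, pd et (pd eu (compU F)) z = pd eu (compU F) z * μ z.1 := by
    intro z hz
    rw [(D z hz).Uut, hμ]
    simp only [hαd z hz, ← hα z hz]
  -- First integral of `(U_u)_t = μ U_u`.
  obtain ⟨C₂, hC₂⟩ : ∃ C, ∀ z ∈ Ω,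
      (fun z : Space => pd eu (compU F) z * Real.exp (-∫ r in t₀..z.1, μ r)) z = C := by
    refine exists_const_of_line_deriv hΩ hconn (fun z hz => ?_) fun z hz e => ?_
    · have h1 : DifferentiableAt ℝ (fun z : Space => Real.exp (-∫ r in t₀..z.1, μ r)) z :=
        DifferentiableAt.comp z (g := fun s => Real.exp (-∫ r in t₀..s, μ r))
          (hint hμc hz).neg.exp.differentiableAt differentiableAt_fst
      exact (dd sUu hz).mul h1
    · refine ((hasDerivAt_line (dd sUu hz) e).mul
        (hasDerivAt_line_comp_fst (hint hμc hz).neg.exp e)).congr_deriv ?_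
      simp only [zero_smul, add_zero]
      rw [pΦ z hz, hUut z hz]
      ring
  obtain ⟨φ, hφs, hφ, hφd⟩ := exists_descent hΩ sUu (by
    intro z hz z' hz' heq
    have h1 := (hC₂ z hz).trans (hC₂ z' hz').symm
    simp only [heq] at h1
    exact mul_right_cancel₀ (Real.exp_ne_zero _) h1)
  -- the shift of `u`
  have hmK := hθ.smooth_m.continuousOn.mono hKI
  have hE : ∀ z ∈ Ω, HasDerivAt (expInt t₀ θ) (-(θ.m z.1) * expInt t₀ θ z.1) z.1 := fun z hz =>
    hasDerivAt_expInt hKo hmK ht₀ (hmem z hz)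
  -- The equations for `U_t` and `U_ut` combine to `(U / U_u - u)_t = -m (U / U_u - u)`, and `expInt
  -- t₀ θ` solves the same linear equation; `σ` is the constant ratio.
  obtain ⟨σ, hσ⟩ : ∃ C, ∀ z ∈ Ω,
      (fun z : Space => (compU F z / pd eu (compU F) z - z.2.2) / expInt t₀ θ z.1) z = C := by
    refine exists_const_of_line_deriv hΩ hconn (fun z hz => ?_) fun z hz e => ?_
    · have h1 : ContDiffOn ℝ ∞ (fun z : Space => expInt t₀ θ z.1) Ω :=
        (contDiffOn_expInt hKo (hθ.smooth_m.mono hKI) ht₀).comp contDiffOn_fst hmem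
      exact dd (((hUs.div sUu fun z hz => (D z hz).Uu).sub
        (contDiffOn_snd.snd)).div h1 fun z _ => (expInt_pos _ _ _).ne') hz
    · have hu : HasDerivAt (fun s : ℝ => (z + s • e).2.2) e.2.2 0 := by
        simpa using ((hasDerivAt_id (0 : ℝ)).mul_const e.2.2).const_add z.2.2
      have hΦ := (D z hz).Uu
      have hE0 := (expInt_pos t₀ θ z.1).ne'
      refine ((((hasDerivAt_line (dd hUs hz) e).div (hasDerivAt_line (dd sUu hz) e)
        (by simpa using hΦ)).sub hu).div (hasDerivAt_line_comp_fst (hE z hz) e)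
        (by simpa using hE0)).congr_deriv ?_
      simp only [zero_smul, add_zero, Pi.sub_apply, Pi.div_apply]
      rw [pΦ z hz, pU z hz, (D z hz).Uut, (D z hz).Ut]
      field_simp
      ring
  have hU : ∀ z ∈ Ω, compU F z = φ z.1 * (z.2.2 + σ * expInt t₀ θ z.1) := by
    intro z hz
    have h1 := hσ z hz
    simp only at h1
    rw [div_eq_iff (expInt_pos t₀ θ z.1).ne', sub_eq_iff_eq_add, div_eq_iff (D z hz).Uu] at h1
    rw [h1, hφ z hz]
    ring
  -- the shift of `x`
  set κ : ℝ → ℝ := fun t => deriv α t * η.n (α t) + B * (σ * θ.f t * expInt t₀ θ t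
    - σ ^ 2 * θ.c t * expInt t₀ θ t ^ 2 - θ.n t) with hκ
  have hEc : ContinuousOn (expInt t₀ θ) K := by
    rintro _ ⟨z, hz, rfl⟩
    exact (hE z hz).continuousAt.continuousWithinAt
  have hκc : ContinuousOn κ K := by
    have h1 := hθ.smooth_f.continuousOn.mono hKI
    have h2 := hθ.smooth_c.continuousOn.mono hKI
    have h3 := hθ.smooth_n.continuousOn.mono hKI
    have h4 := hcomp hη.smooth_n
    fun_prop
  -- After substituting `U = φ (u + σ E)`, the relations for `c` and `f` cancel all terms containing
  -- `u`, and a function of `t` remains.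
  have hXt : ∀ z ∈ Ω, pd et (compX F) z = κ z.1 := by
    intro z hz
    have h1 := (D z hz).Xt
    have h2 := (D z hz).f
    have h3 := (D z hz).c
    have h4 := (D z hz).Uu
    rw [hB z hz] at h1 h2 h3
    rw [hU z hz] at h1 h2
    rw [hφ z hz] at h2 h3 h4
    rw [hκ]
    simp only
    rw [hαd z hz, ← hα z hz]
    set E := expInt t₀ θ z.1
    linear_combination h1 + (z.2.2 + σ * E) * h2 - (z.2.2 + σ * E) ^ 2 * h3
  have hxs : ContDiffOn ℝ ∞ (fun z : Space => compX F z - B * z.2.1) Ω :=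
    hXs.sub (by fun_prop)
  have pxs : ∀ z ∈ Ω, ∀ e : Space, HasDerivAt (fun s : ℝ => compX F (z + s • e)
      - B * (z + s • e).2.1) (κ z.1 * e.1) 0 := by
    intro z hz e
    have hx : HasDerivAt (fun s : ℝ => (z + s • e).2.1) e.2.1 0 := by
      simpa using ((hasDerivAt_id (0 : ℝ)).mul_const e.2.1).const_add z.2.1
    refine ((hasDerivAt_line (dd hXs hz) e).sub (hx.const_mul B)).congr_deriv ?_
    rw [pX z hz, hB z hz, hXt z hz]
    ring
  obtain ⟨C₃, hC₃⟩ : ∃ C, ∀ z ∈ Ω,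
      (fun z : Space => compX F z - B * z.2.1 - ∫ r in t₀..z.1, κ r) z = C := by
    refine exists_const_of_line_deriv hΩ hconn (fun z hz => ?_) fun z hz e => ?_
    · have h1 : DifferentiableAt ℝ (fun z : Space => ∫ r in t₀..z.1, κ r) z :=
        DifferentiableAt.comp z (g := fun s => ∫ r in t₀..s, κ r)
          (hint hκc hz).differentiableAt differentiableAt_fst
      exact (dd hxs hz).sub h1
    · exact ((pxs z hz e).sub (hasDerivAt_line_comp_fst (hint hκc hz) e)).congr_deriv (by ring)
  obtain ⟨γ, hγs, hγ, hγd⟩ := exists_descent hΩ hxs (by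
    intro z hz z' hz' heq
    have h1 := (hC₃ z hz).trans (hC₃ z' hz').symm
    simp only [heq] at h1
    linarith)
  have hγd' : ∀ z ∈ Ω, deriv γ z.1 = κ z.1 := by
    intro z hz
    rw [hγd z hz, (hasDerivAt_line (dd hxs hz) et).unique (pxs z hz et)]
    simp
  have hB0 : B ≠ 0 := by rw [← hB z₀ hz₀]; exact (D z₀ hz₀).Xx
  refine ⟨⟨α, fun _ => B, γ, φ, σ⟩, ⟨hαs, contDiffOn_const, hγs, hφs, ?_, ?_⟩, ⟨B, fun _ _ => rfl⟩,
    ?_, ?_⟩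
  · rintro _ ⟨z, hz, rfl⟩
    simp only
    rw [hαd z hz, ← hφ z hz]
    exact mul_ne_zero (mul_ne_zero (D z hz).Tt hB0) (D z hz).Uu
  · ext s
    constructor
    · rintro ⟨_, ⟨z, hz, rfl⟩, rfl⟩
      exact ⟨z, hz, hα z hz⟩
    · rintro ⟨z, hz, rfl⟩
      exact ⟨z.1, hmem z hz, (hα z hz).symm⟩
  · intro z hz
    refine Prod.ext (hα z hz) (Prod.ext ?_ (hU z hz))
    have := hγ z hz
    change compX F z = B * z.2.1 + γ z.1
    linarith
  · have ht {z : Space} (hz : z ∈ Ω) : deriv α z.1 ≠ 0 := by rw [hαd z hz]; exact (D z hz).Tt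
    have hp {z : Space} (hz : z ∈ Ω) : φ z.1 ≠ 0 := by rw [← hφ z hz]; exact (D z hz).Uu
    have e2 {z : Space} (hz : z ∈ Ω) : pd et (compT F) z = deriv α z.1 := (hαd z hz).symm
    constructor <;> rintro _ ⟨z, hz, rfl⟩ <;> simp only <;> have ht := ht hz <;> have hp := hp hz
    · have := (D z hz).a
      rw [hα z hz, hφ z hz, e2 hz, hB z hz] at this
      field_simp
      linear_combination this
    · have := (D z hz).b
      rw [hα z hz, hφ z hz, e2 hz, hB z hz] at this
      field_simp
      linear_combination this
    · have := (D z hz).c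
      rw [hα z hz, hφ z hz, e2 hz, hB z hz] at this
      field_simp
      linear_combination this
    · have h1 := (D z hz).f
      have h2 := (D z hz).c
      rw [hα z hz, hφ z hz, e2 hz, hB z hz] at h1 h2
      rw [hU z hz] at h1
      field_simp
      linear_combination h1 - 2 * (z.2.2 + σ * expInt t₀ θ z.1) * h2
    · have := (D z hz).g
      rw [hα z hz, e2 hz, hB z hz] at this
      field_simp
      linear_combination this
    · have h1 := (D z hz).h
      have h2 := (D z hz).a
      rw [hα z hz, e2 hz, hB z hz] at h1 h2
      rw [hφ z hz] at h2
      rw [hU z hz] at h1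
      field_simp
      linear_combination h1 - (z.2.2 + σ * expInt t₀ θ z.1) * h2
    · have h1 : deriv φ z.1 = φ z.1 * μ z.1 := by rw [hφd z hz, hUut z hz, hφ z hz]
      rw [h1, hμ]
      field_simp
      ring
    · have h1 : deriv (fun s => γ s / B) z.1 = κ z.1 / B := by
        rw [deriv_div_const, hγd' z hz]
      rw [h1, hκ, hθk _ (h.subset z hz)]
      field_simp
      ring
    · rw [hηk _ (hαJ _ (hmem z hz)), hθk _ (h.subset z hz)]
      simp

end IsPointTransf

/-! ### Maps of the given form are point transformations -/

theorem isInvertible_of_injective (L : Space →L[ℝ] Space) (h : ∀ z, L z = 0 → z = 0) :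
    L.IsInvertible :=
  ⟨(LinearEquiv.ofInjectiveEndo (L : Space →ₗ[ℝ] Space)
    ((injective_iff_map_eq_zero _).2 h)).toContinuousLinearEquiv, rfl⟩

theorem isOpen_cyl {I : Set ℝ} (hI : IsOpen I) : IsOpen {z : Space | z.1 ∈ I} :=
  hI.preimage continuous_fst

theorem isConnected_cyl {I : Set ℝ} (hI : IsConnected I) : IsConnected {z : Space | z.1 ∈ I} := by
  have : {z : Space | z.1 ∈ I} = I ×ˢ univ := by ext z; simp
  rw [this]
  exact hI.prod isConnected_univ

theorem image_fst_cyl (I : Set ℝ) : Prod.fst '' {z : Space | z.1 ∈ I} = I := by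
  ext t
  constructor
  · rintro ⟨z, hz, rfl⟩; exact hz
  · intro ht; exact ⟨(t, 0, 0), ht, rfl⟩

namespace Params

variable {P : Params} {I J : Set ℝ}

theorem Valid.ne (hV : P.Valid I J) {t : ℝ} (ht : t ∈ I) :
    deriv P.α t ≠ 0 ∧ P.β t ≠ 0 ∧ P.φ t ≠ 0 := by
  have := hV.ne_zero t ht
  simp only [ne_eq, mul_eq_zero, not_or] at this
  exact ⟨this.1.1, this.1.2, this.2⟩

theorem deriv_β_eq_zero (hI : IsOpen I) (hB : ∃ B : ℝ, ∀ t ∈ I, P.β t = B) {t : ℝ} (ht : t ∈ I) :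
    deriv P.β t = 0 := by
  obtain ⟨B, hB⟩ := hB
  have : P.β =ᶠ[𝓝 t] fun _ => B := by
    filter_upwards [hI.mem_nhds ht] with s hs using hB s hs
  rw [this.deriv_eq]; simp

theorem deriv_γ_div_β (hI : IsOpen I) (hB : ∃ B : ℝ, ∀ t ∈ I, P.β t = B) {t : ℝ} (ht : t ∈ I) :
    deriv (fun s => P.γ s / P.β s) t = deriv P.γ t / P.β t := by
  obtain ⟨B, hB⟩ := hB
  have : (fun s => P.γ s / P.β s) =ᶠ[𝓝 t] fun s => P.γ s / B := by
    filter_upwards [hI.mem_nhds ht] with s hs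
    rw [hB s hs]
  rw [this.deriv_eq, deriv_div_const, hB t ht]

theorem Valid.contDiffOn_pointMap (hV : P.Valid I J) (hI : IsOpenInterval I) {t₀ : ℝ} (ht₀ : t₀ ∈ I)
    {θ : Coeffs} (hθ : θ.MemClass I) :
    ContDiffOn ℝ ∞ (P.pointMap t₀ θ) {z : Space | z.1 ∈ I} := by
  have hc {q : ℝ → ℝ} (hq : ContDiffOn ℝ ∞ q I) :
      ContDiffOn ℝ ∞ (fun z : Space => q z.1) {z : Space | z.1 ∈ I} :=
    hq.comp contDiffOn_fst fun z hz => hz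
  have hE := hc (contDiffOn_expInt hI hθ.smooth_m ht₀)
  exact (hc hV.smooth_α).prodMk ((((hc hV.smooth_β).mul contDiffOn_snd.fst).add
    (hc hV.smooth_γ)).prodMk ((hc hV.smooth_φ).mul
      (contDiffOn_snd.snd.add (contDiffOn_const.mul hE))))

/-- The transformations of the given form are point transformations. -/
theorem Valid.isPointTransf_pointMap (hV : P.Valid I J) (hI : IsOpenInterval I)
    {t₀ : ℝ} (ht₀ : t₀ ∈ I) (hB : ∃ B : ℝ, ∀ t ∈ I, P.β t = B) {θ η : Coeffs}
    (hθ : θ.MemClass I) (hθk : ∀ t ∈ I, θ.k t = 0) (hR : P.CoeffRel I t₀ θ η) :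
    IsPointTransf I J θ η {z | z.1 ∈ I} (P.pointMap t₀ θ) := by
  have hΩ := isOpen_cyl hI.1
  have hs := hV.contDiffOn_pointMap hI ht₀ hθ
  have dα {t : ℝ} (ht : t ∈ I) : HasDerivAt P.α (deriv P.α t) t :=
    ((hV.smooth_α.contDiffAt (hI.1.mem_nhds ht)).differentiableAt (by simp)).hasDerivAt
  have dβ {t : ℝ} (ht : t ∈ I) : HasDerivAt P.β 0 t := by
    rw [← deriv_β_eq_zero hI.1 hB ht]
    exact ((hV.smooth_β.contDiffAt (hI.1.mem_nhds ht)).differentiableAt (by simp)).hasDerivAt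
  have dγ {t : ℝ} (ht : t ∈ I) : HasDerivAt P.γ (deriv P.γ t) t :=
    ((hV.smooth_γ.contDiffAt (hI.1.mem_nhds ht)).differentiableAt (by simp)).hasDerivAt
  have dφ {t : ℝ} (ht : t ∈ I) : HasDerivAt P.φ (deriv P.φ t) t :=
    ((hV.smooth_φ.contDiffAt (hI.1.mem_nhds ht)).differentiableAt (by simp)).hasDerivAt
  have dE {t : ℝ} (ht : t ∈ I) := hasDerivAt_expInt hI hθ.smooth_m.continuousOn ht₀ ht
  have pT {z : Space} (hz : z.1 ∈ I) (e : Space) :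
      pd e (compT (P.pointMap t₀ θ)) z = deriv P.α z.1 * e.1 :=
    (hasDerivAt_line (differentiableAt_of_contDiffOn hΩ hs.fst hz) e).unique
      (hasDerivAt_line_comp_fst (dα hz) e)
  have pX {z : Space} (hz : z.1 ∈ I) (e : Space) :
      pd e (compX (P.pointMap t₀ θ)) z = P.β z.1 * e.2.1 + deriv P.γ z.1 * e.1 := by
    have hx : HasDerivAt (fun s : ℝ => (z + s • e).2.1) e.2.1 0 := by
      simpa using ((hasDerivAt_id (0 : ℝ)).mul_const e.2.1).const_add z.2.1
    refine (hasDerivAt_line (differentiableAt_of_contDiffOn hΩ hs.snd.fst hz) e).unique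
      ((((hasDerivAt_line_comp_fst (dβ hz) e).mul hx).add
        (hasDerivAt_line_comp_fst (dγ hz) e)).congr_deriv ?_)
    simp
  have pU {z : Space} (hz : z.1 ∈ I) (e : Space) :
      pd e (compU (P.pointMap t₀ θ)) z
        = deriv P.φ z.1 * e.1 * (z.2.2 + P.σ * expInt t₀ θ z.1)
          + P.φ z.1 * (e.2.2 - P.σ * θ.m z.1 * expInt t₀ θ z.1 * e.1) := by
    have hu : HasDerivAt (fun s : ℝ => (z + s • e).2.2) e.2.2 0 := by
      simpa using ((hasDerivAt_id (0 : ℝ)).mul_const e.2.2).const_add z.2.2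
    refine (hasDerivAt_line (differentiableAt_of_contDiffOn hΩ hs.snd.snd hz) e).unique
      (((hasDerivAt_line_comp_fst (dφ hz) e).mul (hu.add
        ((hasDerivAt_line_comp_fst (dE hz) e).const_mul P.σ))).congr_deriv ?_)
    simp only [zero_smul, add_zero, Pi.add_apply]
    ring
  refine ⟨hΩ, isConnected_cyl hI.2, fun z hz => hz, fun z hz => ?_, hs, fun z hz => ?_, ?_⟩
  · rw [← hV.image_eq]; exact mem_image_of_mem _ hz
  · obtain ⟨h1, h2, h3⟩ := hV.ne hz
    refine isInvertible_of_injective _ fun e he => ?_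
    rw [fderiv_eq_comp (hs.contDiffAt (hΩ.mem_nhds hz))] at he
    have e1 : pd e (compT (P.pointMap t₀ θ)) z = 0 := congrArg Prod.fst he
    have e2 : pd e (compX (P.pointMap t₀ θ)) z = 0 := congrArg (fun z => z.2.1) he
    have e3 : pd e (compU (P.pointMap t₀ θ)) z = 0 := congrArg (fun z => z.2.2) he
    rw [pT hz] at e1
    have e1 : e.1 = 0 := by simpa [h1] using e1
    rw [pX hz, e1] at e2
    have e2 : e.2.1 = 0 := by simpa [h2] using e2
    rw [pU hz, e1] at e3
    have e3 : e.2.2 = 0 := by simpa [h3] using e3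
    exact Prod.ext e1 (Prod.ext e2 e3)
  · intro u v p hp hu hv hm
    have ht : p.1 ∈ I := hp
    obtain ⟨h1, h2, h3⟩ := hV.ne ht
    obtain ⟨hj, hd⟩ := jets_of_mapsGraph (hs.contDiffAt (hΩ.mem_nhds hp)) hu hv hm
      (B := P.β p.1) (Eventually.of_forall fun y => rfl)
      (Eventually.of_forall fun y => by simp only [compX, pointMap]; ring)
      (by rw [pT ht]; simp) (by rw [pX ht]; simp)
    have hN : ∀ j : ℕ, 0 < j → iteratedDeriv j
        (fun y => compU (P.pointMap t₀ θ) (p.1, y, u (p.1, y))) p.2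
        = P.φ p.1 * iteratedDeriv j (fun y => u (p.1, y)) p.2 := by
      intro j hj
      have : (fun y => compU (P.pointMap t₀ θ) (p.1, y, u (p.1, y)))
          = fun y => P.φ p.1 * (P.σ * expInt t₀ θ p.1) + P.φ p.1 * u (p.1, y) := by
        ext y; simp only [compU, pointMap]; ring
      rw [this, iteratedDeriv_const_add hj, iteratedDeriv_const_mul_field]
    have hv' : ∀ j : ℕ, 0 < j → iteratedDeriv j
        (fun y => v ((baseMap (P.pointMap t₀ θ) u p).1, y)) (baseMap (P.pointMap t₀ θ) u p).2
        = P.φ p.1 * iteratedDeriv j (fun y => u (p.1, y)) p.2 / P.β p.1 ^ j := by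
      intro j hj'
      rw [eq_div_iff (pow_ne_zero j h2), ← hN j hj', ← hj j, mul_comm]
    have hv0 : v (baseMap (P.pointMap t₀ θ) u p) = P.φ p.1 * (u p + P.σ * expInt t₀ θ p.1) :=
      hm.2.self_of_nhds.symm
    have hvt : deriv (fun s => v (s, (baseMap (P.pointMap t₀ θ) u p).2))
        (baseMap (P.pointMap t₀ θ) u p).1 =
        (deriv P.φ p.1 * (u p + P.σ * expInt t₀ θ p.1)
          - P.φ p.1 * P.σ * θ.m p.1 * expInt t₀ θ p.1
          + deriv (fun s => u (s, p.2)) p.1 * P.φ p.1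
          - P.φ p.1 * iteratedDeriv 1 (fun y => u (p.1, y)) p.2 / P.β p.1 * deriv P.γ p.1)
          / deriv P.α p.1 := by
      rw [pT ht, pX ht, pU ht, pU ht, hv' 1 (by norm_num)] at hd
      rw [eq_div_iff h1]
      simp only [mul_zero, mul_one, zero_add, zero_sub, sub_zero, pow_one] at hd
      linear_combination hd
    -- The left-hand side of the new equation is `φ / α_t` times that of the old one, and this
    -- factor does not vanish.
    have hkey : ∀ L R : ℝ, L = P.φ p.1 / deriv P.α p.1 * R → (R = 0 ↔ L = 0) := by
      intro L R h
      rw [h]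
      constructor
      · intro h; rw [h, mul_zero]
      · intro h
        exact (mul_eq_zero.1 h).resolve_left (div_ne_zero h3 h1)
    unfold Satisfies
    apply hkey
    have hb1 : (baseMap (P.pointMap t₀ θ) u p).1 = P.α p.1 := rfl
    rw [hvt, hv0, hv' 1 (by norm_num), hv' 2 (by norm_num), hv' 3 (by norm_num),
      hv' 5 (by norm_num), hb1, hR.a_eq _ ht, hR.b_eq _ ht, hR.c_eq _ ht, hR.f_eq _ ht,
      hR.g_eq _ ht, hR.h_eq _ ht, hR.m_eq _ ht, hR.n_eq _ ht, hR.k_eq _ ht, hθk _ ht,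
      deriv_β_eq_zero hI.1 hB ht, deriv_γ_div_β hI.1 hB ht]
    field_simp
    ring

end Params

/-! ### The action on the arbitrary elements -/

namespace Coeffs

theorem eq_of_eqOn {θ η : Coeffs} {J : Set ℝ} (hθ : θ.restrict J = θ) (hη : η.restrict J = η)
    (ha : EqOn θ.a η.a J) (hb : EqOn θ.b η.b J) (hc : EqOn θ.c η.c J) (hf : EqOn θ.f η.f J)
    (hg : EqOn θ.g η.g J) (hh : EqOn θ.h η.h J) (hm : EqOn θ.m η.m J) (hn : EqOn θ.n η.n J)
    (hk : EqOn θ.k η.k J) : θ = η := by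
  rw [← hθ, ← hη]
  have e : ∀ {p q : ℝ → ℝ}, EqOn p q J → J.indicator p = J.indicator q := fun h =>
    Set.indicator_congr h
  simp only [restrict, e ha, e hb, e hc, e hf, e hg, e hh, e hm, e hn, e hk]

theorem restrict_restrict (θ : Coeffs) (J : Set ℝ) : (θ.restrict J).restrict J = θ.restrict J := by
  simp [restrict]

/-- Smooth functions on `J` restrict to arbitrary elements of the subclass. -/
theorem memClass_restrict {θ : Coeffs} {J : Set ℝ} (ha : ContDiffOn ℝ ∞ θ.a J)
    (hb : ContDiffOn ℝ ∞ θ.b J) (hc : ContDiffOn ℝ ∞ θ.c J) (hf : ContDiffOn ℝ ∞ θ.f J)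
    (hg : ContDiffOn ℝ ∞ θ.g J) (hh : ContDiffOn ℝ ∞ θ.h J) (hm : ContDiffOn ℝ ∞ θ.m J)
    (hn : ContDiffOn ℝ ∞ θ.n J) (hk : ∀ t ∈ J, θ.k t = 0)
    (hne : ∀ t ∈ J, θ.g t * (θ.a t ^ 2 + θ.b t ^ 2 + θ.c t ^ 2) ≠ 0) :
    (θ.restrict J).MemClass J ∧ ∀ t ∈ J, (θ.restrict J).k t = 0 := by
  have e : ∀ {p : ℝ → ℝ}, ContDiffOn ℝ ∞ p J → ContDiffOn ℝ ∞ (J.indicator p) J := fun h =>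
    h.congr fun t ht => indicator_of_mem ht _
  have hk0 : J.indicator θ.k = fun _ => 0 := by
    ext t
    by_cases ht : t ∈ J
    · rw [indicator_of_mem ht, hk t ht]
    · rw [indicator_of_notMem ht]
  refine ⟨⟨e ha, e hb, e hc, e hf, e hg, e hh, e hm, e hn, ?_, fun t ht => ?_,
    θ.restrict_restrict J⟩, fun t _ => ?_⟩
  · simp only [restrict, hk0]; exact contDiffOn_const
  · simpa only [restrict, indicator_of_mem ht] using hne t ht
  · simp only [restrict, hk0]

end Coeffs

namespace Params

variable {P : Params} {I J : Set ℝ}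

theorem Valid.injOn_α (hV : P.Valid I J) (hI : IsOpenInterval I) : InjOn P.α I := by
  have key : ∀ s ∈ I, ∀ s' ∈ I, s < s' → P.α s ≠ P.α s' := by
    intro s hs s' hs' hlt heq
    have hsub : Icc s s' ⊆ I := hI.ordConnected.out hs hs'
    obtain ⟨r, hr, hr'⟩ := exists_deriv_eq_zero hlt (hV.smooth_α.continuousOn.mono hsub) heq
    exact (hV.ne (hsub (Ioo_subset_Icc_self hr))).1 hr'
  intro s hs s' hs' heq
  rcases lt_trichotomy s s' with h1 | h1 | h1
  · exact absurd heq (key s hs s' hs' h1)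
  · exact h1
  · exact absurd heq.symm (key s' hs' s hs h1)

/-- The smooth inverse of `α`. -/
theorem Valid.exists_inverse_α (hV : P.Valid I J) (hI : IsOpenInterval I) :
    ∃ τ : ℝ → ℝ, ContDiffOn ℝ ∞ τ J ∧ (∀ t ∈ I, τ (P.α t) = t) ∧
      (∀ s ∈ J, τ s ∈ I ∧ P.α (τ s) = s) := by
  have hinj := hV.injOn_α hI
  have h1 : ∀ t ∈ I, Function.invFunOn P.α I (P.α t) = t := fun t ht =>
    hinj.leftInvOn_invFunOn ht
  refine ⟨Function.invFunOn P.α I, ?_, h1, fun s hs => ?_⟩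
  · rw [← hV.image_eq]
    rintro _ ⟨t, ht, rfl⟩
    have hs := hV.smooth_α.contDiffAt (hI.1.mem_nhds ht)
    have hi : (fderiv ℝ P.α t).IsInvertible := by
      refine ⟨ContinuousLinearEquiv.unitsEquivAut ℝ (Units.mk0 (deriv P.α t) (hV.ne ht).1), ?_⟩
      ext
      simp
    -- The global inverse coincides near `α t` with the smooth local inverse there, by injectivity
    -- of `α` on `I`.
    obtain ⟨Q, hQs, hQt, -, hQr⟩ := exists_local_inverse hs hi
    refine (hQs.congr_of_eventuallyEq ?_).contDiffWithinAt
    have hQI : ∀ᶠ s in 𝓝 (P.α t), Q s ∈ I :=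
      hQs.continuousAt.tendsto.eventually (by rw [hQt]; exact hI.1.mem_nhds ht)
    filter_upwards [hQr, hQI] with s h2 h3
    rw [← h1 _ h3, h2]
  · rw [← hV.image_eq] at hs
    obtain ⟨t, ht, rfl⟩ := hs
    rw [h1 t ht]
    exact ⟨ht, rfl⟩

/-- The new arbitrary elements are determined by the old ones. -/
theorem CoeffRel.unique_right {t₀ : ℝ} {θ η η' : Coeffs} (hV : P.Valid I J)
    (h : P.CoeffRel I t₀ θ η) (h' : P.CoeffRel I t₀ θ η') (hη : η.restrict J = η)
    (hη' : η'.restrict J = η') : η = η' := by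
  have key : ∀ {p q : ℝ → ℝ}, (∀ t ∈ I, p (P.α t) = q (P.α t)) → EqOn p q J := by
    intro p q hpq s hs
    rw [← hV.image_eq] at hs
    obtain ⟨t, ht, rfl⟩ := hs
    exact hpq t ht
  exact Coeffs.eq_of_eqOn hη hη'
    (key fun t ht => (h.a_eq t ht).trans (h'.a_eq t ht).symm)
    (key fun t ht => (h.b_eq t ht).trans (h'.b_eq t ht).symm)
    (key fun t ht => (h.c_eq t ht).trans (h'.c_eq t ht).symm)
    (key fun t ht => (h.f_eq t ht).trans (h'.f_eq t ht).symm)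
    (key fun t ht => (h.g_eq t ht).trans (h'.g_eq t ht).symm)
    (key fun t ht => (h.h_eq t ht).trans (h'.h_eq t ht).symm)
    (key fun t ht => (h.m_eq t ht).trans (h'.m_eq t ht).symm)
    (key fun t ht => (h.n_eq t ht).trans (h'.n_eq t ht).symm)
    (key fun t ht => (h.k_eq t ht).trans (h'.k_eq t ht).symm)

/-- The old arbitrary elements are determined by the new ones. -/
theorem CoeffRel.unique_left {t₀ : ℝ} {θ θ' η : Coeffs} (hV : P.Valid I J)
    (hI : IsOpenInterval I) (ht₀ : t₀ ∈ I) (h : P.CoeffRel I t₀ θ η)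
    (h' : P.CoeffRel I t₀ θ' η) (hθ : θ.restrict I = θ) (hθ' : θ'.restrict I = θ') : θ = θ' := by
  have cancel : ∀ {r p q w : ℝ}, r ≠ 0 → w = r * p → w = r * q → p = q := fun hr h1 h2 =>
    mul_left_cancel₀ hr (h1.symm.trans h2)
  -- The formulas are triangular. That for `m` contains no other arbitrary element, so `m` and hence
  -- the exponential are recovered first; `a` and `c` precede `f` and `h`, and `n` comes last.
  have hm : EqOn θ.m θ'.m I := by
    intro t ht
    obtain ⟨n1, n2, n3⟩ := hV.ne ht
    have := cancel (one_div_ne_zero n1) (h.m_eq t ht) (h'.m_eq t ht)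
    linarith
  have hE : ∀ t ∈ I, expInt t₀ θ t = expInt t₀ θ' t := fun t ht =>
    expInt_congr hI.ordConnected hm ht₀ ht
  have ha : EqOn θ.a θ'.a I := fun t ht => by
    obtain ⟨n1, n2, n3⟩ := hV.ne ht
    exact cancel (by positivity) (h.a_eq t ht) (h'.a_eq t ht)
  have hb : EqOn θ.b θ'.b I := fun t ht => by
    obtain ⟨n1, n2, n3⟩ := hV.ne ht
    exact cancel (by positivity) (h.b_eq t ht) (h'.b_eq t ht)
  have hc : EqOn θ.c θ'.c I := fun t ht => by
    obtain ⟨n1, n2, n3⟩ := hV.ne ht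
    exact cancel (by positivity) (h.c_eq t ht) (h'.c_eq t ht)
  have hg : EqOn θ.g θ'.g I := fun t ht => by
    obtain ⟨n1, n2, n3⟩ := hV.ne ht
    exact cancel (by positivity) (h.g_eq t ht) (h'.g_eq t ht)
  have hf : EqOn θ.f θ'.f I := fun t ht => by
    obtain ⟨n1, n2, n3⟩ := hV.ne ht
    have := cancel (by positivity) (h.f_eq t ht) (h'.f_eq t ht)
    rw [hE t ht, hc ht] at this
    linarith
  have hh : EqOn θ.h θ'.h I := fun t ht => by
    obtain ⟨n1, n2, n3⟩ := hV.ne ht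
    have := cancel (by positivity) (h.h_eq t ht) (h'.h_eq t ht)
    rw [hE t ht, ha ht] at this
    linarith
  have hk : EqOn θ.k θ'.k I := fun t ht => by
    obtain ⟨n1, n2, n3⟩ := hV.ne ht
    have := cancel (by positivity) (h.k_eq t ht) (h'.k_eq t ht)
    linarith
  have hn : EqOn θ.n θ'.n I := fun t ht => by
    obtain ⟨n1, n2, n3⟩ := hV.ne ht
    have := cancel (by positivity) (h.n_eq t ht) (h'.n_eq t ht)
    rw [hE t ht, hc ht, hf ht, hk ht] at this
    linarith
  exact Coeffs.eq_of_eqOn hθ hθ' ha hb hc hf hg hh hm hn hk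

section smooth

theorem Valid.smooth_deriv_α (hV : P.Valid I J) (hI : IsOpenInterval I) :
    ContDiffOn ℝ ∞ (deriv P.α) I :=
  ((contDiffOn_infty_iff_deriv_of_isOpen hI.1).1 hV.smooth_α).2

theorem Valid.smooth_deriv_φ (hV : P.Valid I J) (hI : IsOpenInterval I) :
    ContDiffOn ℝ ∞ (deriv P.φ) I :=
  ((contDiffOn_infty_iff_deriv_of_isOpen hI.1).1 hV.smooth_φ).2

theorem Valid.smooth_deriv_γ_div_β (hV : P.Valid I J) (hI : IsOpenInterval I) :
    ContDiffOn ℝ ∞ (deriv fun s => P.γ s / P.β s) I :=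
  ((contDiffOn_infty_iff_deriv_of_isOpen hI.1).1
    (hV.smooth_γ.div hV.smooth_β fun _ ht => (hV.ne ht).2.1)).2

end smooth

/-- The formulas for the new arbitrary elements define elements of the subclass. -/
theorem Valid.exists_coeffRel_right (hV : P.Valid I J) (hI : IsOpenInterval I)
    {t₀ : ℝ} (ht₀ : t₀ ∈ I) (hB : ∃ B : ℝ, ∀ t ∈ I, P.β t = B) {θ : Coeffs} (hθ : θ.MemClass I)
    (hθk : ∀ t ∈ I, θ.k t = 0) :
    ∃ η : Coeffs, (η.MemClass J ∧ ∀ t ∈ J, η.k t = 0) ∧ P.CoeffRel I t₀ θ η := by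
  obtain ⟨τ, hτs, hτα, hτ⟩ := hV.exists_inverse_α hI
  have sα := hV.smooth_deriv_α hI
  have sφ := hV.smooth_deriv_φ hI
  have sγ := hV.smooth_deriv_γ_div_β hI
  have sE := contDiffOn_expInt hI hθ.smooth_m ht₀
  have n1 {t : ℝ} (ht : t ∈ I) := (hV.ne ht).1
  have n2 {t : ℝ} (ht : t ∈ I) := (hV.ne ht).2.1
  have n3 {t : ℝ} (ht : t ∈ I) := (hV.ne ht).2.2
  have sc {q : ℝ → ℝ} (hq : ContDiffOn ℝ ∞ q I) : ContDiffOn ℝ ∞ (fun s => q (τ s)) J :=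
    hq.comp hτs fun s hs => (hτ s hs).1
  set ξ : Coeffs :=
    { a := fun t => P.β t ^ 3 / (deriv P.α t * P.φ t) * θ.a t
      b := fun t => P.β t ^ 3 / (deriv P.α t * P.φ t) * θ.b t
      c := fun t => P.β t / (deriv P.α t * P.φ t ^ 2) * θ.c t
      f := fun t => P.β t / (deriv P.α t * P.φ t) * (θ.f t - 2 * P.σ * θ.c t * expInt t₀ θ t)
      g := fun t => P.β t ^ 5 / deriv P.α t * θ.g t
      h := fun t => P.β t ^ 3 / deriv P.α t * (θ.h t - P.σ * θ.a t * expInt t₀ θ t)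
      m := fun t => 1 / deriv P.α t * (θ.m t - deriv P.φ t / P.φ t)
      n := fun t => P.β t / deriv P.α t * (θ.n t + deriv (fun s => P.γ s / P.β s) t
        + P.σ ^ 2 * θ.c t * expInt t₀ θ t ^ 2 - P.σ * θ.f t * expInt t₀ θ t)
      k := fun _ => 0 } with hξ
  set η : Coeffs :=
    { a := fun s => ξ.a (τ s), b := fun s => ξ.b (τ s), c := fun s => ξ.c (τ s)
      f := fun s => ξ.f (τ s), g := fun s => ξ.g (τ s), h := fun s => ξ.h (τ s)
      m := fun s => ξ.m (τ s), n := fun s => ξ.n (τ s), k := fun _ => 0 } with hη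
  have sβφ : ContDiffOn ℝ ∞ (fun t => P.β t ^ 3 / (deriv P.α t * P.φ t)) I :=
    (hV.smooth_β.pow 3).div (sα.mul hV.smooth_φ) fun t ht => mul_ne_zero (n1 ht) (n3 ht)
  have hαJ {t : ℝ} (ht : t ∈ I) : P.α t ∈ J := by rw [← hV.image_eq]; exact mem_image_of_mem _ ht
  refine ⟨η.restrict J, Coeffs.memClass_restrict (sc (q := ξ.a) ?_) (sc (q := ξ.b) ?_)
    (sc (q := ξ.c) ?_) (sc (q := ξ.f) ?_) (sc (q := ξ.g) ?_) (sc (q := ξ.h) ?_)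
    (sc (q := ξ.m) ?_) (sc (q := ξ.n) ?_) (fun _ _ => rfl) ?_, ?_⟩
  · exact sβφ.mul hθ.smooth_a
  · exact sβφ.mul hθ.smooth_b
  · exact (hV.smooth_β.div (sα.mul (hV.smooth_φ.pow 2)) fun t ht =>
      mul_ne_zero (n1 ht) (pow_ne_zero _ (n3 ht))).mul hθ.smooth_c
  · exact (hV.smooth_β.div (sα.mul hV.smooth_φ) fun t ht => mul_ne_zero (n1 ht) (n3 ht)).mul
      (hθ.smooth_f.sub ((contDiffOn_const.mul hθ.smooth_c).mul sE))
  · exact ((hV.smooth_β.pow 5).div sα fun t ht => n1 ht).mul hθ.smooth_g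
  · exact ((hV.smooth_β.pow 3).div sα fun t ht => n1 ht).mul
      (hθ.smooth_h.sub ((contDiffOn_const.mul hθ.smooth_a).mul sE))
  · exact (contDiffOn_const.div sα fun t ht => n1 ht).mul
      (hθ.smooth_m.sub (sφ.div hV.smooth_φ fun t ht => n3 ht))
  · exact (hV.smooth_β.div sα fun t ht => n1 ht).mul (((hθ.smooth_n.add sγ).add
      ((contDiffOn_const.mul hθ.smooth_c).mul (sE.pow 2))).sub
      ((contDiffOn_const.mul hθ.smooth_f).mul sE))
  · intro s hs
    obtain ⟨ht, -⟩ := hτ s hs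
    have h0 := hθ.ne_zero _ ht
    have m1 := n1 ht
    have m2 := n2 ht
    have m3 := n3 ht
    simp only [hη, hξ]
    refine mul_ne_zero (mul_ne_zero (by positivity) (left_ne_zero_of_mul h0)) fun h1 => ?_
    have e1 := (add_eq_zero_iff_of_nonneg (by positivity) (by positivity)).1 h1
    have e2 := (add_eq_zero_iff_of_nonneg (by positivity) (by positivity)).1 e1.1
    have ea : θ.a (τ s) = 0 := by simpa [m1, m2, m3] using e2.1
    have eb : θ.b (τ s) = 0 := by simpa [m1, m2, m3] using e2.2
    have ec : θ.c (τ s) = 0 := by simpa [m1, m2, m3] using e1.2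
    exact h0 (by rw [ea, eb, ec]; ring)
  · constructor <;> intro t ht <;>
      simp only [Coeffs.restrict, indicator_of_mem (hαJ ht), hη, hξ, hτα t ht, hθk t ht, zero_mul,
        sub_zero, zero_add, deriv_β_eq_zero hI.1 hB ht, zero_div, mul_zero]

/-- Every element of the subclass arises as the tuple of new arbitrary elements. -/
theorem Valid.exists_coeffRel_left (hV : P.Valid I J) (hI : IsOpenInterval I)
    {t₀ : ℝ} (ht₀ : t₀ ∈ I) (hB : ∃ B : ℝ, ∀ t ∈ I, P.β t = B) {η : Coeffs} (hη : η.MemClass J)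
    (hηk : ∀ t ∈ J, η.k t = 0) :
    ∃ θ : Coeffs, (θ.MemClass I ∧ ∀ t ∈ I, θ.k t = 0) ∧ P.CoeffRel I t₀ θ η := by
  have sα := hV.smooth_deriv_α hI
  have sφ := hV.smooth_deriv_φ hI
  have sγ := hV.smooth_deriv_γ_div_β hI
  have n1 {t : ℝ} (ht : t ∈ I) := (hV.ne ht).1
  have n2 {t : ℝ} (ht : t ∈ I) := (hV.ne ht).2.1
  have n3 {t : ℝ} (ht : t ∈ I) := (hV.ne ht).2.2
  have hαJ {t : ℝ} (ht : t ∈ I) : P.α t ∈ J := by rw [← hV.image_eq]; exact mem_image_of_mem _ ht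
  have sc {q : ℝ → ℝ} (hq : ContDiffOn ℝ ∞ q J) : ContDiffOn ℝ ∞ (fun t => q (P.α t)) I :=
    hq.comp hV.smooth_α fun t ht => hαJ ht
  set m : ℝ → ℝ := fun t => deriv P.α t * η.m (P.α t) + deriv P.φ t / P.φ t with hm
  -- `expInt` uses only the entry `m` of a tuple. The zeros are placeholders, since the remaining
  -- entries are themselves defined through `E`.
  set E : ℝ → ℝ := expInt t₀ ⟨0, 0, 0, 0, 0, 0, m, 0, 0⟩ with hE
  set a : ℝ → ℝ := fun t => deriv P.α t * P.φ t / P.β t ^ 3 * η.a (P.α t) with ha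
  set c : ℝ → ℝ := fun t => deriv P.α t * P.φ t ^ 2 / P.β t * η.c (P.α t) with hc
  set f : ℝ → ℝ := fun t => deriv P.α t * P.φ t / P.β t * η.f (P.α t)
    + 2 * P.σ * c t * E t with hf
  set ξ : Coeffs :=
    { a := a
      b := fun t => deriv P.α t * P.φ t / P.β t ^ 3 * η.b (P.α t)
      c := c
      f := f
      g := fun t => deriv P.α t / P.β t ^ 5 * η.g (P.α t)
      h := fun t => deriv P.α t / P.β t ^ 3 * η.h (P.α t) + P.σ * a t * E t
      m := m
      n := fun t => deriv P.α t / P.β t * η.n (P.α t) - deriv (fun s => P.γ s / P.β s) t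
        - P.σ ^ 2 * c t * E t ^ 2 + P.σ * f t * E t
      k := fun _ => 0 } with hξ
  have sm : ContDiffOn ℝ ∞ m I :=
    (sα.mul (sc hη.smooth_m)).add (sφ.div hV.smooth_φ fun t ht => n3 ht)
  have sE : ContDiffOn ℝ ∞ E I := contDiffOn_expInt hI sm ht₀
  have sαφ : ContDiffOn ℝ ∞ (fun t => deriv P.α t * P.φ t / P.β t ^ 3) I :=
    (sα.mul hV.smooth_φ).div (hV.smooth_β.pow 3) fun t ht => pow_ne_zero _ (n2 ht)
  have sa : ContDiffOn ℝ ∞ a I := sαφ.mul (sc hη.smooth_a)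
  have sC : ContDiffOn ℝ ∞ c I :=
    ((sα.mul (hV.smooth_φ.pow 2)).div hV.smooth_β fun t ht => n2 ht).mul (sc hη.smooth_c)
  have sf : ContDiffOn ℝ ∞ f I :=
    (((sα.mul hV.smooth_φ).div hV.smooth_β fun t ht => n2 ht).mul (sc hη.smooth_f)).add
      ((contDiffOn_const.mul sC).mul sE)
  have hE' : ∀ t ∈ I, expInt t₀ (ξ.restrict I) t = E t := fun t ht =>
    expInt_congr hI.ordConnected (fun s hs => indicator_of_mem hs _) ht₀ ht
  refine ⟨ξ.restrict I, Coeffs.memClass_restrict sa (sαφ.mul (sc hη.smooth_b)) sC sf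
    ((sα.div (hV.smooth_β.pow 5) fun t ht => pow_ne_zero _ (n2 ht)).mul (sc hη.smooth_g))
    (((sα.div (hV.smooth_β.pow 3) fun t ht => pow_ne_zero _ (n2 ht)).mul (sc hη.smooth_h)).add
      ((contDiffOn_const.mul sa).mul sE)) sm
    (((((sα.div hV.smooth_β fun t ht => n2 ht).mul (sc hη.smooth_n)).sub sγ).sub
      ((contDiffOn_const.mul sC).mul (sE.pow 2))).add ((contDiffOn_const.mul sf).mul sE))
    (fun _ _ => rfl) ?_, ?_⟩
  · intro t ht
    have h0 := hη.ne_zero _ (hαJ ht)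
    have m1 := n1 ht
    have m2 := n2 ht
    have m3 := n3 ht
    simp only [hξ, ha, hc]
    refine mul_ne_zero (mul_ne_zero (by positivity) (left_ne_zero_of_mul h0)) fun h1 => ?_
    have e1 := (add_eq_zero_iff_of_nonneg (by positivity) (by positivity)).1 h1
    have e2 := (add_eq_zero_iff_of_nonneg (by positivity) (by positivity)).1 e1.1
    have ea : η.a (P.α t) = 0 := by simpa [m1, m2, m3] using e2.1
    have eb : η.b (P.α t) = 0 := by simpa [m1, m2, m3] using e2.2
    have ec : η.c (P.α t) = 0 := by simpa [m1, m2, m3] using e1.2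
    exact h0 (by rw [ea, eb, ec]; ring)
  · constructor <;> intro t ht <;> have m1 := n1 ht <;> have m2 := n2 ht <;> have m3 := n3 ht <;>
      (try rw [hE' t ht]) <;>
      simp only [Coeffs.restrict, indicator_of_mem ht, hξ, hf, ha, hc, hm, hηk _ (hαJ ht),
        deriv_β_eq_zero hI.1 hB ht] <;>
      field_simp <;> ring

/-- The action on the arbitrary elements. -/
theorem Valid.exists_equiv (hV : P.Valid I J) (hI : IsOpenInterval I)
    {t₀ : ℝ} (ht₀ : t₀ ∈ I) (hB : ∃ B : ℝ, ∀ t ∈ I, P.β t = B) :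
    ∃ E : Subclass I ≃ Subclass J, ∀ θ : Subclass I, P.CoeffRel I t₀ θ.1 (E θ).1 := by
  have h1 : ∀ θ : Subclass I, ∃ η : Subclass J, P.CoeffRel I t₀ θ.1 η.1 := fun θ => by
    obtain ⟨η, hη, hR⟩ := hV.exists_coeffRel_right hI ht₀ hB θ.2.1 θ.2.2
    exact ⟨⟨η, hη⟩, hR⟩
  choose E hE using h1
  refine ⟨Equiv.ofBijective E ⟨fun θ θ' h => ?_, fun η => ?_⟩, hE⟩
  · have h2 := hE θ'
    rw [← h] at h2
    exact Subtype.ext (CoeffRel.unique_left hV hI ht₀ (hE θ) h2 θ.2.1.restrict_eq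
      θ'.2.1.restrict_eq)
  · obtain ⟨θ, hθ, hR⟩ := hV.exists_coeffRel_left hI ht₀ hB η.2.1 η.2.2
    refine ⟨⟨θ, hθ⟩, Subtype.ext ?_⟩
    exact CoeffRel.unique_right hV (hE ⟨θ, hθ⟩) hR (E ⟨θ, hθ⟩).2.1.restrict_eq η.2.1.restrict_eq

end Params

/-! ### Composition and inversion of point transformations -/

theorem isInvertible_of_comp_right {E : Type*} [NormedAddCommGroup E] [NormedSpace ℝ E]
    {A B : E →L[ℝ] E} (hB : B.IsInvertible) (h : (A.comp B).IsInvertible) : A.IsInvertible := by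
  obtain ⟨e, rfl⟩ := hB
  simpa using h

theorem isInvertible_of_comp_left {E : Type*} [NormedAddCommGroup E] [NormedSpace ℝ E]
    {A B : E →L[ℝ] E} (hA : A.IsInvertible) (h : (A.comp B).IsInvertible) : B.IsInvertible := by
  obtain ⟨e, rfl⟩ := hA
  simpa using h

theorem isInvertible_id {E : Type*} [NormedAddCommGroup E] [NormedSpace ℝ E] :
    (ContinuousLinearMap.id ℝ E).IsInvertible := ⟨ContinuousLinearEquiv.refl ℝ E, rfl⟩

theorem MapsGraph.eventually_eq {F : Space → Space} {u v : ℝ × ℝ → ℝ} {p : ℝ × ℝ}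
    (h : MapsGraph F u v p) : ∀ᶠ q in 𝓝 p,
      F (q.1, q.2, u q) = ((baseMap F u q).1, (baseMap F u q).2, v (baseMap F u q)) :=
  h.2.mono fun _ hq => Prod.ext rfl (Prod.ext rfl hq)

namespace IsPointTransf

variable {I J K : Set ℝ} {θ η ζ : Coeffs} {Ω Ω' : Set Space} {F G : Space → Space}

/-- The Jacobian is `T_t X_x`, whatever the graph. Composition needs this: the intermediate image of
a graph must itself be a graph. -/
theorem isInvertible_baseMap (h : IsPointTransf I J θ η Ω F) (hθ : θ.MemClass I)
    (hη : η.MemClass J) (hJ : IsOpen J) (hθk : ∀ t ∈ I, θ.k t = 0) (hηk : ∀ t ∈ J, η.k t = 0)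
    {u : ℝ × ℝ → ℝ} {p : ℝ × ℝ} (hp : (p.1, p.2, u p) ∈ Ω) (hu : ContDiffAt ℝ ∞ u p) :
    (fderiv ℝ (baseMap F u) p).IsInvertible := by
  have D := h.determining hθ hη hJ hθk hηk hp
  refine isInvertible_fderiv_baseMap (h.contDiffAt hp) hu rfl rfl ?_
  rw [D.Tx, D.Tu, D.Xu]
  simpa using ⟨D.Tt, D.Xx⟩

/-- The composition of point transformations. -/
theorem comp (h₁ : IsPointTransf I J θ η Ω F) (h₂ : IsPointTransf J K η ζ Ω' G)
    (hm : MapsTo F Ω Ω')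
    (hB : ∀ (u : ℝ × ℝ → ℝ) (p : ℝ × ℝ), (p.1, p.2, u p) ∈ Ω → ContDiffAt ℝ ∞ u p →
      (fderiv ℝ (baseMap F u) p).IsInvertible) :
    IsPointTransf I K θ ζ Ω (G ∘ F) := by
  refine ⟨h₁.isOpen, h₁.isConnected, h₁.subset, fun z hz => h₂.mapsTo _ (hm hz),
    h₂.smooth.comp h₁.smooth hm, fun z hz => ?_, fun u v p hp hu hv hg => ?_⟩
  · rw [fderiv_comp z ((h₂.contDiffAt (hm hz)).differentiableAt (by simp))
      ((h₁.contDiffAt hz).differentiableAt (by simp))]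
    exact (h₂.nondegenerate _ (hm hz)).comp (h₁.nondegenerate z hz)
  · obtain ⟨w, hw, hgw⟩ := exists_image_graph (h₁.contDiffAt hp) hu (hB u p hp hu)
    have e : ∀ᶠ q in 𝓝 p, baseMap (G ∘ F) u q = baseMap G w (baseMap F u q) := by
      filter_upwards [hgw.eventually_eq] with q hq
      simp only [baseMap, Function.comp_apply]
      rw [hq]
    have ep := e.self_of_nhds
    have hmem : ((baseMap F u p).1, (baseMap F u p).2, w (baseMap F u p)) ∈ Ω' := by
      rw [← hgw.eventually_eq.self_of_nhds]
      exact hm hp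
    have sF := contDiffAt_baseMap (h₁.contDiffAt hp) hu
    have sG := contDiffAt_baseMap (h₂.contDiffAt hmem) hw
    -- The relation between `u` and `v` is known near `p`. The local inverse `Q` transports it to a
    -- neighbourhood of `baseMap F u p`, where it relates `w` and `v`.
    obtain ⟨Q, hQs, hQp, -, hQr⟩ := exists_local_inverse sF (hB u p hp hu)
    have hQ : Tendsto Q (𝓝 (baseMap F u p)) (𝓝 p) := by
      have := hQs.continuousAt.tendsto
      rwa [hQp] at this
    rw [ep] at hv ⊢
    refine (h₁.satisfies_iff u w p hp hu hw hgw).trans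
      (h₂.satisfies_iff w v (baseMap F u p) hmem hw hv ⟨?_, ?_⟩)
    · refine isInvertible_of_comp_right (hB u p hp hu) ?_
      rw [← fderiv_comp p (sG.differentiableAt (by simp)) (sF.differentiableAt (by simp)),
        ← Filter.EventuallyEq.fderiv_eq (f := baseMap G w ∘ baseMap F u) e]
      exact hg.1
    · filter_upwards [hQr, hQ.eventually (hg.2.and (e.and hgw.eventually_eq))] with y h1 h2
      obtain ⟨h2, h3, h4⟩ := h2
      rw [Function.comp_apply, h3, h4, h1] at h2
      exact h2

/-- The inverse of a point transformation. -/
theorem symm (h : IsPointTransf I J θ η Ω F) (hΩ' : IsOpen Ω') (hc : IsConnected Ω')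
    (hJ : ∀ z ∈ Ω', z.1 ∈ J) (hG : MapsTo G Ω' Ω) (hl : ∀ z ∈ Ω, G (F z) = z)
    (hr : ∀ z ∈ Ω', F (G z) = z) : IsPointTransf J I η θ Ω' G := by
  -- Smoothness of `G` is not assumed; near each point `G` agrees with a smooth local inverse of
  -- `F`.
  have sG : ∀ z ∈ Ω', ContDiffAt ℝ ∞ G z := by
    intro z hz
    obtain ⟨Q, hQs, hQp, -, hQr⟩ :=
      exists_local_inverse (h.contDiffAt (hG hz)) (h.nondegenerate _ (hG hz))
    rw [hr z hz] at hQs hQp hQr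
    have hQΩ : ∀ᶠ y in 𝓝 z, Q y ∈ Ω :=
      hQs.continuousAt.eventually_mem (by rw [hQp]; exact h.isOpen.mem_nhds (hG hz))
    refine hQs.congr_of_eventuallyEq ?_
    filter_upwards [hQr, hQΩ] with y h1 h2
    rw [← hl _ h2, h1]
  refine ⟨hΩ', hc, hJ, fun z hz => h.subset _ (hG hz), fun z hz => (sG z hz).contDiffWithinAt,
    fun z hz => ?_, fun v u p hp hv hu hg => ?_⟩
  · refine isInvertible_of_comp_left (h.nondegenerate _ (hG hz)) ?_
    rw [← fderiv_comp z ((h.contDiffAt (hG hz)).differentiableAt (by simp))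
      ((sG z hz).differentiableAt (by simp))]
    have : F ∘ G =ᶠ[𝓝 z] id := by
      filter_upwards [hΩ'.mem_nhds hz] with y hy using hr y hy
    rw [this.fderiv_eq, fderiv_id]
    exact isInvertible_id
  · have sB := contDiffAt_baseMap (sG _ hp) hv
    have hmem : ((baseMap G v p).1, (baseMap G v p).2, u (baseMap G v p)) ∈ Ω := by
      rw [← hg.eventually_eq.self_of_nhds]
      exact hG hp
    have hpΩ : ∀ᶠ q in 𝓝 p, ((q.1, q.2, v q) : Space) ∈ Ω' :=
      (continuousAt_fst.prodMk (continuousAt_snd.prodMk hv.continuousAt)).eventually_mem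
        (hΩ'.mem_nhds hp)
    have e : ∀ᶠ q in 𝓝 p, F ((baseMap G v q).1, (baseMap G v q).2, u (baseMap G v q))
        = (q.1, q.2, v q) := by
      filter_upwards [hpΩ, hg.eventually_eq] with q h1 h2
      rw [← h2, hr _ h1]
    have e' : ∀ᶠ q in 𝓝 p, baseMap F u (baseMap G v q) = q := by
      filter_upwards [e] with q hq
      rw [baseMap, hq]
    have ep := e'.self_of_nhds
    obtain ⟨Q, hQs, hQp, -, hQr⟩ := exists_local_inverse sB hg.1
    have hQ : Tendsto Q (𝓝 (baseMap G v p)) (𝓝 p) := by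
      have := hQs.continuousAt.tendsto
      rwa [hQp] at this
    have sF := contDiffAt_baseMap (h.contDiffAt hmem) hu
    have key := h.satisfies_iff u v (baseMap G v p) hmem hu (by rw [ep]; exact hv) ⟨?_, ?_⟩
    · rw [ep] at key
      exact key.symm
    · refine isInvertible_of_comp_right hg.1 ?_
      rw [← fderiv_comp p (sF.differentiableAt (by simp)) (sB.differentiableAt (by simp)),
        Filter.EventuallyEq.fderiv_eq (show baseMap F u ∘ baseMap G v =ᶠ[𝓝 p] id from e'),
        fderiv_id]
      exact isInvertible_id
    · filter_upwards [hQr, hQ.eventually (e.and e')] with y h1 h2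
      rw [h1] at h2
      rw [h2.1, h2.2]

end IsPointTransf

/-! ### Bijectivity of the maps of the given form and restriction in time -/

namespace Params

variable {P : Params} {I J : Set ℝ} {t₀ : ℝ}

theorem Valid.mapsTo_α (hV : P.Valid I J) {t : ℝ} (ht : t ∈ I) : P.α t ∈ J := by
  rw [← hV.image_eq]
  exact mem_image_of_mem _ ht

theorem Valid.isOpenInterval (hV : P.Valid I J) (hI : IsOpenInterval I) : IsOpenInterval J := by
  rw [← hV.image_eq]
  refine ⟨isOpen_iff_mem_nhds.2 ?_, hI.2.image _ hV.smooth_α.continuousOn⟩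
  rintro _ ⟨t, ht, rfl⟩
  have hs : HasStrictDerivAt P.α (deriv P.α t) t :=
    (hV.smooth_α.contDiffAt (hI.1.mem_nhds ht)).hasStrictDerivAt (by simp)
  rw [← hs.map_nhds_eq (hV.ne ht).1]
  exact image_mem_map (hI.1.mem_nhds ht)

theorem Valid.exists_pointMap_eq (hV : P.Valid I J) (θ : Coeffs) {w : Space} (hw : w.1 ∈ J) :
    ∃ z : Space, z.1 ∈ I ∧ P.pointMap t₀ θ z = w := by
  rw [← hV.image_eq] at hw
  obtain ⟨t, ht, hw⟩ := hw
  obtain ⟨-, h2, h3⟩ := hV.ne ht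
  refine ⟨(t, (w.2.1 - P.γ t) / P.β t, w.2.2 / P.φ t - P.σ * expInt t₀ θ t), ht, ?_⟩
  refine Prod.ext hw (Prod.ext ?_ ?_)
  · simp only [pointMap]
    field_simp
    ring
  · simp only [pointMap]
    field_simp
    ring

theorem Valid.injOn_pointMap (hV : P.Valid I J) (hI : IsOpenInterval I) (θ : Coeffs) :
    InjOn (P.pointMap t₀ θ) {z | z.1 ∈ I} := by
  rintro ⟨t, x, u⟩ ht ⟨t', x', u'⟩ ht' h
  simp only [pointMap, Prod.mk.injEq] at h
  obtain rfl : t = t' := hV.injOn_α hI ht ht' h.1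
  obtain ⟨-, h2, h3⟩ := hV.ne ht
  have e2 : x = x' := mul_left_cancel₀ h2 (by linarith [h.2.1])
  have e3 := mul_left_cancel₀ h3 h.2.2
  rw [e2, add_right_cancel e3]

theorem pointMap_congr {θ θ' : Coeffs} (hI : IsOpenInterval I) (ht₀ : t₀ ∈ I)
    (h : EqOn θ.m θ'.m I) {z : Space} (hz : z.1 ∈ I) :
    P.pointMap t₀ θ z = P.pointMap t₀ θ' z := by
  simp only [pointMap, expInt_congr hI.ordConnected h ht₀ hz]

theorem CoeffRel.restrict {θ η : Coeffs} (hV : P.Valid I J) (hI : IsOpenInterval I) (ht₀ : t₀ ∈ I)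
    (h : P.CoeffRel I t₀ θ η) : P.CoeffRel I t₀ (θ.restrict I) (η.restrict J) := by
  have hE : ∀ t ∈ I, expInt t₀ (θ.restrict I) t = expInt t₀ θ t := fun t ht =>
    expInt_congr hI.ordConnected (fun s hs => indicator_of_mem hs _) ht₀ ht
  constructor <;> intro t ht <;> (try rw [hE t ht]) <;>
    simp only [Coeffs.restrict, indicator_of_mem ht, indicator_of_mem (hV.mapsTo_α ht)]
  exacts [h.a_eq t ht, h.b_eq t ht, h.c_eq t ht, h.f_eq t ht, h.g_eq t ht, h.h_eq t ht,
    h.m_eq t ht, h.n_eq t ht, h.k_eq t ht]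

end Params

/-! ### The equivalence group and normalization -/

section equiv

variable {I J K : Set ℝ} {t₀ : ℝ}

/-- Transformations of the given form are equivalence transformations. -/
theorem isEquivTransf_of_givesAt (hI : IsOpenInterval I) (hJ : IsOpenInterval J) (ht₀ : t₀ ∈ I)
    {𝒯 : Joint I ≃ Joint J} (h : ∀ θ : Subclass I, ∃ P : Params, P.Valid I J ∧
      (∃ B : ℝ, ∀ t ∈ I, P.β t = B) ∧ P.GivesAt t₀ 𝒯 θ) : IsEquivTransf 𝒯 := by
  choose P hV hB hG using h
  set z₀ : Cyl I := ⟨(t₀, 0, 0), ht₀⟩ with hz₀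
  -- The parameters depend on `θ` but not on the point, and together with `θ` they determine the new
  -- arbitrary elements.
  have hE : ∀ θ z, (𝒯 (θ, z)).1 = (𝒯 (θ, z₀)).1 := fun θ z => Subtype.ext
    ((hG θ z).2.unique_right (hV θ) (hG θ z₀).2 (𝒯 (θ, z)).1.2.1.restrict_eq
      (𝒯 (θ, z₀)).1.2.1.restrict_eq)
  -- Injectivity comes from `𝒯`. The point map at `θ'` is onto the cylinder over `J`, so if `θ` and
  -- `θ'` had the same new arbitrary elements, `𝒯 (θ, z₀)` would also be attained over `θ'`.
  have hbij : Function.Bijective fun θ => (𝒯 (θ, z₀)).1 := by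
    refine ⟨fun θ θ' heq => ?_, fun η => ?_⟩
    · obtain ⟨z, hz, hzw⟩ := (hV θ').exists_pointMap_eq (t₀ := t₀) θ'.1 (𝒯 (θ, z₀)).2.2
      have h1 : 𝒯 (θ', ⟨z, hz⟩) = 𝒯 (θ, z₀) :=
        Prod.ext ((hE θ' _).trans heq.symm) (Subtype.ext ((hG θ' ⟨z, hz⟩).1.trans hzw))
      exact (congrArg Prod.fst (𝒯.injective h1)).symm
    · obtain ⟨s, hs⟩ := hJ.2.nonempty
      obtain ⟨⟨θ, z⟩, h1⟩ := 𝒯.surjective (η, ⟨(s, 0, 0), hs⟩)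
      exact ⟨θ, (hE θ z).symm.trans (congrArg Prod.fst h1)⟩
  refine ⟨Equiv.ofBijective _ hbij, fun θ => (P θ).pointMap t₀ θ.1,
    fun θ z => ⟨hE θ z, (hG θ z).1⟩, fun θ => ?_⟩
  exact (hV θ).isPointTransf_pointMap hI ht₀ (hB θ) θ.2.1 θ.2.2 (hG θ z₀).2

/-- Equivalence transformations are of the given form. -/
theorem IsEquivTransf.exists_givesAt (hJ : IsOpenInterval J) (ht₀ : t₀ ∈ I)
    {𝒯 : Joint I ≃ Joint J} (h : IsEquivTransf 𝒯) (θ : Subclass I) : ∃ P : Params, P.Valid I J ∧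
      (∃ B : ℝ, ∀ t ∈ I, P.β t = B) ∧ P.GivesAt t₀ 𝒯 θ := by
  obtain ⟨E, F, hEF, hF⟩ := h
  -- `mapsTo` gives one inclusion only. For the other, a preimage under `𝒯` of a point over `E θ`
  -- lies over `θ` because `E` is injective.
  have himg : (fun z => (F θ z).1) '' {z : Space | z.1 ∈ I} = J := by
    ext s
    constructor
    · rintro ⟨z, hz, rfl⟩
      exact (hF θ).mapsTo z hz
    · intro hs
      obtain ⟨⟨θ', z⟩, h1⟩ := 𝒯.surjective (E θ, ⟨(s, 0, 0), hs⟩)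
      obtain ⟨h2, h3⟩ := hEF θ' z
      rw [h1] at h2 h3
      obtain rfl := E.injective h2
      exact ⟨z, z.2, by simp only [← h3]⟩
  obtain ⟨P, hV, hB, hP, hR⟩ := (hF θ).exists_params (t₀ := t₀) hJ θ.2.1 (E θ).2.1 θ.2.2 (E θ).2.2
    (by rw [image_fst_cyl]; exact ht₀)
  rw [image_fst_cyl] at hV hB hR
  rw [himg] at hV
  refine ⟨P, hV, hB, fun z => ⟨(hEF θ z).2.trans (hP z z.2), ?_⟩⟩
  rw [(hEF θ z).1]
  exact hR

/-- Parameters that are the same for all arbitrary elements give an equivalence transformation. -/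
theorem Params.Valid.exists_isEquivTransf {P : Params} (hV : P.Valid I J) (hI : IsOpenInterval I)
    (hJ : IsOpenInterval J) (ht₀ : t₀ ∈ I) (hB : ∃ B : ℝ, ∀ t ∈ I, P.β t = B) :
    ∃ 𝒯 : Joint I ≃ Joint J, IsEquivTransf 𝒯 ∧ ∀ θ : Subclass I, P.GivesAt t₀ 𝒯 θ := by
  obtain ⟨E, hE⟩ := hV.exists_equiv hI ht₀ hB
  have hbij : Function.Bijective fun p : Joint I =>
      ((E p.1, ⟨P.pointMap t₀ p.1.1 p.2, hV.mapsTo_α p.2.2⟩) : Joint J) := by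
    constructor
    · rintro ⟨θ, z⟩ ⟨θ', z'⟩ h
      obtain ⟨h1, h2⟩ := Prod.ext_iff.1 h
      obtain rfl := E.injective h1
      exact Prod.ext rfl (Subtype.ext (hV.injOn_pointMap hI θ.1 z.2 z'.2 (Subtype.ext_iff.1 h2)))
    · rintro ⟨η, w⟩
      obtain ⟨θ, rfl⟩ := E.surjective η
      obtain ⟨z, hz, hzw⟩ := hV.exists_pointMap_eq (t₀ := t₀) θ.1 w.2
      exact ⟨(θ, ⟨z, hz⟩), Prod.ext rfl (Subtype.ext hzw)⟩
  have hG : ∀ θ : Subclass I, P.GivesAt t₀ (Equiv.ofBijective _ hbij) θ :=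
    fun θ z => ⟨rfl, hE θ⟩
  exact ⟨_, isEquivTransf_of_givesAt hI hJ ht₀ fun θ => ⟨P, hV, hB, hG θ⟩, hG⟩

theorem isEquivTransf_refl (hI : IsOpenInterval I) : IsEquivTransf (Equiv.refl (Joint I)) := by
  refine ⟨Equiv.refl _, fun _ => id, fun _ _ => ⟨rfl, rfl⟩, fun θ =>
    ⟨isOpen_cyl hI.1, isConnected_cyl hI.2, fun z hz => hz, fun z hz => hz, contDiffOn_id,
      fun z _ => by rw [fderiv_id]; exact isInvertible_id, fun u v p _ _ _ hm => ?_⟩⟩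
  have h1 : u =ᶠ[𝓝 p] v := hm.2
  have h2 : (fun s => u (s, p.2)) =ᶠ[𝓝 p.1] fun s => v (s, p.2) :=
    (continuousAt_id.prodMk continuousAt_const : ContinuousAt (fun s => (s, p.2)) p.1).eventually h1
  have h3 : (fun y => u (p.1, y)) =ᶠ[𝓝 p.2] fun y => v (p.1, y) :=
    (continuousAt_const.prodMk continuousAt_id : ContinuousAt (fun y => (p.1, y)) p.2).eventually h1
  change Satisfies θ.1 u p ↔ Satisfies θ.1 v p
  unfold Satisfies
  rw [h2.deriv_eq, h3.iteratedDeriv_eq 1, h3.iteratedDeriv_eq 2, h3.iteratedDeriv_eq 3,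
    h3.iteratedDeriv_eq 5, h1.self_of_nhds]

open Classical in
theorem IsEquivTransf.symm (hJ : IsOpenInterval J) {𝒯 : Joint I ≃ Joint J}
    (h : IsEquivTransf 𝒯) : IsEquivTransf 𝒯.symm := by
  obtain ⟨E, F, hEF, hF⟩ := h
  have hcomp : ∀ (θ : Subclass I) (z : Cyl I),
      𝒯.symm (E θ, ⟨F θ z, (hF θ).mapsTo z z.2⟩) = (θ, z) := by
    intro θ z
    rw [Equiv.symm_apply_eq]
    exact (Prod.ext (hEF θ z).1 (Subtype.ext (hEF θ z).2)).symm
  have hfst : ∀ (η : Subclass J) (w : Cyl J), (𝒯.symm (η, w)).1 = E.symm η := by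
    intro η w
    rw [Equiv.eq_symm_apply, ← (hEF _ (𝒯.symm (η, w)).2).1, Prod.mk.eta, Equiv.apply_symm_apply]
  -- The components are defined by the inverse on the cylinder over `J`; the default `0` off the
  -- cylinder plays no role.
  obtain ⟨G, hG⟩ : ∃ G : Subclass J → Space → Space,
      ∀ η (w : Space) (hw : w.1 ∈ J), G η w = (𝒯.symm (η, ⟨w, hw⟩)).2 :=
    ⟨fun η w => if hw : w.1 ∈ J then (𝒯.symm (η, ⟨w, hw⟩)).2 else 0, fun _ _ hw => dif_pos hw⟩
  refine ⟨E.symm, G, fun η w => ⟨hfst η w, (hG η w w.2).symm⟩, fun η => ?_⟩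
  obtain ⟨θ, rfl⟩ := E.surjective η
  rw [E.symm_apply_apply]
  refine (hF θ).symm (isOpen_cyl hJ.1) (isConnected_cyl hJ.2) (fun z hz => hz) (fun w hw => ?_)
    (fun z hz => ?_) (fun w hw => ?_)
  · rw [hG _ w hw]
    exact (𝒯.symm (E θ, ⟨w, hw⟩)).2.2
  · rw [hG _ _ ((hF θ).mapsTo z hz), hcomp θ ⟨z, hz⟩]
  · have h1 := hfst (E θ) ⟨w, hw⟩
    rw [E.symm_apply_apply] at h1
    have h2 : 𝒯.symm (E θ, ⟨w, hw⟩) = (θ, (𝒯.symm (E θ, ⟨w, hw⟩)).2) := Prod.ext h1 rfl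
    rw [hG _ w hw, ← (hEF θ _).2, ← h2, Equiv.apply_symm_apply]

theorem IsEquivTransf.trans (hJ : IsOpenInterval J)
    {𝒯 : Joint I ≃ Joint J} {𝒮 : Joint J ≃ Joint K} (h : IsEquivTransf 𝒯) (h' : IsEquivTransf 𝒮) :
    IsEquivTransf (𝒯.trans 𝒮) := by
  obtain ⟨E, F, hEF, hF⟩ := h
  obtain ⟨E', F', hEF', hF'⟩ := h'
  refine ⟨E.trans E', fun θ => F' (E θ) ∘ F θ, fun θ z => ?_, fun θ => ?_⟩
  · have h1 : 𝒯 (θ, z) = (E θ, (𝒯 (θ, z)).2) := Prod.ext (hEF θ z).1 rfl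
    have h2 := hEF' (E θ) (𝒯 (θ, z)).2
    rw [← h1, (hEF θ z).2] at h2
    exact h2
  · exact (hF θ).comp (hF' (E θ)) (fun z hz => (hF θ).mapsTo z hz) fun u p hp hu =>
      (hF θ).isInvertible_baseMap θ.2.1 (E θ).2.1 hJ.1 θ.2.2 (E θ).2.2 hp hu

theorem Subclass.restrict_mem (θ : Subclass I) (hJ : J ⊆ I) :
    (θ.1.restrict J).MemClass J ∧ ∀ t ∈ J, (θ.1.restrict J).k t = 0 :=
  Coeffs.memClass_restrict (θ.2.1.smooth_a.mono hJ) (θ.2.1.smooth_b.mono hJ)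
    (θ.2.1.smooth_c.mono hJ) (θ.2.1.smooth_f.mono hJ) (θ.2.1.smooth_g.mono hJ)
    (θ.2.1.smooth_h.mono hJ) (θ.2.1.smooth_m.mono hJ) (θ.2.1.smooth_n.mono hJ)
    (fun t ht => θ.2.2 t (hJ ht)) fun t ht => θ.2.1.ne_zero t (hJ ht)

/-- The parameters found for the given admissible transformation are used unchanged for every tuple
on the projected interval. At the restriction of `θ` the point map is still `F`, as `expInt`
involves only values of `m` on that interval, and uniqueness of the new arbitrary elements
identifies them with the restriction of `θ'`. -/
theorem isNormalized : IsNormalized := by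
  intro I I' _ hI' θ θ' Ω F h
  have hJ := isOpenInterval_image_fst h.isOpen h.isConnected
  obtain ⟨t₀, ht₀⟩ := hJ.2.nonempty
  obtain ⟨P, hV, hB, hP, hR⟩ := h.exists_params hI' θ.2.1 θ'.2.1 θ.2.2 θ'.2.2 ht₀
  have hJ' := hV.isOpenInterval hJ
  obtain ⟨𝒯, h𝒯, hG⟩ := hV.exists_isEquivTransf hJ hJ' ht₀ hB
  have hsub : Prod.fst '' Ω ⊆ I := by
    rintro _ ⟨z, hz, rfl⟩
    exact h.subset z hz
  have hsub' : (fun z => (F z).1) '' Ω ⊆ I' := by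
    rintro _ ⟨z, hz, rfl⟩
    exact h.mapsTo z hz
  refine ⟨_, _, ⟨_, θ.restrict_mem hsub⟩, ⟨_, θ'.restrict_mem hsub'⟩, 𝒯, hJ, hJ', rfl, rfl, rfl,
    rfl, h𝒯, fun z hz => ⟨Subtype.ext ?_, ?_⟩⟩
  · exact (hG _ z).2.unique_right hV (hR.restrict hV hJ ht₀) (𝒯 _).1.2.1.restrict_eq
      (Coeffs.restrict_restrict _ _)
  · refine (hG _ z).1.trans ?_
    rw [hP z hz]
    exact Params.pointMap_congr hJ ht₀ (fun s hs => indicator_of_mem hs _) z.2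

end equiv

end VCKdV

theorem corollary2 :
    -- the generalized extended equivalence transformations form a (pseudo)group
    (∀ I : Set ℝ, IsOpenInterval I → IsEquivTransf (Equiv.refl (Joint I))) ∧
    (∀ I J : Set ℝ, IsOpenInterval I → IsOpenInterval J →
      ∀ 𝒯 : Joint I ≃ Joint J, IsEquivTransf 𝒯 → IsEquivTransf 𝒯.symm) ∧
    (∀ I J K : Set ℝ, IsOpenInterval I → IsOpenInterval J → IsOpenInterval K →
      ∀ (𝒯 : Joint I ≃ Joint J) (𝒮 : Joint J ≃ Joint K),
        IsEquivTransf 𝒯 → IsEquivTransf 𝒮 → IsEquivTransf (𝒯.trans 𝒮)) ∧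
    -- it consists of the transformations of the given form with constant `β`
    (∀ I J : Set ℝ, IsOpenInterval I → IsOpenInterval J → ∀ t₀ ∈ I, ∀ 𝒯 : Joint I ≃ Joint J,
      IsEquivTransf 𝒯 ↔
        ∀ θ : Subclass I, ∃ P : Params, P.Valid I J ∧ (∃ B : ℝ, ∀ t ∈ I, P.β t = B) ∧
          P.GivesAt t₀ 𝒯 θ) ∧
    -- any choice of the parameters, the same for all arbitrary elements, gives an element of it
    (∀ I J : Set ℝ, IsOpenInterval I → IsOpenInterval J → ∀ t₀ ∈ I, ∀ P : Params,
      P.Valid I J → (∃ B : ℝ, ∀ t ∈ I, P.β t = B) →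
        ∃ 𝒯 : Joint I ≃ Joint J, IsEquivTransf 𝒯 ∧ ∀ θ : Subclass I, P.GivesAt t₀ 𝒯 θ) ∧
    -- the subclass is normalized
    IsNormalized :=
  ⟨fun _ hI => isEquivTransf_refl hI, fun _ _ _ hJ _ h => h.symm hJ,
    fun _ _ _ _ hJ _ _ _ h h' => h.trans hJ h',
    fun _ _ hI hJ _ ht₀ _ => ⟨fun h θ => h.exists_givesAt hJ ht₀ θ,
      isEquivTransf_of_givesAt hI hJ ht₀⟩,
    fun _ _ hI hJ _ ht₀ _ hV hB => hV.exists_isEquivTransf hI hJ ht₀ hB, isNormalized⟩
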